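/- For $m\ge 0$, represent a set partition $P$ of a set of $m$ consecutive integers by its arc diagram: for $i<j$ there is an arc $(i,j)$ when $i,j$ are consecutive elements of a block, and there is a loop $(i,i)$ when $\{i\}$ is a block. A $k$-crossing is a set of arcs $(i_1,j_1),\dots,(i_k,j_k)$ with $i_1<\dots<i_k<j_1<\dots<j_k$; a weak $k$-crossing is one with $i_1<\dots<i_k=j_1<\dots<j_k$, and $i_k=j_1$ is its center; an enhanced $k$-crossing is a crossing of either kind. Let $\mathrm{NC}_m^{(k)}$ (resp. $\mathrm{NW}_m^{(k)}$) be the set of partitions of $\{0,\dots,m-1\}$ without $k$-crossings (resp. enhanced $k$-crossings). For a partition $P$ of $\{0,\dots,n\}$, the block $\mathrm{red}(P)$ containing $0$, its elements and its arcs are red; all other blocks, elements and arcs are black. A crossing is black if all its arcs are black, and red otherwise. Let $\mathrm{BNW}_{n+1}^{(k)}$ be the set of partitions of $\{0,\dots,n\}$ without black enhanced $k$-crossings. A node $a$ is under a crossing if $i_s<a<j_s$ for all $s$. The innermost black $(k-1)$-crossing covering $a$ is the one, among the black $(k-1)$-crossings that $a$ is under, with lexicographically smallest word $j_1j_2\cdots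 j_{k-1}$. Let $w(P)=t^{|P|}$, where $|P|$ is the number of blocks. **Operations.** *Enhanced left shift.* Let $a$ be the smallest red node under a black $(k-1)$-crossing, and $(i_1,j_1),\dots,(i_{k-1},j_{k-1})$ the innermost one covering $a$. Replace these black arcs by $(i_1,a),(i_2,j_1),\dots,(i_{k-1},j_{k-2}),(a,j_{k-1})$ and remove $a$ from the red block. *Cyclic rotation.* Let $(i_p,j_p)$ be the rightmost red arc lying in a $k$-crossing, and $(i_1,j_1),\dots,(i_k,j_k)$ the $k$-crossing containing it with lexicographically greatest word $j_1\cdots j_k$. Replace its arcs by $(i_1,j_2),\dots,(i_{p-1},j_p),(i_p,j_1),(i_{p+1},j_{p+1}),\dots,(i_k,j_k)$. *Undoing a cyclic rotation.* Let $a$ be the smallest red node under a black $(k-1)$-crossing, $a'$ the largest red node smaller than $a$, $(i_1,j_1),\dots,(i_{k-1},j_{k-1})$ the innermost black $(k-1)$-crossing covering $a$, and $1\le t<k-1$ with $i_t<a'<i_{t+1}$. Replace these arcs and $(a',a)$ by $(i_1,a),(i_2,j_1),\dots,(i_t,j_{t-1}),(a',j_t),(i_{t+1},j_{t+1}),\dots,(i_{k-1},j_{k-1})$.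 *Undoing an enhanced left shift.* Let $a$ be the largest center of a black weak $k$-crossing, and $(i_1,a),(i_2,j_1),\dots,(i_{k-1},j_{k-2}),(a,j_{k-1})$ the black weak $k$-crossing with center $a$ whose word of right ends is lexicographically greatest. Replace its arcs by $(i_1,j_1),\dots,(i_{k-1},j_{k-1})$ and add $a$ to the red block. After each operation, the red block is again the block containing $0$. **Theorem.** Let $n\ge 0$ and $k\ge 2$. There is a bijection $\Phi:\mathrm{BNW}_{n+1}^{(k)}\to\mathrm{NC}_{n+1}^{(k)}$ such that: 1. For every $P\in\mathrm{BNW}_{n+1}^{(k)}$ the following procedure terminates, and its unique output is $\Phi(P)$: if $P\in\mathrm{BNW}_{n+1}^{(k-1)}$, return $P$; otherwise apply enhanced left shifts until no red node is under a black $(k-1)$-crossing, and then cyclic rotations until there is no red $k$-crossing. 2. For every $Q\in\mathrm{NC}_{n+1}^{(k)}$ the following procedure terminates, and its unique output is $\Phi^{-1}(Q)$: if $Q\in\mathrm{BNW}_{n+1}^{(k-1)}$, return $Q$; otherwise undo cyclic rotations until no red node is under a black $(k-1)$-crossing, and then undo enhanced left shifts until there is no black weak $k$-crossing. 3. $|\Phi(P)|=|P|$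 for all $P\in\mathrm{BNW}_{n+1}^{(k)}$. Moreover, $$\sum_{P\in \mathrm{BNW}_{n+1}^{(k)}}w(P)=\sum_{P\in \mathrm{NC}_{n+1}^{(k)}}w(P);$$ for every $A\subseteq\{1,\dots,n\}$, $$\sum_{\substack{P\in \mathrm{BNW}_{n+1}^{(k)}\\ \mathrm{red}(P)=\{0,\dots,n\}\setminus A}}w(P)=t\sum_{P\in\mathrm{NW}_{|A|}^{(k)}}w(P);$$ and $$\sum_{P\in \mathrm{BNW}_{n+1}^{(k)}}w(P)=t\sum_{i=0}^n\binom ni\sum_{P\in\mathrm{NW}_i^{(k)}}w(P),$$ so that the first identity is equivalent to $\sum_{P\in \mathrm{NC}_{n+1}^{(k)}}w(P)=t\sum_{i=0}^n\binom ni\sum_{P\in\mathrm{NW}_i^{(k)}}w(P)$. -/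

import Mathlib

open Polynomial

namespace KNoncrossing

/-- A set partition of the node set `{0, 1, …, n - 1}` (all blocks are nonempty). -/
abbrev SetPartition (n : ℕ) : Type := Finpartition (Finset.univ : Finset (Fin n))

/-- The number of blocks. -/
abbrev numBlocks {n : ℕ} (P : SetPartition n) : ℕ := P.parts.card

/-- `(i, j)` is an arc of the arc diagram of `P`: either `i < j` are consecutive elements of a
block of `P`, or `i = j` and `{i}` is a block of `P` (a loop). -/
def IsArc {n : ℕ} (P : SetPartition n) (i j : Fin n) : Prop :=
  (i < j ∧ j ∈ P.part i ∧ ∀ l ∈ P.part i, ¬ (i < l ∧ l < j)) ∨ (i = j ∧ P.part i = {i})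

/-- The arcs `(i 0, j 0), …, (i (k - 1), j (k - 1))` of `P` form a `k`-crossing:
`i 0 < ⋯ < i (k - 1) < j 0 < ⋯ < j (k - 1)`. -/
def IsCrossing {n k : ℕ} (P : SetPartition n) (i j : Fin k → Fin n) : Prop :=
  (∀ s, IsArc P (i s) (j s)) ∧ StrictMono i ∧ StrictMono j ∧ ∀ s t, i s < j t

/-- The arcs `(i 0, j 0), …, (i (k - 1), j (k - 1))` of `P` form a weak `k`-crossing:
`i 0 < ⋯ < i (k - 1) = j 0 < ⋯ < j (k - 1)`. -/
def IsWeakCrossing {n k : ℕ} (P : SetPartition n) (i j : Fin k → Fin n) : Prop :=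
  (∀ s, IsArc P (i s) (j s)) ∧ StrictMono i ∧ StrictMono j ∧
    ∀ s t : Fin k, (s : ℕ) + 1 = k → (t : ℕ) = 0 → i s = j t

/-- An enhanced `k`-crossing is a `k`-crossing or a weak `k`-crossing. -/
def IsEnhancedCrossing {n k : ℕ} (P : SetPartition n) (i j : Fin k → Fin n) : Prop :=
  IsCrossing P i j ∨ IsWeakCrossing P i j

/-- The red block of a partition of `{0, …, n}`: the block containing `0`. -/
def red {n : ℕ} (P : SetPartition (n + 1)) : Finset (Fin (n + 1)) := P.part 0

/-- All arcs of `P`, red or black, loops included. -/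
def arcs {n : ℕ} (P : SetPartition n) : Set (Fin n × Fin n) := {e | IsArc P e.1 e.2}

/-- The black arcs of `P`, i.e. the arcs outside the red block. -/
def blackArcs {n : ℕ} (P : SetPartition (n + 1)) : Set (Fin (n + 1) × Fin (n + 1)) :=
  {e | IsArc P e.1 e.2 ∧ e.1 ∉ red P}

/-- A `k`-crossing all of whose arcs are black. -/
def IsBlackCrossing {n k : ℕ} (P : SetPartition (n + 1)) (i j : Fin k → Fin (n + 1)) : Prop :=
  IsCrossing P i j ∧ ∀ s, i s ∉ red P

/-- A weak `k`-crossing all of whose arcs are black. -/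
def IsBlackWeakCrossing {n k : ℕ} (P : SetPartition (n + 1)) (i j : Fin k → Fin (n + 1)) :
    Prop :=
  IsWeakCrossing P i j ∧ ∀ s, i s ∉ red P

open Classical in
/-- The `k`-noncrossing partitions of `{0, …, n - 1}`. -/
noncomputable def NC (n k : ℕ) : Finset (SetPartition n) :=
  {P | ∀ i j : Fin k → Fin n, ¬ IsCrossing P i j}

open Classical in
/-- The enhanced `k`-noncrossing partitions of `{0, …, n - 1}`. -/
noncomputable def NW (n k : ℕ) : Finset (SetPartition n) :=
  {P | ∀ i j : Fin k → Fin n, ¬ IsEnhancedCrossing P i j}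

open Classical in
/-- The partitions of `{0, …, n}` without black enhanced `k`-crossings. -/
noncomputable def BNW (n k : ℕ) : Finset (SetPartition (n + 1)) :=
  {P | ∀ i j : Fin k → Fin (n + 1), ¬ IsBlackCrossing P i j ∧ ¬ IsBlackWeakCrossing P i j}

/-- The weight `t ^ (number of blocks)`, with `t` the polynomial variable. -/
noncomputable def weight {n : ℕ} (P : SetPartition n) : ℕ[X] := X ^ numBlocks P

/-- The node `a` is under the `k`-crossing with left ends `i` and right ends `j`. -/
def Under {n k : ℕ} (i j : Fin k → Fin n) (a : Fin n) : Prop := ∀ s, i s < a ∧ a < j s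

/-- The red nodes lying under some black `m`-crossing. -/
def coveredRed {n : ℕ} (m : ℕ) (P : SetPartition (n + 1)) : Set (Fin (n + 1)) :=
  {a | a ∈ red P ∧ ∃ i j : Fin m → Fin (n + 1), IsBlackCrossing P i j ∧ Under i j a}

/-- `(i, j)` is the innermost black `m`-crossing covering `a`: among these crossings, the word
`j 0, j 1, …, j (m - 1)` of right ends is lexicographically smallest. -/
def IsInnermost {n m : ℕ} (P : SetPartition (n + 1)) (a : Fin (n + 1))
    (i j : Fin m → Fin (n + 1)) : Prop :=
  IsBlackCrossing P i j ∧ Under i j a ∧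
    ∀ i' j' : Fin m → Fin (n + 1), IsBlackCrossing P i' j' → Under i' j' a → toLex j ≤ toLex j'

/-- The set of arcs `(i s, j s)`. -/
def pairs {n k : ℕ} (i j : Fin k → Fin n) : Set (Fin n × Fin n) :=
  Set.range fun s => (i s, j s)

/-- The word `i 0, …, i (m - 1), a`. -/
def append {n m : ℕ} (i : Fin m → Fin n) (a : Fin n) : Fin (m + 1) → Fin n :=
  Fin.snoc (α := fun _ => Fin n) i a

/-- The word `a, j 0, …, j (m - 1)`. -/
def prepend {n m : ℕ} (a : Fin n) (j : Fin m → Fin n) : Fin (m + 1) → Fin n :=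
  Fin.cons (α := fun _ => Fin n) a j

/-- The word `i 0, …, i (t - 1), b, i t, …, i (m - 1)`. -/
def insertAt {n m : ℕ} (t : Fin (m + 1)) (b : Fin n) (i : Fin m → Fin n) : Fin (m + 1) → Fin n :=
  Fin.insertNth (α := fun _ => Fin n) t b i

/-- One enhanced left shift, `P ↦ Q`. Let `a` be the smallest red node under a black
`(k - 1)`-crossing and `(i₁, j₁), …, (i_{k-1}, j_{k-1})` the innermost black `(k - 1)`-crossing
covering `a`. Replace these black arcs by `(i₁, a), (i₂, j₁), …, (i_{k-1}, j_{k-2}), (a, j_{k-1})`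
and remove `a` from the red block. -/
def LeftShift {n : ℕ} (k : ℕ) (P Q : SetPartition (n + 1)) : Prop :=
  ∃ (a : Fin (n + 1)) (i j : Fin (k - 1) → Fin (n + 1)),
    IsLeast (coveredRed (k - 1) P) a ∧ IsInnermost P a i j ∧
    red Q = red P \ {a} ∧
    blackArcs Q = (blackArcs P \ pairs i j) ∪ pairs (append i a) (prepend a j)

/-- `P` has a red `k`-crossing, i.e. one with at least one red arc. -/
def HasRedCrossing {n : ℕ} (k : ℕ) (P : SetPartition (n + 1)) : Prop :=
  ∃ i j : Fin k → Fin (n + 1), IsCrossing P i j ∧ ∃ p, i p ∈ red P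

/-- One cyclic rotation, `P ↦ Q`. Let `(x, y)` be the rightmost red arc that lies in a
`k`-crossing, and `(i₁, j₁), …, (i_k, j_k)` the `k`-crossing containing it, as `(i_p, j_p)`, whose
word of right ends is lexicographically greatest. Replace its arcs by
`(i₁, j₂), …, (i_{p-1}, j_p), (i_p, j₁), (i_{p+1}, j_{p+1}), …, (i_k, j_k)`; the new red block is
the block of `0` in the resulting partition. (The permutation `p.cycleRange` sends
`s ↦ s + 1` for `s < p`, sends `p ↦ 0`, and fixes each `s > p`.) -/
def CyclicRotation {n : ℕ} (k : ℕ) (P Q : SetPartition (n + 1)) : Prop :=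
  ∃ (i j : Fin k → Fin (n + 1)) (p : Fin k),
    IsCrossing P i j ∧ i p ∈ red P ∧
    (∀ (i' j' : Fin k → Fin (n + 1)) (p' : Fin k),
      IsCrossing P i' j' → i' p' ∈ red P → j' p' ≤ j p) ∧
    (∀ (i' j' : Fin k → Fin (n + 1)) (p' : Fin k),
      IsCrossing P i' j' → i' p' = i p → j' p' = j p → toLex j' ≤ toLex j) ∧
    arcs Q = (arcs P \ pairs i j) ∪ pairs i (fun s => j (p.cycleRange s))

/-- A complete run of the forward algorithm on `P`, with output `Q`: return `P` if it has no black
enhanced `(k - 1)`-crossing; otherwise do enhanced left shifts until there is no red node under a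
black `(k - 1)`-crossing, and then cyclic rotations until there is no red `k`-crossing. -/
def ForwardRun {n : ℕ} (k : ℕ) (P Q : SetPartition (n + 1)) : Prop :=
  (P ∈ BNW n (k - 1) ∧ Q = P) ∨
  (P ∉ BNW n (k - 1) ∧ ∃ R : SetPartition (n + 1),
    Relation.ReflTransGen (LeftShift k) P R ∧ coveredRed (k - 1) R = ∅ ∧
    Relation.ReflTransGen (CyclicRotation k) R Q ∧ ¬ HasRedCrossing k Q)

/-- One undoing of a cyclic rotation, `P ↦ Q`. Let `a` be the smallest red node under a black
`(k - 1)`-crossing, `b` the largest red node smaller than `a`, `(i₁, j₁), …, (i_{k-1}, j_{k-1})`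
the innermost black `(k - 1)`-crossing covering `a`, and `1 ≤ t < k - 1` with
`i_t < b < i_{t+1}`. Replace the arcs of this crossing and the red arc `(b, a)` by
`(i₁, a), (i₂, j₁), …, (i_t, j_{t-1}), (b, j_t), (i_{t+1}, j_{t+1}), …, (i_{k-1}, j_{k-1})`. -/
def UndoRotation {n : ℕ} (k : ℕ) (P Q : SetPartition (n + 1)) : Prop :=
  ∃ (a b : Fin (n + 1)) (i j : Fin (k - 1) → Fin (n + 1)) (t : Fin (k - 1 + 1)),
    IsLeast (coveredRed (k - 1) P) a ∧
    IsGreatest {c | c ∈ red P ∧ c < a} b ∧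
    IsInnermost P a i j ∧
    1 ≤ (t : ℕ) ∧ (t : ℕ) < k - 1 ∧
    (∀ s : Fin (k - 1), ((s : ℕ) < t → i s < b) ∧ ((t : ℕ) ≤ s → b < i s)) ∧
    arcs Q = (arcs P \ (pairs i j ∪ {(b, a)})) ∪ pairs (insertAt t b i) (prepend a j)

/-- `(i₁, a), (i₂, j₁), …, (i_m, j_{m-1}), (a, j_m)` is a black weak `(m + 1)`-crossing of `P`
(so its center is `a`). -/
def IsBlackWeakCrossingAt {n m : ℕ} (P : SetPartition (n + 1)) (a : Fin (n + 1))
    (i j : Fin m → Fin (n + 1)) : Prop :=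
  IsBlackWeakCrossing P (append i a) (prepend a j)

/-- One undoing of an enhanced left shift, `P ↦ Q`. Let `a` be the largest center of a black weak
`k`-crossing and `(i₁, a), (i₂, j₁), …, (i_{k-1}, j_{k-2}), (a, j_{k-1})` the outermost black weak
`k`-crossing with center `a` (the word of right ends is lexicographically greatest). Replace these
arcs by `(i₁, j₁), …, (i_{k-1}, j_{k-1})` and add `a` to the red block. -/
def UndoShift {n : ℕ} (k : ℕ) (P Q : SetPartition (n + 1)) : Prop :=
  ∃ (a : Fin (n + 1)) (i j : Fin (k - 1) → Fin (n + 1)),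
    IsGreatest {c | ∃ i' j' : Fin (k - 1) → Fin (n + 1), IsBlackWeakCrossingAt P c i' j'} a ∧
    IsBlackWeakCrossingAt P a i j ∧
    (∀ i' j' : Fin (k - 1) → Fin (n + 1), IsBlackWeakCrossingAt P a i' j' →
      toLex j' ≤ toLex j) ∧
    red Q = insert a (red P) ∧
    blackArcs Q = (blackArcs P \ pairs (append i a) (prepend a j)) ∪ pairs i j

/-- A complete run of the backward algorithm on `P`, with output `Q`: return `P` if it has no black
enhanced `(k - 1)`-crossing; otherwise undo cyclic rotations until there is no red node under a
black `(k - 1)`-crossing, and then undo enhanced left shifts until there is no black weak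
`k`-crossing. -/
def BackwardRun {n : ℕ} (k : ℕ) (P Q : SetPartition (n + 1)) : Prop :=
  (P ∈ BNW n (k - 1) ∧ Q = P) ∨
  (P ∉ BNW n (k - 1) ∧ ∃ R : SetPartition (n + 1),
    Relation.ReflTransGen (UndoRotation k) P R ∧ coveredRed (k - 1) R = ∅ ∧
    Relation.ReflTransGen (UndoShift k) R Q ∧
    ∀ i j : Fin k → Fin (n + 1), ¬ IsBlackWeakCrossing Q i j)

end KNoncrossing

/-! Put `K = k - 1`. All four operations are instances of one move. Take arcs forming a `K`-crossing
over a node `a`, insert a node `b` among their left ends to get `x 0 < ... < x K` with `x t = b`,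
and put `a` before their right ends to get `a = y 0 < ... < y K`. The old arcs are `(x (s - 1), y
s)` for `1 ≤ s ≤ t` and `(x s, y s)` for `t < s ≤ K`; the new arcs are `(x s, y s)` for `0 ≤ s ≤ K`.
A left shift goes from old to new with `t = K` and `b = a`, a red node that is set free. Undoing a
rotation goes from old to new with `b` the red predecessor of `a`, the red arc `(b, a)` being used
up. The other two operations go from new to old. `IsExchange` isolates this move, with `r` equal to
`≤` for shifts (weak crossings count) and to `<` for rotations.

Each operation preserves an invariant and is undone by its partner. `ShiftInv` and `RotInv` both
forbid black `(K + 1)`-crossings. They also demand that every black enhanced `(K + 1)`-crossing,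
respectively every `(K + 1)`-crossing, has a right end to the left of each red node under a black
`K`-crossing. The partitions in `BNW` are those with `ShiftInv` and no black weak crossing; those in
`NC` are those with `RotInv` and no red crossing; and when no red node is covered the two invariants
coincide. Hence the two phases can be glued there, and two deterministic, terminating, mutually
inverse processes give the bijection.

The core is to compare crossings before and after an exchange. The arcs over `a` receive labels in
`1, ..., K` that increase strictly along chains of old arcs and along chains of new arcs. Going from
old to new, the label of a fixed arc is the size of a longest chain of old arcs ending there. This
works after the exchange as well because the innermost crossing is not only lexicographically but
pointwise minimal (`le_of_forall_toLex_le`). Going from new to old, longest chains starting at an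
arc are used instead, together with lexicographic maximality. A crossing is then transported by
trading some of its arcs for the chain arc with the same or a neighbouring label:
`exists_old_of_new`, `exists_old_of_new_left`, `exists_new_of_old` and `exists_new_of_old_left`. The
lemmas `le_of_new` and `eq_of_old_of_lex_le` show that the inverse operation selects the same arcs
up to index `t`; the remaining ones are fixed by the exchange and do not matter.

The number of blocks is the number of nodes without an incoming arc, which no exchange alters. For
the enumeration, deleting the red block and relabelling the black nodes turns `BNW` with a
prescribed red block into `NW`. -/

namespace KNoncrossing

/-! ### Ranks in a strict order whose chains are bounded. -/

section Rank

variable {α : Type*}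

/-- `D` is a finite chain in `S` whose largest element is `f`. -/
def IsChainTo (R : α → α → Prop) (S : Set α) (f : α) (D : Finset α) : Prop :=
  (D : Set α) ⊆ S ∧ IsChain R (D : Set α) ∧ f ∈ D ∧ ∀ d ∈ D, d = f ∨ R d f

/-- `rk f` is the largest size of a chain with greatest element `f`. Excluding chains of size
exactly `K + 1` bounds all chains by `K`, since subsets of chains are chains. Applied to the
reversed order it measures chains starting at `f`. -/
theorem exists_rank (R : α → α → Prop) (htr : ∀ a b c, R a b → R b c → R a c)
    (hirr : ∀ a, ¬ R a a) (S : Set α) (K : ℕ)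
    (hK : ∀ D : Finset α, (D : Set α) ⊆ S → IsChain R (D : Set α) → D.card ≠ K + 1) :
    ∃ rk : α → ℕ, (∀ f ∈ S, 1 ≤ rk f ∧ rk f ≤ K) ∧
      (∀ f ∈ S, ∀ g ∈ S, R f g → rk f < rk g) ∧
      (∀ f ∈ S, ∃ D, IsChainTo R S f D ∧ D.card = rk f) ∧
      (∀ f ∈ S, ∀ D, IsChainTo R S f D → D.card ≤ rk f) := by
  classical
  have hle : ∀ D : Finset α, (D : Set α) ⊆ S → IsChain R (D : Set α) → D.card ≤ K := by
    intro D hD hc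
    by_contra hlt
    obtain ⟨E, hE, hEc⟩ := Finset.exists_subset_card_eq (show K + 1 ≤ D.card by omega)
    exact hK E (fun e he => hD (hE he)) (hc.mono (by exact_mod_cast hE)) hEc
  let p : α → ℕ → Prop := fun f m => ∃ D, IsChainTo R S f D ∧ D.card = m
  have hone : ∀ f ∈ S, p f 1 := fun f hf =>
    ⟨{f}, ⟨by simpa using hf, by simp, by simp, by simp⟩, by simp⟩
  have hmax : ∀ f ∈ S, ∀ D, IsChainTo R S f D → D.card ≤ Nat.findGreatest (p f) K :=
    fun f _ D hD => Nat.le_findGreatest (hle D hD.1 hD.2.1) ⟨D, hD, rfl⟩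
  have hex : ∀ f ∈ S, p f (Nat.findGreatest (p f) K) := fun f hf => by
    obtain ⟨D, hD, hc⟩ := hone f hf
    exact Nat.findGreatest_spec (m := 1) (hc ▸ hle D hD.1 hD.2.1) (hone f hf)
  refine ⟨fun f => Nat.findGreatest (p f) K, ?_, ?_, hex, hmax⟩
  · intro f hf
    refine ⟨?_, Nat.findGreatest_le K⟩
    obtain ⟨D, hD, hc⟩ := hone f hf
    exact hc ▸ hmax f hf D hD
  · intro f hf g hg hfg
    obtain ⟨D, ⟨hDS, hDc, hfD, hDf⟩, hcard⟩ := hex f hf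
    have hRg : ∀ d ∈ D, R d g := fun d hd => by
      rcases hDf d hd with rfl | h
      · exact hfg
      · exact htr _ _ _ h hfg
    have hgD : g ∉ D := fun h => hirr g (hRg g h)
    have : IsChainTo R S g (insert g D) := by
      refine ⟨?_, ?_, by simp, ?_⟩
      · intro d hd
        rcases Finset.mem_insert.1 (Finset.mem_coe.1 hd) with rfl | h
        · exact hg
        · exact hDS h
      · rw [Finset.coe_insert]
        exact hDc.insert fun b hb _ => Or.inr (hRg b hb)
      · intro d hd
        rcases Finset.mem_insert.1 hd with rfl | h
        · exact Or.inl rfl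
        · exact Or.inr (hRg d h)
    have h2 := hmax g hg _ this
    rw [Finset.card_insert_of_notMem hgD, hcard] at h2
    exact h2

end Rank

/-! ### Chains of arcs, exchanges, and transport of crossings on the right of `y 0` from new to old.
-/

section Exchange

variable {N : Type*} [LinearOrder N]

/-- The arc `e` ends before the arc `f` on both sides. -/
def Prec (e f : N × N) : Prop := e.1 < f.1 ∧ e.2 < f.2

theorem Prec.trans {e f g : N × N} (h : Prec e f) (h' : Prec f g) : Prec e g :=
  ⟨h.1.trans h'.1, h.2.trans h'.2⟩

theorem Prec.irrefl (e : N × N) : ¬ Prec e e := fun h => lt_irrefl _ h.1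

/-- A chain of arcs for `Prec`. -/
abbrev ArcChain (D : Finset (N × N)) : Prop := IsChain Prec (D : Set (N × N))

theorem ArcChain.prec_of_fst_lt {D : Finset (N × N)} (hD : ArcChain D) {e f : N × N}
    (he : e ∈ D) (hf : f ∈ D) (h : e.1 < f.1) : Prec e f := by
  rcases hD he hf (fun h' => by simp [h'] at h) with h' | h'
  · exact h'
  · exact absurd h'.1 h.not_gt

theorem ArcChain.prec_of_snd_lt {D : Finset (N × N)} (hD : ArcChain D) {e f : N × N}
    (he : e ∈ D) (hf : f ∈ D) (h : e.2 < f.2) : Prec e f := by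
  rcases hD he hf (fun h' => by simp [h'] at h) with h' | h'
  · exact h'
  · exact absurd h'.2 h.not_gt

theorem ArcChain.eq_of_snd_eq {D : Finset (N × N)} (hD : ArcChain D) {e f : N × N}
    (he : e ∈ D) (hf : f ∈ D) (h : e.2 = f.2) : e = f := by
  by_contra hne
  rcases hD he hf hne with h' | h'
  · exact absurd h h'.2.ne
  · exact absurd h h'.2.ne'

theorem ArcChain.eq_of_fst_eq {D : Finset (N × N)} (hD : ArcChain D) {e f : N × N}
    (he : e ∈ D) (hf : f ∈ D) (h : e.1 = f.1) : e = f := by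
  by_contra hne
  rcases hD he hf hne with h' | h'
  · exact absurd h h'.1.ne
  · exact absurd h h'.1.ne'

/-- Any two arcs of a chain are comparable, so preserving `Prec` already forces injectivity.
Transporting a crossing thus reduces to the monotonicity of one map. -/
theorem ArcChain.image {D : Finset (N × N)} (hD : ArcChain D) (φ : N × N → N × N)
    (hφ : ∀ e ∈ D, ∀ f ∈ D, Prec e f → Prec (φ e) (φ f)) :
    ArcChain (D.image φ) ∧ (D.image φ).card = D.card := by
  constructor
  · intro e' he' f' hf' hne
    simp only [Finset.coe_image, Set.mem_image, Finset.mem_coe] at he' hf'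
    obtain ⟨e, he, rfl⟩ := he'
    obtain ⟨f, hf, rfl⟩ := hf'
    rcases hD he hf (fun h => hne (by rw [h])) with h | h
    · exact Or.inl (hφ e he f hf h)
    · exact Or.inr (hφ f hf e he h)
  · refine Finset.card_image_of_injOn fun e he f hf hef => ?_
    by_contra hne
    rcases hD he hf hne with h | h
    · exact Prec.irrefl _ (hef ▸ hφ e he f hf h : Prec (φ f) (φ f))
    · exact Prec.irrefl _ (hef ▸ hφ f hf e he h : Prec (φ f) (φ f))

/-- The arcs before an exchange: the fixed arcs `O`, and `(x (s - 1), y s)` for `1 ≤ s ≤ t`. -/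
def oldArcs (O : Set (N × N)) (x y : ℕ → N) (t : ℕ) : Set (N × N) :=
  O ∪ {e | ∃ s, 1 ≤ s ∧ s ≤ t ∧ e = (x (s - 1), y s)}

/-- The arcs after an exchange: the fixed arcs `O`, and `(x s, y s)` for `s ≤ t`. -/
def newArcs (O : Set (N × N)) (x y : ℕ → N) (t : ℕ) : Set (N × N) :=
  O ∪ {e | ∃ s, s ≤ t ∧ e = (x s, y s)}

/-- The left end of the old arc with right end `y s`. -/
def leftEnd (x : ℕ → N) (t s : ℕ) : N := if s ≤ t then x (s - 1) else x s

/-- The arcs of `A` lying over `a`. -/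
def overArcs (r : N → N → Prop) (a : N) (A : Set (N × N)) : Set (N × N) :=
  {e | e ∈ A ∧ r e.1 a ∧ a < e.2}

/-- The data of an exchange. -/
structure IsExchange (r : N → N → Prop) (O : Set (N × N)) (x y : ℕ → N) (t K : ℕ) : Prop where
  one_le : 1 ≤ t
  le : t ≤ K
  x_lt : ∀ s s', s < s' → s' ≤ K → x s < x s'
  y_lt : ∀ s s', s < s' → s' ≤ K → y s < y s'
  tail : ∀ s, t < s → s ≤ K → (x s, y s) ∈ O
  inj_fst : ∀ f ∈ O, ∀ g ∈ O, f.1 = g.1 → f = g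
  inj_snd : ∀ f ∈ O, ∀ g ∈ O, f.2 = g.2 → f = g
  ne_x : ∀ f ∈ O, ∀ s ≤ t, f.1 ≠ x s
  ne_y : ∀ f ∈ O, ∀ s ≤ t, f.2 ≠ y s
  r_mono : ∀ u v u' v', r u v → u' ≤ u → v ≤ v' → r u' v'
  r_x : ∀ s ≤ K, r (x s) (y 0)

/-- A labelling of the arcs over `y 0` that increases along chains before and after the
exchange. -/
structure IsLabelling (r : N → N → Prop) (O : Set (N × N)) (x y : ℕ → N) (t K : ℕ)
    (lab : N × N → ℕ) : Prop where
  old_range : ∀ f ∈ overArcs r (y 0) (oldArcs O x y t), 1 ≤ lab f ∧ lab f ≤ K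
  old_lt : ∀ f ∈ overArcs r (y 0) (oldArcs O x y t), ∀ g ∈ overArcs r (y 0) (oldArcs O x y t),
    Prec f g → lab f < lab g
  new_range : ∀ f ∈ overArcs r (y 0) (newArcs O x y t), 1 ≤ lab f ∧ lab f ≤ K
  new_lt : ∀ f ∈ overArcs r (y 0) (newArcs O x y t), ∀ g ∈ overArcs r (y 0) (newArcs O x y t),
    Prec f g → lab f < lab g
  lab_new : ∀ s ≤ K, lab (x s, y s) = s
  lab_old : ∀ s, 1 ≤ s → s ≤ K → lab (leftEnd x t s, y s) = s

namespace IsExchange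

variable {r : N → N → Prop} {O : Set (N × N)} {x y : ℕ → N} {t K : ℕ} {lab : N × N → ℕ}

theorem x_le (h : IsExchange r O x y t K) {s s' : ℕ} (hs : s ≤ s') (hs' : s' ≤ K) :
    x s ≤ x s' := by
  rcases hs.eq_or_lt with rfl | hlt
  · exact le_rfl
  · exact (h.x_lt _ _ hlt hs').le

theorem y_le (h : IsExchange r O x y t K) {s s' : ℕ} (hs : s ≤ s') (hs' : s' ≤ K) :
    y s ≤ y s' := by
  rcases hs.eq_or_lt with rfl | hlt
  · exact le_rfl
  · exact (h.y_lt _ _ hlt hs').le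

theorem leftEnd_le (h : IsExchange r O x y t K) {s : ℕ} (hs : s ≤ K) : leftEnd x t s ≤ x s := by
  unfold leftEnd
  split_ifs
  · exact h.x_le (by omega) hs
  · exact le_rfl

theorem leftEnd_lt (h : IsExchange r O x y t K) {s s' : ℕ} (h1 : 1 ≤ s) (hs : s < s')
    (hs' : s' ≤ K) : leftEnd x t s < leftEnd x t s' := by
  unfold leftEnd
  split_ifs
  all_goals first | omega | exact h.x_lt _ _ (by omega) (by omega)

theorem x_pred_le_leftEnd (h : IsExchange r O x y t K) {s : ℕ} (hs : s ≤ K) :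
    x (s - 1) ≤ leftEnd x t s := by
  unfold leftEnd
  split_ifs
  · exact le_rfl
  · exact h.x_le (by omega) hs

theorem old_mem (h : IsExchange r O x y t K) {s : ℕ} (h1 : 1 ≤ s) (hs : s ≤ K) :
    (leftEnd x t s, y s) ∈ oldArcs O x y t := by
  unfold leftEnd
  split_ifs with hst
  · exact Or.inr ⟨s, h1, hst, rfl⟩
  · exact Or.inl (h.tail s (by omega) hs)

theorem new_mem (h : IsExchange r O x y t K) {s : ℕ} (hs : s ≤ K) :
    (x s, y s) ∈ newArcs O x y t := by
  by_cases hst : s ≤ t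
  · exact Or.inr ⟨s, hst, rfl⟩
  · exact Or.inl (h.tail s (by omega) hs)

theorem old_over (h : IsExchange r O x y t K) {s : ℕ} (h1 : 1 ≤ s) (hs : s ≤ K) :
    (leftEnd x t s, y s) ∈ overArcs r (y 0) (oldArcs O x y t) :=
  ⟨h.old_mem h1 hs, h.r_mono _ _ _ _ (h.r_x s hs) (h.leftEnd_le hs) le_rfl,
    h.y_lt _ _ (by omega) hs⟩

theorem new_over (h : IsExchange r O x y t K) {s : ℕ} (h1 : 1 ≤ s) (hs : s ≤ K) :
    (x s, y s) ∈ overArcs r (y 0) (newArcs O x y t) :=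
  ⟨h.new_mem hs, h.r_x s hs, h.y_lt _ _ (by omega) hs⟩

theorem y_inj (h : IsExchange r O x y t K) {s s' : ℕ} (hs : s ≤ K) (hs' : s' ≤ K)
    (he : y s = y s') : s = s' := by
  rcases lt_trichotomy s s' with hlt | rfl | hlt
  · exact absurd he (h.y_lt _ _ hlt hs').ne
  · rfl
  · exact absurd he (h.y_lt _ _ hlt hs).ne'

/-- Old arcs have distinct right ends, so an arc ending at `y s` must be the chain arc. This is why
the label of such an arc can be read off from its right end. -/
theorem eq_of_old (h : IsExchange r O x y t K) {g : N × N} (hg : g ∈ oldArcs O x y t) {s : ℕ}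
    (h1 : 1 ≤ s) (hs : s ≤ K) (he : g.2 = y s) : g = (leftEnd x t s, y s) := by
  rcases hg with hg | ⟨s', h1', hs', rfl⟩
  · by_cases hst : s ≤ t
    · exact absurd he (h.ne_y g hg s hst)
    · rw [leftEnd, if_neg hst]
      exact h.inj_snd g hg _ (h.tail s (by omega) hs) he
  · have := h.y_inj (hs'.trans h.le) hs he
    subst this
    rw [leftEnd, if_pos hs']

theorem eq_of_new (h : IsExchange r O x y t K) {g : N × N} (hg : g ∈ newArcs O x y t) {s : ℕ}
    (hs : s ≤ K) (he : g.2 = y s) : g = (x s, y s) := by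
  rcases hg with hg | ⟨s', hs', rfl⟩
  · by_cases hst : s ≤ t
    · exact absurd he (h.ne_y g hg s hst)
    · exact h.inj_snd g hg _ (h.tail s (by omega) hs) he
  · have := h.y_inj (hs'.trans h.le) hs he
    subst this
    rfl

/-- A chain of new arcs with all right ends beyond `y 0` can be pushed to the old arcs. -/
theorem exists_old_of_new (h : IsExchange r O x y t K) (hl : IsLabelling r O x y t K lab)
    {D : Finset (N × N)} (hD : ArcChain D) (hDn : (D : Set (N × N)) ⊆ newArcs O x y t)
    (hy : ∀ e ∈ D, y 0 < e.2) (hr : ∀ e ∈ D, ∀ f ∈ D, r e.1 f.2) :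
    ∃ D' : Finset (N × N), ArcChain D' ∧ D'.card = D.card ∧
      (D' : Set (N × N)) ⊆ oldArcs O x y t ∧ (∀ e ∈ D', y 0 < e.2) ∧
      ∀ e ∈ D', ∀ f ∈ D', r e.1 f.2 := by
  classical
  by_cases hex : ∃ s ≤ t, (x s, y s) ∈ D
  swap
  · refine ⟨D, hD, rfl, fun e he => ?_, hy, hr⟩
    rcases hDn he with h' | ⟨s, hs, rfl⟩
    · exact Or.inl h'
    · exact absurd ⟨s, hs, he⟩ hex
  obtain ⟨m, hmt, hmD, hmax⟩ : ∃ m ≤ t, (x m, y m) ∈ D ∧ ∀ s ≤ t, (x s, y s) ∈ D → s ≤ m := by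
    obtain ⟨s, hs, hsD⟩ := hex
    have := Nat.findGreatest_spec (P := fun s => (x s, y s) ∈ D) hs hsD
    exact ⟨_, Nat.findGreatest_le t, this, fun s' hs' hsD' => Nat.le_findGreatest hs' hsD'⟩
  have hle := h.le
  have hle_m : ∀ g ∈ D, g.2 ≤ y m → g ∈ overArcs r (y 0) (newArcs O x y t) ∧ lab g ≤ m := by
    intro g hg hgm
    have hm1 : 1 ≤ m := by
      rcases Nat.eq_zero_or_pos m with rfl | h'
      · exact absurd (hy _ hmD) (lt_irrefl _)
      · exact h'
    rcases hgm.eq_or_lt with he | hlt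
    · have := h.eq_of_new (hDn hg) (hmt.trans h.le) he
      subst this
      exact ⟨h.new_over hm1 (hmt.trans h.le), (hl.lab_new m (hmt.trans h.le)).le⟩
    · have hp := hD.prec_of_snd_lt hg hmD hlt
      have hov : g ∈ overArcs r (y 0) (newArcs O x y t) :=
        ⟨hDn hg, h.r_mono _ _ _ _ (h.r_x m (hmt.trans h.le)) hp.1.le le_rfl, hy g hg⟩
      refine ⟨hov, ?_⟩
      have := hl.new_lt g hov _ (h.new_over hm1 (hmt.trans h.le)) hp
      rw [hl.lab_new m (hmt.trans h.le)] at this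
      exact this.le
  -- Here `(x m, y m)` is the last exchanged arc in `D`. Up to it, an arc is replaced by the old
  -- chain arc of its own label unless this would move its left end to the right. Left ends move
  -- weakly left and right ends weakly right, so `r` survives by `r_mono`.
  set φ : N × N → N × N := fun g =>
    if g.2 ≤ y m ∧ leftEnd x t (lab g) ≤ g.1 then (leftEnd x t (lab g), y (lab g)) else g with hφ
  have hkeep : ∀ g ∈ D, g.2 ≤ y m → g.1 < leftEnd x t (lab g) → g ∈ O := by
    intro g hg hgm hlt
    rcases hDn hg with h' | ⟨s, hs, rfl⟩
    · exact h'
    · rw [hl.lab_new s (hs.trans h.le)] at hlt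
      exact absurd hlt (h.leftEnd_le (hs.trans h.le)).not_gt
  have hfst : ∀ g ∈ D, (φ g).1 ≤ g.1 := by
    intro g hg
    simp only [hφ]
    split_ifs with hc
    · exact hc.2
    · exact le_rfl
  have hsnd : ∀ g ∈ D, g.2 ≤ (φ g).2 := by
    intro g hg
    simp only [hφ]
    split_ifs with hc
    · obtain ⟨hov, hlm⟩ := hle_m g hg hc.1
      have hr := hl.new_range g hov
      -- If the chain arc ended earlier than `g`, it would precede `g` among the old arcs although
      -- both carry the same label.
      by_contra hlt
      simp only [not_le] at hlt
      rcases hc.2.eq_or_lt with he | hlt'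
      · rcases hov.1 with hO | ⟨s, hs, rfl⟩
        · rw [leftEnd, if_pos (by omega)] at he
          exact h.ne_x g hO (lab g - 1) (by omega) he.symm
        · rw [hl.lab_new s (by omega)] at hlt
          exact lt_irrefl _ hlt
      · rcases hov.1 with hO | ⟨s, hs, rfl⟩
        · have := hl.old_lt _ (h.old_over hr.1 hr.2) g ⟨Or.inl hO, hov.2⟩ ⟨hlt', hlt⟩
          rw [hl.lab_old _ hr.1 hr.2] at this
          exact lt_irrefl _ this
        · rw [hl.lab_new s (by omega)] at hlt
          exact lt_irrefl _ hlt
    · exact le_rfl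
  have hmono : ∀ e ∈ D, ∀ f ∈ D, Prec e f → Prec (φ e) (φ f) := by
    intro e he f hf hef
    by_cases hfm : f.2 ≤ y m
    · have hem := hef.2.le.trans hfm
      obtain ⟨heo, hel⟩ := hle_m e he hem
      obtain ⟨hfo, hfl⟩ := hle_m f hf hfm
      have hlt := hl.new_lt e heo f hfo hef
      have hre := hl.new_range e heo
      have hrf := hl.new_range f hfo
      have h1 := h.leftEnd_lt hre.1 hlt hrf.2
      have h2 := h.y_lt _ _ hlt hrf.2
      -- Two replaced arcs are compared through their labels. When only `f` is kept, it starts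
      -- before the chain arc of its label, and must end no earlier than that arc, since otherwise
      -- it would precede an arc with its own label.
      by_cases hce : leftEnd x t (lab e) ≤ e.1 <;> by_cases hcf : leftEnd x t (lab f) ≤ f.1
      · simp only [hφ, hem, hfm, hce, hcf, and_self, if_true]
        exact ⟨h1, h2⟩
      · simp only [hφ, hem, hfm, hce, hcf, and_self, if_true, and_false, if_false]
        refine ⟨hce.trans_lt hef.1, h2.trans_le ?_⟩
        by_contra hlt'
        simp only [not_le] at hlt' hcf
        have hO := hkeep f hf hfm hcf
        have := hl.old_lt f ⟨Or.inl hO, hfo.2⟩ _ (h.old_over hrf.1 hrf.2) ⟨hcf, hlt'⟩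
        rw [hl.lab_old _ hrf.1 hrf.2] at this
        exact lt_irrefl _ this
      · have := hsnd f hf
        simp only [hφ, hem, hfm, hce, hcf, and_self, if_true, and_false, if_false] at this ⊢
        simp only [not_le] at hce
        exact ⟨hce.trans h1, hef.2.trans_le this⟩
      · simp only [hφ, hem, hfm, hce, hcf, and_false, if_false]
        exact hef
    · have hf' : φ f = f := by simp [hφ, hfm]
      rw [hf']
      refine ⟨(hfst e he).trans_lt hef.1, ?_⟩
      simp only [hφ]
      split_ifs with hc
      · have := (hle_m e he hc.1).2
        exact (h.y_le this (hmt.trans h.le)).trans_lt (not_le.1 hfm)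
      · exact hef.2
  obtain ⟨hc, hcard⟩ := hD.image φ hmono
  refine ⟨D.image φ, hc, hcard, ?_, ?_, ?_⟩
  · intro e' he'
    simp only [Finset.coe_image, Set.mem_image, Finset.mem_coe] at he'
    obtain ⟨g, hg, rfl⟩ := he'
    simp only [hφ]
    split_ifs with hc
    · have := hl.new_range g (hle_m g hg hc.1).1
      exact h.old_mem this.1 this.2
    · rcases hDn hg with h' | ⟨s, hs, rfl⟩
      · exact Or.inl h'
      · refine absurd ⟨h.y_le (hmax s hs hg) (hmt.trans h.le), ?_⟩ hc
        rw [hl.lab_new s (hs.trans h.le)]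
        exact h.leftEnd_le (hs.trans h.le)
  · intro e' he'
    obtain ⟨g, hg, rfl⟩ := Finset.mem_image.1 he'
    exact (hy g hg).trans_le (hsnd g hg)
  · intro e' he' f' hf'
    obtain ⟨g, hg, rfl⟩ := Finset.mem_image.1 he'
    obtain ⟨g', hg', rfl⟩ := Finset.mem_image.1 hf'
    exact h.r_mono _ _ _ _ (hr g hg g' hg') (hfst g hg) (hsnd g' hg')

end IsExchange
end Exchange

/-! ### The three remaining transports of crossings across an exchange. -/

section Exchange

variable {N : Type*} [LinearOrder N]

namespace IsExchange

variable {r : N → N → Prop} {O : Set (N × N)} {x y : ℕ → N} {t K : ℕ} {lab : N × N → ℕ}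

/-- A chain of new arcs avoiding `(x t, y t)` can be pushed to the old arcs without moving its
left ends to the right. -/
theorem exists_old_of_new_left (h : IsExchange r O x y t K) (hl : IsLabelling r O x y t K lab)
    (hR : ∀ f ∈ overArcs r (y 0) (oldArcs O x y t), ∀ s, 1 ≤ s → s ≤ K →
      (s < K → f.1 < leftEnd x t (s + 1)) → f.2 < y s → lab f < s)
    {D : Finset (N × N)} (hD : ArcChain D) (hDn : (D : Set (N × N)) ⊆ newArcs O x y t)
    (ht : (x t, y t) ∉ D) (hr : ∀ e ∈ D, y 0 ≤ e.2 → r e.1 (y 0)) :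
    ∃ D' : Finset (N × N), ArcChain D' ∧ D'.card = D.card ∧
      (D' : Set (N × N)) ⊆ oldArcs O x y t ∧ (∀ e ∈ D', ∃ f ∈ D, e.1 ≤ f.1) ∧
      ∀ e ∈ D', (e ∈ D ∧ e ∈ O) ∨ y 0 < e.2 ∧ r e.1 (y 0) := by
  classical
  have hO : ∀ e ∈ D, (¬ ∃ s ≤ t, e = (x s, y s)) → e ∈ O := by
    intro e he hn
    rcases hDn he with h' | h'
    · exact h'
    · exact absurd h' hn
  by_cases hex : ∃ s, s ≤ t ∧ (x s, y s) ∈ D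
  swap
  · have hDO : ∀ e ∈ D, e ∈ O := fun e he =>
      hO e he fun ⟨s, hs, hse⟩ => hex ⟨s, hs, hse ▸ he⟩
    exact ⟨D, hD, rfl, fun e he => Or.inl (hDO e he), fun e he => ⟨e, he, le_rfl⟩,
      fun e he => Or.inl ⟨he, hDO e he⟩⟩
  obtain ⟨hmt, hmD⟩ := Nat.find_spec hex
  have hmin : ∀ s ≤ t, (x s, y s) ∈ D → Nat.find hex ≤ s :=
    fun s hs hsD => Nat.find_min' hex ⟨hs, hsD⟩
  generalize Nat.find hex = m at hmt hmD hmin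
  have hle := h.le
  have hone := h.one_le
  -- range and monotonicity of the labels of the arcs that are not before `(x m, y m)`
  have hov : ∀ g ∈ D, y 0 < g.2 → g ∈ overArcs r (y 0) (newArcs O x y t) :=
    fun g hg hlt => ⟨hDn hg, hr g hg hlt.le, hlt⟩
  -- The only arc of this kind is not over `y 0`, so the range clauses do not apply to it; `lab_new`
  -- gives it the label 0.
  have hzero : ∀ g ∈ D, y m ≤ g.2 → ¬ y 0 < g.2 → g = (x 0, y 0) := by
    intro g hg hgm hn
    refine h.eq_of_new (hDn hg) (Nat.zero_le _) (le_antisymm (not_lt.1 hn) ?_)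
    exact (h.y_le (Nat.zero_le _) (hmt.trans hle)).trans hgm
  have hlabK : ∀ g ∈ D, y m ≤ g.2 → lab g ≤ K := by
    intro g hg hgm
    by_cases hlt : y 0 < g.2
    · exact (hl.new_range g (hov g hg hlt)).2
    · rw [hzero g hg hgm hlt, hl.lab_new 0 (Nat.zero_le _)]
      exact Nat.zero_le _
  have hlablt : ∀ g ∈ D, ∀ g' ∈ D, y m ≤ g.2 → Prec g g' → lab g < lab g' := by
    intro g hg g' hg' hgm hp
    have h0 : y 0 < g'.2 :=
      (h.y_le (Nat.zero_le _) (hmt.trans hle)).trans_lt (hgm.trans_lt hp.2)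
    by_cases hlt : y 0 < g.2
    · exact hl.new_lt g (hov g hg hlt) g' (hov g' hg' h0) hp
    · rw [hzero g hg hgm hlt, hl.lab_new 0 (Nat.zero_le _)]
      exact (hl.new_range g' (hov g' hg' h0)).1
  -- From the first exchanged arc `(x m, y m)` on, an arc is replaced by the old chain arc with the
  -- next larger label if this does not move its left end to the right. For `s < t` the arc `(x s, y
  -- s)` becomes `(x s, y (s + 1))`; only `(x t, y t)` would have no image among the old arcs, and
  -- `D` avoids it.
  set φ : N × N → N × N := fun g =>
    if y m ≤ g.2 ∧ lab g < K ∧ leftEnd x t (lab g + 1) ≤ g.1 then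
      (leftEnd x t (lab g + 1), y (lab g + 1)) else g with hφ
  have hmove : ∀ s < t, (lab (x s, y s) < K ∧ leftEnd x t (lab (x s, y s) + 1) ≤ x s) := by
    intro s hs
    rw [hl.lab_new s (by omega)]
    refine ⟨by omega, ?_⟩
    rw [leftEnd, if_pos (by omega)]
    exact le_rfl
  have hnet : ∀ s ≤ t, (x s, y s) ∈ D → s < t := fun s hs hsD =>
    lt_of_le_of_ne hs fun he => ht (he ▸ hsD)
  -- an arc that is kept is fixed, and lies weakly above the arc with its label
  have hkeepO : ∀ g ∈ D, ¬ (y m ≤ g.2 ∧ lab g < K ∧ leftEnd x t (lab g + 1) ≤ g.1) → g ∈ O := by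
    intro g hg hc
    refine hO g hg ?_
    rintro ⟨s, hs, rfl⟩
    have := hnet s hs hg
    exact hc ⟨h.y_le (hmin s hs hg) (by omega), hmove s this⟩
  have hkeep : ∀ g ∈ D, y m ≤ g.2 → ¬ (lab g < K ∧ leftEnd x t (lab g + 1) ≤ g.1) →
      1 ≤ lab g ∧ y (lab g) ≤ g.2 := by
    intro g hg hgm hc
    have hgO : g ∈ O := hkeepO g hg fun h' => hc h'.2
    have h0 : y 0 < g.2 := by
      by_contra hn
      exact h.ne_y g hgO 0 (Nat.zero_le _) (by rw [hzero g hg hgm hn])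
    have hgo := hov g hg h0
    have hrg := hl.new_range g hgo
    refine ⟨hrg.1, ?_⟩
    by_contra hlt
    -- Being kept means starting before the chain arc with the next label. Ending also before the
    -- chain arc of its own label would, by `hR`, make that label smaller than itself.
    have := hR g ⟨Or.inl hgO, hgo.2⟩ (lab g) hrg.1 hrg.2
      (fun hK => not_le.1 fun h' => hc ⟨hK, h'⟩) (not_le.1 hlt)
    exact lt_irrefl _ this
  -- an arc that is moved does not move down
  have hsnd : ∀ g ∈ D, y m ≤ g.2 → lab g < K → leftEnd x t (lab g + 1) ≤ g.1 →
      g.2 ≤ y (lab g + 1) := by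
    intro g hg hgm hK hc
    by_cases h0 : y 0 < g.2
    · have hgo := hov g hg h0
      rcases hgo.1 with hgO | ⟨s, hs, rfl⟩
      · by_contra hlt
        rcases hc.eq_or_lt with he | hlt'
        · by_cases hst : lab g + 1 ≤ t
          · rw [leftEnd, if_pos hst] at he
            exact h.ne_x g hgO _ (by omega) he.symm
          · rw [leftEnd, if_neg hst] at he
            have := h.inj_fst g hgO _ (h.tail (lab g + 1) (by omega) hK) he.symm
            have h2 := hl.lab_new (lab g + 1) hK
            rw [← this] at h2
            omega
        · have := hl.old_lt _ (h.old_over (by omega) hK) g ⟨Or.inl hgO, hgo.2⟩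
            ⟨hlt', not_le.1 hlt⟩
          rw [hl.lab_old _ (by omega) hK] at this
          omega
      · rw [hl.lab_new s (by omega)] at hK ⊢
        exact h.y_le (by omega) hK
    · exact (not_lt.1 h0).trans (h.y_le (Nat.zero_le _) hK)
  have hmono : ∀ e ∈ D, ∀ f ∈ D, Prec e f → Prec (φ e) (φ f) := by
    intro e he f hf hef
    by_cases hce : y m ≤ e.2 ∧ lab e < K ∧ leftEnd x t (lab e + 1) ≤ e.1
    · have hmf : y m ≤ f.2 := hce.1.trans hef.2.le
      have hlt := hlablt e he f hf hce.1 hef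
      have hfK := hlabK f hf hmf
      by_cases hcf : lab f < K ∧ leftEnd x t (lab f + 1) ≤ f.1
      · simp only [hφ, hce, hmf, hcf, and_self, if_true]
        exact ⟨h.leftEnd_lt (by omega) (by omega) (by omega), h.y_lt _ _ (by omega) (by omega)⟩
      · have hφf : φ f = f := by simp only [hφ]; rw [if_neg fun h' => hcf h'.2]
        have hφe : φ e = (leftEnd x t (lab e + 1), y (lab e + 1)) := by
          simp only [hφ]; rw [if_pos hce]
        rw [hφf, hφe]
        refine ⟨hce.2.2.trans_lt hef.1, lt_of_le_of_ne ?_ ?_⟩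
        · exact (h.y_le (by omega) hfK).trans (hkeep f hf hmf hcf).2
        · intro heq
          have hfO : f ∈ O := hkeepO f hf fun h' => hcf h'.2
          have := h.eq_of_old (Or.inl hfO) (s := lab e + 1) (by omega) (by omega) heq.symm
          have h1 : leftEnd x t (lab e + 1) ≤ e.1 := hce.2.2
          have h2 : f.1 = leftEnd x t (lab e + 1) := by rw [this]
          exact absurd hef.1 (not_lt.2 (h2 ▸ h1))
    · have hφe : φ e = e := by simp only [hφ]; rw [if_neg hce]
      rw [hφe]
      by_cases hcf : y m ≤ f.2 ∧ lab f < K ∧ leftEnd x t (lab f + 1) ≤ f.1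
      · have hφf : φ f = (leftEnd x t (lab f + 1), y (lab f + 1)) := by
          simp only [hφ]; rw [if_pos hcf]
        rw [hφf]
        refine ⟨?_, hef.2.trans_le (hsnd f hf hcf.1 hcf.2.1 hcf.2.2)⟩
        by_cases hme : y m ≤ e.2
        · have hlt := hlablt e he f hf hme hef
          have : ¬ leftEnd x t (lab e + 1) ≤ e.1 := fun h' => hce ⟨hme, by omega, h'⟩
          exact (not_le.1 this).trans (h.leftEnd_lt (by omega) (by omega) (by omega))
        -- An arc ending before `y m` starts before `x m`, which is the left end of the old chain
        -- arc with index `m + 1`; the image of `f` starts there or later.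
        · have hp := hD.prec_of_snd_lt he hmD (not_le.1 hme)
          have hml : m ≤ lab f := by
            rcases hcf.1.eq_or_lt with heq | hlt
            · rw [h.eq_of_new (hDn hf) (hmt.trans hle) heq.symm, hl.lab_new m (by omega)]
            · have := hlablt _ hmD f hf le_rfl (hD.prec_of_snd_lt hmD hf hlt)
              rw [hl.lab_new m (by omega)] at this
              exact this.le
          have h1 : leftEnd x t (m + 1) ≤ leftEnd x t (lab f + 1) := by
            rcases hml.eq_or_lt with heq | hlt
            · rw [heq]
            · exact (h.leftEnd_lt (by omega) (by omega) (by omega)).le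
          have h2 : leftEnd x t (m + 1) = x m := by
            have := hnet m hmt hmD
            rw [leftEnd, if_pos (by omega), Nat.add_sub_cancel]
          exact hp.1.trans_le (h2 ▸ h1)
      · have hφf : φ f = f := by simp only [hφ]; rw [if_neg hcf]
        rw [hφf]
        exact hef
  obtain ⟨hc, hcard⟩ := hD.image φ hmono
  refine ⟨D.image φ, hc, hcard, ?_, ?_, ?_⟩
  · intro e' he'
    simp only [Finset.coe_image, Set.mem_image, Finset.mem_coe] at he'
    obtain ⟨g, hg, rfl⟩ := he'
    simp only [hφ]
    split_ifs with hc
    · exact h.old_mem (by omega) hc.2.1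
    · exact Or.inl (hkeepO g hg hc)
  · intro e' he'
    obtain ⟨g, hg, rfl⟩ := Finset.mem_image.1 he'
    refine ⟨g, hg, ?_⟩
    simp only [hφ]
    split_ifs with hc
    · exact hc.2.2
    · exact le_rfl
  · intro e' he'
    obtain ⟨g, hg, rfl⟩ := Finset.mem_image.1 he'
    simp only [hφ]
    split_ifs with hc
    · have := h.old_over (s := lab g + 1) (by omega) hc.2.1
      exact Or.inr ⟨this.2.2, this.2.1⟩
    · exact Or.inl ⟨hg, hkeepO g hg hc⟩

/-- A chain of old arcs with all right ends beyond `y 0` can be pushed to the new arcs. -/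
theorem exists_new_of_old (h : IsExchange r O x y t K) (hl : IsLabelling r O x y t K lab)
    {D : Finset (N × N)} (hD : ArcChain D) (hDo : (D : Set (N × N)) ⊆ oldArcs O x y t)
    (hy : ∀ e ∈ D, y 0 < e.2) (hr : ∀ e ∈ D, ∀ f ∈ D, r e.1 f.2) :
    ∃ D' : Finset (N × N), ArcChain D' ∧ D'.card = D.card ∧
      (D' : Set (N × N)) ⊆ newArcs O x y t ∧ (∀ e ∈ D', y 0 < e.2) ∧
      ∀ e ∈ D', ∀ f ∈ D', r e.1 f.2 := by
  classical
  by_cases hex : ∃ s, 1 ≤ s ∧ s ≤ t ∧ (x (s - 1), y s) ∈ D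
  swap
  · refine ⟨D, hD, rfl, fun e he => ?_, hy, hr⟩
    rcases hDo he with h' | ⟨s, h1, hs, rfl⟩
    · exact Or.inl h'
    · exact absurd ⟨s, h1, hs, he⟩ hex
  obtain ⟨hm1, hmt, hmD⟩ := Nat.find_spec hex
  have hmin : ∀ s, 1 ≤ s → s ≤ t → (x (s - 1), y s) ∈ D → Nat.find hex ≤ s :=
    fun s h1 hs hsD => Nat.find_min' hex ⟨h1, hs, hsD⟩
  generalize Nat.find hex = m at hm1 hmt hmD hmin
  have hle := h.le
  have hz : ∀ s ≤ t, leftEnd x t s = x (s - 1) := fun s hs => by rw [leftEnd, if_pos hs]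
  have hover : ∀ g ∈ D, r g.1 (y 0) → g ∈ overArcs r (y 0) (oldArcs O x y t) :=
    fun g hg hgr => ⟨hDo hg, hgr, hy g hg⟩
  have hml : ∀ g ∈ D, r g.1 (y 0) → y m ≤ g.2 → m ≤ lab g := by
    intro g hg hgr hgm
    rcases hgm.eq_or_lt with he | hlt
    · rw [h.eq_of_old (hDo hg) hm1 (by omega) he.symm, hl.lab_old m hm1 (by omega)]
    · have := hl.old_lt _ (h.old_over hm1 (hmt.trans hle)) g (hover g hg hgr) (by
        rw [hz m hmt]; exact hD.prec_of_snd_lt hmD hg hlt)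
      rw [hl.lab_old m hm1 (by omega)] at this
      exact this.le
  -- From the first exchanged arc `(x (m - 1), y m)` on, an arc over `y 0` is replaced by the new
  -- chain arc of its label if that arc ends no later. Left ends now move right and right ends move
  -- left, so the relation `r` has to be checked anew at the end.
  set φ : N × N → N × N := fun g =>
    if y m ≤ g.2 ∧ r g.1 (y 0) ∧ y (lab g) ≤ g.2 then (x (lab g), y (lab g)) else g with hφ
  have hkeepO : ∀ g ∈ D, ¬ (y m ≤ g.2 ∧ r g.1 (y 0) ∧ y (lab g) ≤ g.2) → g ∈ O := by
    intro g hg hc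
    rcases hDo hg with h' | ⟨s, h1, hs, rfl⟩
    · exact h'
    · refine absurd ⟨h.y_le (hmin s h1 hs hg) (by omega), ?_, ?_⟩ hc
      · exact h.r_x _ (by omega)
      · rw [← hz s hs, hl.lab_old s h1 (by omega)]
  have hfst : ∀ g ∈ D, r g.1 (y 0) → y (lab g) ≤ g.2 → g.1 ≤ x (lab g) := by
    intro g hg hgr hc
    have hgo := hover g hg hgr
    have hrg := hl.old_range g hgo
    rcases hgo.1 with hgO | ⟨s, h1, hs, rfl⟩
    · by_contra hlt
      rcases hc.eq_or_lt with he | hlt'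
      · have := h.eq_of_new (Or.inl hgO) hrg.2 he.symm
        rw [this] at hlt
        simp only at hlt
        have h2 := hl.lab_new (lab g) hrg.2
        rw [h2] at hlt
        exact hlt le_rfl
      · have := hl.new_lt _ (h.new_over hrg.1 hrg.2) g ⟨Or.inl hgO, hgo.2⟩ ⟨not_le.1 hlt, hlt'⟩
        rw [hl.lab_new _ hrg.2] at this
        exact lt_irrefl _ this
    · rw [← hz s hs, hl.lab_old s h1 (by omega)]
      exact h.leftEnd_le (by omega)
  have hkeepx : ∀ g ∈ D, g ∈ O → r g.1 (y 0) → ¬ y (lab g) ≤ g.2 → x (lab g) ≤ g.1 := by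
    intro g hg hgO hgr hc
    have hgo := hover g hg hgr
    have hrg := hl.old_range g hgo
    by_contra hlt
    have := hl.new_lt g ⟨Or.inl hgO, hgo.2⟩ _ (h.new_over hrg.1 hrg.2) ⟨not_le.1 hlt, not_le.1 hc⟩
    rw [hl.lab_new _ hrg.2] at this
    exact lt_irrefl _ this
  have hmono : ∀ e ∈ D, ∀ f ∈ D, Prec e f → Prec (φ e) (φ f) := by
    intro e he f hf hef
    by_cases hce : y m ≤ e.2 ∧ r e.1 (y 0) ∧ y (lab e) ≤ e.2
    · have hφe : φ e = (x (lab e), y (lab e)) := by simp only [hφ]; rw [if_pos hce]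
      have heo := hover e he hce.2.1
      have hre := hl.old_range e heo
      rw [hφe]
      by_cases hfr : r f.1 (y 0)
      · have hfo := hover f hf hfr
        have hrf := hl.old_range f hfo
        have hlt := hl.old_lt e heo f hfo hef
        by_cases hcf : y (lab f) ≤ f.2
        · have hφf : φ f = (x (lab f), y (lab f)) := by
            simp only [hφ]; rw [if_pos ⟨hce.1.trans hef.2.le, hfr, hcf⟩]
          rw [hφf]
          exact ⟨h.x_lt _ _ hlt hrf.2, h.y_lt _ _ hlt hrf.2⟩
        · have hφf : φ f = f := by simp only [hφ]; rw [if_neg fun h' => hcf h'.2.2]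
          rw [hφf]
          refine ⟨(h.x_lt _ _ hlt hrf.2).trans_le ?_, hce.2.2.trans_lt hef.2⟩
          exact hkeepx f hf (hkeepO f hf fun h' => hcf h'.2.2) hfr hcf
      · have hφf : φ f = f := by simp only [hφ]; rw [if_neg fun h' => hfr h'.2.1]
        rw [hφf]
        refine ⟨?_, hce.2.2.trans_lt hef.2⟩
        -- Every `x s` stands in relation `r` to `y 0`, so a left end not in this relation lies to
        -- the right of all of them.
        by_contra hlt
        exact hfr (h.r_mono _ _ _ _ (h.r_x (lab e) hre.2) (not_lt.1 hlt) le_rfl)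
    · have hφe : φ e = e := by simp only [hφ]; rw [if_neg hce]
      rw [hφe]
      by_cases hcf : y m ≤ f.2 ∧ r f.1 (y 0) ∧ y (lab f) ≤ f.2
      · have hφf : φ f = (x (lab f), y (lab f)) := by simp only [hφ]; rw [if_pos hcf]
        rw [hφf]
        have hfo := hover f hf hcf.2.1
        have hrf := hl.old_range f hfo
        refine ⟨hef.1.trans_le (hfst f hf hcf.2.1 hcf.2.2), ?_⟩
        by_cases hme : y m ≤ e.2
        · have her : r e.1 (y 0) := h.r_mono _ _ _ _ hcf.2.1 hef.1.le le_rfl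
          have hlt := hl.old_lt e (hover e he her) f hfo hef
          have : ¬ y (lab e) ≤ e.2 := fun h' => hce ⟨hme, her, h'⟩
          exact (not_le.1 this).trans (h.y_lt _ _ hlt hrf.2)
        · exact (not_le.1 hme).trans_le (h.y_le (hml f hf hcf.2.1 hcf.1) hrf.2)
      · have hφf : φ f = f := by simp only [hφ]; rw [if_neg hcf]
        rw [hφf]
        exact hef
  obtain ⟨hc, hcard⟩ := hD.image φ hmono
  have hφy : ∀ g ∈ D, y 0 < (φ g).2 := by
    intro g hg
    simp only [hφ]
    split_ifs with hc
    · have hrg := hl.old_range g (hover g hg hc.2.1)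
      exact h.y_lt _ _ (by omega) hrg.2
    · exact hy g hg
  refine ⟨D.image φ, hc, hcard, ?_, ?_, ?_⟩
  · intro e' he'
    simp only [Finset.coe_image, Set.mem_image, Finset.mem_coe] at he'
    obtain ⟨g, hg, rfl⟩ := he'
    simp only [hφ]
    split_ifs with hc
    · exact h.new_mem (hl.old_range g (hover g hg hc.2.1)).2
    · exact Or.inl (hkeepO g hg hc)
  · intro e' he'
    obtain ⟨g, hg, rfl⟩ := Finset.mem_image.1 he'
    exact hφy g hg
  · intro e' he' f' hf'
    obtain ⟨g, hg, rfl⟩ := Finset.mem_image.1 he'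
    obtain ⟨g', hg', rfl⟩ := Finset.mem_image.1 hf'
    by_cases hc : y m ≤ g.2 ∧ r g.1 (y 0) ∧ y (lab g) ≤ g.2
    · have hφe : φ g = (x (lab g), y (lab g)) := by simp only [hφ]; rw [if_pos hc]
      rw [hφe]
      exact h.r_mono _ _ _ _ (h.r_x _ (hl.old_range g (hover g hg hc.2.1)).2) le_rfl
        (hφy g' hg').le
    · have hφe : φ g = g := by simp only [hφ]; rw [if_neg hc]
      rw [hφe]
      by_cases hc' : y m ≤ g'.2 ∧ r g'.1 (y 0) ∧ y (lab g') ≤ g'.2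
      · have hφf : φ g' = (x (lab g'), y (lab g')) := by simp only [hφ]; rw [if_pos hc']
        rw [hφf]
        -- A replaced arc has label at least `m`, so it still ends at `y m` or later, and `g` was
        -- already related to the right end `y m` of an arc of `D`.
        refine h.r_mono _ _ _ _ (hr g hg _ hmD) le_rfl ?_
        exact h.y_le (hml g' hg' hc'.2.1 hc'.1) (hl.old_range g' (hover g' hg' hc'.2.1)).2
      · have hφf : φ g' = g' := by simp only [hφ]; rw [if_neg hc']
        rw [hφf]
        exact hr g hg g' hg'

/-- A chain of old arcs can be pushed to the new arcs other than `(x t, y t)` without moving its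
last left end to the right. -/
theorem exists_new_of_old_left (h : IsExchange r O x y t K) (hl : IsLabelling r O x y t K lab)
    {D : Finset (N × N)} (hD : ArcChain D) (hDo : (D : Set (N × N)) ⊆ oldArcs O x y t)
    (hr : ∀ e ∈ D, y 0 ≤ e.2 → r e.1 (y 0)) :
    ∃ D' : Finset (N × N), ArcChain D' ∧ D'.card = D.card ∧
      (D' : Set (N × N)) ⊆ newArcs O x y t ∧ (x t, y t) ∉ D' ∧
      (∀ e ∈ D', ∃ f ∈ D, e.1 ≤ f.1) ∧
      ∀ e ∈ D', (e ∈ D ∧ e ∈ O) ∨ y 0 ≤ e.2 ∧ r e.1 (y 0) := by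
  classical
  have hle := h.le
  have hnt : ∀ e ∈ O, e ≠ (x t, y t) := fun e he heq => h.ne_x e he t le_rfl (by rw [heq])
  have hne0 : ∀ e ∈ D, e.2 ≠ y 0 := by
    intro e he heq
    rcases hDo he with h' | ⟨s, h1, hs, rfl⟩
    · exact h.ne_y e h' 0 (Nat.zero_le _) heq
    · have := h.y_inj (by omega) (Nat.zero_le _) heq
      omega
  by_cases hex : ∃ s, s ≤ t ∧ 1 ≤ s ∧ (x (s - 1), y s) ∈ D
  swap
  · have hDO : ∀ e ∈ D, e ∈ O := by
      intro e he
      rcases hDo he with h' | ⟨s, h1, hs, rfl⟩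
      · exact h'
      · exact absurd ⟨s, hs, h1, he⟩ hex
    exact ⟨D, hD, rfl, fun e he => Or.inl (hDO e he), fun hmem => hnt _ (hDO _ hmem) rfl,
      fun e he => ⟨e, he, le_rfl⟩, fun e he => Or.inl ⟨he, hDO e he⟩⟩
  obtain ⟨m, hmt, ⟨hm1, hmD⟩, hmax⟩ : ∃ m ≤ t, (1 ≤ m ∧ (x (m - 1), y m) ∈ D) ∧
      ∀ s ≤ t, 1 ≤ s → (x (s - 1), y s) ∈ D → s ≤ m := by
    obtain ⟨s, hs, hsD⟩ := hex
    have := Nat.findGreatest_spec (P := fun s => 1 ≤ s ∧ (x (s - 1), y s) ∈ D) hs hsD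
    exact ⟨_, Nat.findGreatest_le t, this,
      fun s' hs' h1 hsD' => Nat.le_findGreatest hs' ⟨h1, hsD'⟩⟩
  have hz : ∀ s ≤ t, leftEnd x t s = x (s - 1) := fun s hs => by rw [leftEnd, if_pos hs]
  have hover : ∀ g ∈ D, y 0 < g.2 → g ∈ overArcs r (y 0) (oldArcs O x y t) :=
    fun g hg hlt => ⟨hDo hg, hr g hg hlt.le, hlt⟩
  have hlm : ∀ g ∈ D, y 0 < g.2 → g.2 ≤ y m → lab g ≤ m := by
    intro g hg h0 hgm
    rcases hgm.eq_or_lt with he | hlt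
    · rw [h.eq_of_old (hDo hg) hm1 (by omega) he, hl.lab_old m hm1 (by omega)]
    · have := hl.old_lt g (hover g hg h0) _ (h.old_over hm1 (hmt.trans hle)) (by
        rw [hz m hmt]; exact hD.prec_of_snd_lt hg hmD hlt)
      rw [hl.lab_old m hm1 (by omega)] at this
      exact this.le
  -- Up to the last exchanged arc `(x (m - 1), y m)`, an arc over `y 0` is replaced by the new chain
  -- arc with the next smaller label; thus `(x (s - 1), y s)` becomes `(x (s - 1), y (s - 1))`.
  -- Labels are at most `m ≤ t`, so `(x t, y t)` is never hit and no left end passes `x (m - 1)`.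
  -- The arc `(x 0, y 0)` may be hit, whence `y 0 ≤ e.2` in the conclusion.
  set φ : N × N → N × N := fun g =>
    if y 0 < g.2 ∧ g.2 ≤ y m ∧ g.1 ≤ x (lab g - 1) then (x (lab g - 1), y (lab g - 1)) else g
    with hφ
  have hkeepO : ∀ g ∈ D, ¬ (y 0 < g.2 ∧ g.2 ≤ y m ∧ g.1 ≤ x (lab g - 1)) → g ∈ O := by
    intro g hg hc
    rcases hDo hg with h' | ⟨s, h1, hs, rfl⟩
    · exact h'
    · refine absurd ⟨h.y_lt _ _ (by omega) (by omega), h.y_le (hmax s hs h1 hg) (by omega), ?_⟩ hc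
      rw [← hz s hs, hl.lab_old s h1 (by omega), hz s hs]
  -- comparison of right ends for moved arcs
  have hmovey : ∀ g ∈ D, y 0 < g.2 → g.2 ≤ y m → g.1 ≤ x (lab g - 1) → y (lab g) ≤ g.2 := by
    intro g hg h0 hgm hc
    have hgo := hover g hg h0
    have hrg := hl.old_range g hgo
    have hlab := hlm g hg h0 hgm
    by_contra hlt
    rcases hc.eq_or_lt with he | hlt'
    · rcases hgo.1 with hgO | ⟨s, h1, hs, rfl⟩
      · exact h.ne_x g hgO _ (by omega) he
      · rw [← hz s hs, hl.lab_old s h1 (by omega)] at hlt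
        exact hlt le_rfl
    · have := hl.old_lt g hgo _ (h.old_over hrg.1 hrg.2)
        ⟨by rw [hz _ (by omega)]; exact hlt', not_le.1 hlt⟩
      rw [hl.lab_old _ hrg.1 hrg.2] at this
      exact lt_irrefl _ this
  -- The labelling of the old arcs bounds the right end of a kept arc; given this, the labelling of
  -- the new arcs bounds its left end.
  have hkeep : ∀ g ∈ D, y 0 < g.2 → g.2 ≤ y m → ¬ g.1 ≤ x (lab g - 1) →
      g.2 < y (lab g) ∧ x (lab g) ≤ g.1 := by
    intro g hg h0 hgm hc
    have hgO := hkeepO g hg fun h' => hc h'.2.2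
    have hgo := hover g hg h0
    have hrg := hl.old_range g hgo
    have hlab := hlm g hg h0 hgm
    have h1 : g.2 < y (lab g) := by
      by_contra hlt
      rcases (not_lt.1 hlt).eq_or_lt with he | hlt'
      · exact h.ne_y g hgO _ (by omega) he.symm
      · have := hl.old_lt _ (h.old_over hrg.1 hrg.2) g hgo
          ⟨by rw [hz _ (by omega)]; exact not_le.1 hc, hlt'⟩
        rw [hl.lab_old _ hrg.1 hrg.2] at this
        exact lt_irrefl _ this
    refine ⟨h1, ?_⟩
    by_contra hlt
    have := hl.new_lt g ⟨Or.inl hgO, hgo.2⟩ _ (h.new_over hrg.1 hrg.2) ⟨not_le.1 hlt, h1⟩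
    rw [hl.lab_new _ hrg.2] at this
    exact lt_irrefl _ this
  have hmono : ∀ e ∈ D, ∀ f ∈ D, Prec e f → Prec (φ e) (φ f) := by
    intro e he f hf hef
    by_cases hce : y 0 < e.2 ∧ e.2 ≤ y m ∧ e.1 ≤ x (lab e - 1)
    · have hφe : φ e = (x (lab e - 1), y (lab e - 1)) := by simp only [hφ]; rw [if_pos hce]
      rw [hφe]
      have heo := hover e he hce.1
      have hre := hl.old_range e heo
      have hlm' := hlm e he hce.1 hce.2.1
      have hf0 : y 0 < f.2 := hce.1.trans hef.2
      have hfo := hover f hf hf0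
      have hrf := hl.old_range f hfo
      have hlt := hl.old_lt e heo f hfo hef
      by_cases hfm : f.2 ≤ y m
      · by_cases hcf : f.1 ≤ x (lab f - 1)
        · have hφf : φ f = (x (lab f - 1), y (lab f - 1)) := by
            simp only [hφ]; rw [if_pos ⟨hf0, hfm, hcf⟩]
          rw [hφf]
          exact ⟨h.x_lt _ _ (by omega) (by omega), h.y_lt _ _ (by omega) (by omega)⟩
        · have hφf : φ f = f := by simp only [hφ]; rw [if_neg fun h' => hcf h'.2.2]
          rw [hφf]
          refine ⟨(h.x_lt _ _ (by omega) hrf.2).trans_le (hkeep f hf hf0 hfm hcf).2, ?_⟩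
          refine ((h.y_lt _ _ (by omega) hre.2).trans_le
            (hmovey e he hce.1 hce.2.1 hce.2.2)).trans hef.2
      · have hφf : φ f = f := by simp only [hφ]; rw [if_neg fun h' => hfm h'.2.1]
        rw [hφf]
        have hp := hD.prec_of_snd_lt hmD hf (not_le.1 hfm)
        exact ⟨(h.x_le (by omega) (by omega)).trans_lt hp.1,
          (h.y_le (by omega) (by omega)).trans_lt (not_le.1 hfm)⟩
    · have hφe : φ e = e := by simp only [hφ]; rw [if_neg hce]
      rw [hφe]
      by_cases hcf : y 0 < f.2 ∧ f.2 ≤ y m ∧ f.1 ≤ x (lab f - 1)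
      · have hφf : φ f = (x (lab f - 1), y (lab f - 1)) := by simp only [hφ]; rw [if_pos hcf]
        rw [hφf]
        refine ⟨hef.1.trans_le hcf.2.2, ?_⟩
        have hfo := hover f hf hcf.1
        have hrf := hl.old_range f hfo
        by_cases he0 : y 0 < e.2
        · have hem := hef.2.le.trans hcf.2.1
          have hlt := hl.old_lt e (hover e he he0) f hfo hef
          have hk := hkeep e he he0 hem fun h' => hce ⟨he0, hem, h'⟩
          exact hk.1.trans_le (h.y_le (by omega) (by omega))
        · exact (lt_of_le_of_ne (not_lt.1 he0) (hne0 e he)).trans_le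
            (h.y_le (Nat.zero_le _) (by omega))
      · have hφf : φ f = f := by simp only [hφ]; rw [if_neg hcf]
        rw [hφf]
        exact hef
  obtain ⟨hc, hcard⟩ := hD.image φ hmono
  refine ⟨D.image φ, hc, hcard, ?_, ?_, ?_, ?_⟩
  · intro e' he'
    simp only [Finset.coe_image, Set.mem_image, Finset.mem_coe] at he'
    obtain ⟨g, hg, rfl⟩ := he'
    simp only [hφ]
    split_ifs with hc
    · have := hl.old_range g (hover g hg hc.1)
      exact h.new_mem (by omega)
    · exact Or.inl (hkeepO g hg hc)
  · intro hmem
    obtain ⟨g, hg, heq⟩ := Finset.mem_image.1 hmem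
    simp only [hφ] at heq
    split_ifs at heq with hc
    · have h1 := hl.old_range g (hover g hg hc.1)
      have h2 := hlm g hg hc.1 hc.2.1
      have := h.y_inj (by omega) (by omega) (congrArg Prod.snd heq)
      omega
    · exact hnt g (hkeepO g hg hc) heq
  · intro e' he'
    obtain ⟨g, hg, rfl⟩ := Finset.mem_image.1 he'
    simp only [hφ]
    split_ifs with hc
    · have h2 := hlm g hg hc.1 hc.2.1
      exact ⟨_, hmD, h.x_le (by omega) (by omega)⟩
    · exact ⟨g, hg, le_rfl⟩
  · intro e' he'
    obtain ⟨g, hg, rfl⟩ := Finset.mem_image.1 he'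
    simp only [hφ]
    split_ifs with hc
    · have h1 := hl.old_range g (hover g hg hc.1)
      exact Or.inr ⟨h.y_le (Nat.zero_le _) (by omega), h.r_x _ (by omega)⟩
    · exact Or.inl ⟨hg, hkeepO g hg hc⟩

end IsExchange
end Exchange

/-! ### Construction of labellings, and comparison of competing chains with the chain of the
exchange. -/

section Exchange

variable {N : Type*} [LinearOrder N]

theorem ArcChain.exists_fun {D : Finset (N × N)} (hD : ArcChain D) {m : ℕ} (hm : D.card = m) :
    ∃ i j : Fin m → N, StrictMono i ∧ StrictMono j ∧ (∀ s, (i s, j s) ∈ D) ∧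
      ∀ e ∈ D, ∃ s, e = (i s, j s) := by
  classical
  have hc : (D.image Prod.fst).card = m := by
    rw [Finset.card_image_of_injOn, hm]
    exact fun e he f hf hef => hD.eq_of_fst_eq he hf hef
  have hex : ∀ s : Fin m, ∃ v, ((D.image Prod.fst).orderEmbOfFin hc s, v) ∈ D := by
    intro s
    obtain ⟨e, he, h⟩ := Finset.mem_image.1 ((D.image Prod.fst).orderEmbOfFin_mem hc s)
    exact ⟨e.2, by rw [← h]; exact he⟩
  choose j hj using hex
  have hi : StrictMono ((D.image Prod.fst).orderEmbOfFin hc) := OrderEmbedding.strictMono _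
  refine ⟨_, j, hi, fun s s' hs => ?_, hj, fun e he => ?_⟩
  · exact (hD.prec_of_fst_lt (hj s) (hj s') (hi hs)).2
  · have : e.1 ∈ Set.range ((D.image Prod.fst).orderEmbOfFin hc) := by
      rw [Finset.range_orderEmbOfFin]
      exact Finset.mem_coe.2 (Finset.mem_image_of_mem _ he)
    obtain ⟨s, hs⟩ := this
    exact ⟨s, hD.eq_of_fst_eq he (hj s) hs.symm⟩

theorem ArcChain.of_indexed {ι : Type*} [LinearOrder ι] (I : Finset ι) (w : ι → N × N)
    (hw : ∀ s ∈ I, ∀ s' ∈ I, s < s' → Prec (w s) (w s')) :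
    ArcChain (I.image w) ∧ (I.image w).card = I.card := by
  constructor
  · intro e he f hf hne
    simp only [Finset.coe_image, Set.mem_image, Finset.mem_coe] at he hf
    obtain ⟨s, hs, rfl⟩ := he
    obtain ⟨s', hs', rfl⟩ := hf
    rcases lt_trichotomy s s' with h | rfl | h
    · exact Or.inl (hw s hs s' hs' h)
    · exact absurd rfl hne
    · exact Or.inr (hw s' hs' s hs h)
  · refine Finset.card_image_of_injOn fun s hs s' hs' h => ?_
    rcases lt_trichotomy s s' with h' | h' | h'
    · exact absurd (h ▸ hw s hs s' hs' h' : Prec (w s') (w s')) (Prec.irrefl _)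
    · exact h'
    · exact absurd (h ▸ hw s' hs' s hs h' : Prec (w s') (w s')) (Prec.irrefl _)

theorem ArcChain.union {D E : Finset (N × N)} (hD : ArcChain D) (hE : ArcChain E)
    (h : ∀ d ∈ D, ∀ e ∈ E, Prec d e) : ArcChain (D ∪ E) ∧ (D ∪ E).card = D.card + E.card := by
  constructor
  · intro e he f hf hne
    simp only [Finset.coe_union, Set.mem_union, Finset.mem_coe] at he hf
    rcases he with he | he <;> rcases hf with hf | hf
    · exact hD he hf hne
    · exact Or.inl (h e he f hf)
    · exact Or.inr (h f hf e he)
    · exact hE he hf hne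
  · refine Finset.card_union_of_disjoint (Finset.disjoint_left.2 fun d hd hd' => ?_)
    exact Prec.irrefl d (h d hd d hd')

theorem ArcChain.subset {D E : Finset (N × N)} (hD : ArcChain D) (h : E ⊆ D) : ArcChain E :=
  IsChain.mono (by exact_mod_cast h) hD

theorem isChain_flip {D : Finset (N × N)} :
    IsChain (fun e f => Prec f e) (D : Set (N × N)) ↔ ArcChain D :=
  ⟨fun h _ he _ hf hne => (h he hf hne).symm, fun h _ he _ hf hne => (h he hf hne).symm⟩

namespace IsExchange

variable {r : N → N → Prop} {O : Set (N × N)} {x y : ℕ → N} {t K : ℕ}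

/-- Arcs ending at some `y s` with `s ≤ K` get the label `s`, all others their rank. The old arc
ending at `y s` starts no later than the new one, so `hbefore`, stated for new chain arcs, and
`hafter`, stated for old ones, each cover both sides of the exchange. -/
theorem exists_labelling_of_rank (h : IsExchange r O x y t K) (rk : N × N → ℕ)
    (hrange : ∀ f ∈ overArcs r (y 0) O, 1 ≤ rk f ∧ rk f ≤ K)
    (hlt : ∀ f ∈ overArcs r (y 0) O, ∀ g ∈ overArcs r (y 0) O, Prec f g → rk f < rk g)
    (hbefore : ∀ f ∈ overArcs r (y 0) O, ∀ s, 1 ≤ s → s ≤ K → Prec f (x s, y s) → rk f < s)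
    (hafter : ∀ f ∈ overArcs r (y 0) O, ∀ s, 1 ≤ s → s ≤ K →
      Prec (leftEnd x t s, y s) f → s < rk f)
    (htail : ∀ s, t < s → s ≤ K → rk (x s, y s) = s) :
    ∃ lab, IsLabelling r O x y t K lab ∧ ∀ f ∈ overArcs r (y 0) O, lab f = rk f := by
  classical
  have hle := h.le
  let lab : N × N → ℕ := fun f => if hf : ∃ s, s ≤ K ∧ f.2 = y s then Nat.find hf else rk f
  have hlab : ∀ f : N × N, ∀ s ≤ K, f.2 = y s → lab f = s := by
    intro f s hs hf
    have hex : ∃ s, s ≤ K ∧ f.2 = y s := ⟨s, hs, hf⟩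
    have h1 := Nat.find_spec hex
    have : lab f = Nat.find hex := dif_pos hex
    rw [this]
    exact h.y_inj h1.1 hs (h1.2.symm.trans hf)
  have hO : ∀ f ∈ overArcs r (y 0) O, lab f = rk f := by
    intro f hf
    by_cases hex : ∃ s, s ≤ K ∧ f.2 = y s
    · obtain ⟨s, hs, hfs⟩ := hex
      rw [hlab f s hs hfs]
      by_cases hst : s ≤ t
      · exact absurd hfs (h.ne_y f hf.1 s hst)
      · rw [h.inj_snd f hf.1 _ (h.tail s (by omega) hs) hfs, htail s (by omega) hs]
    · exact dif_neg hex
  refine ⟨lab, ⟨?_, ?_, ?_, ?_, fun s hs => hlab _ s hs rfl, fun s _ hs => hlab _ s hs rfl⟩, hO⟩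
  · rintro f ⟨hf | ⟨s, h1, hs, rfl⟩, hov⟩
    · rw [hO f ⟨hf, hov⟩]; exact hrange f ⟨hf, hov⟩
    · rw [hlab _ s (by omega) rfl]; omega
  · rintro f ⟨hf | ⟨s, h1, hs, rfl⟩, hov⟩ g ⟨hg | ⟨s', h1', hs', rfl⟩, hov'⟩ hp
    · rw [hO f ⟨hf, hov⟩, hO g ⟨hg, hov'⟩]; exact hlt f ⟨hf, hov⟩ g ⟨hg, hov'⟩ hp
    · rw [hO f ⟨hf, hov⟩, hlab _ s' (by omega) rfl]
      exact hbefore f ⟨hf, hov⟩ s' h1' (by omega)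
        ⟨hp.1.trans_le (h.x_le (by omega) (by omega)), hp.2⟩
    · rw [hO g ⟨hg, hov'⟩, hlab _ s (by omega) rfl]
      exact hafter g ⟨hg, hov'⟩ s h1 (by omega) (by rw [leftEnd, if_pos hs]; exact hp)
    · rw [hlab _ s (by omega) rfl, hlab _ s' (by omega) rfl]
      by_contra hn
      exact absurd hp.2 (h.y_le (not_lt.1 hn) (by omega)).not_gt
  · rintro f ⟨hf | ⟨s, hs, rfl⟩, hov⟩
    · rw [hO f ⟨hf, hov⟩]; exact hrange f ⟨hf, hov⟩
    · rw [hlab _ s (by omega) rfl]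
      refine ⟨?_, by omega⟩
      rcases Nat.eq_zero_or_pos s with rfl | hpos
      · exact absurd hov.2 (lt_irrefl _)
      · exact hpos
  · rintro f ⟨hf | ⟨s, hs, rfl⟩, hov⟩ g ⟨hg | ⟨s', hs', rfl⟩, hov'⟩ hp
    · rw [hO f ⟨hf, hov⟩, hO g ⟨hg, hov'⟩]; exact hlt f ⟨hf, hov⟩ g ⟨hg, hov'⟩ hp
    · rw [hO f ⟨hf, hov⟩, hlab _ s' (by omega) rfl]
      refine hbefore f ⟨hf, hov⟩ s' ?_ (by omega) hp
      rcases Nat.eq_zero_or_pos s' with rfl | hpos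
      · exact absurd hov'.2 (lt_irrefl _)
      · exact hpos
    · rw [hO g ⟨hg, hov'⟩, hlab _ s (by omega) rfl]
      rcases Nat.eq_zero_or_pos s with rfl | hpos
      · exact (hrange g ⟨hg, hov'⟩).1
      · exact hafter g ⟨hg, hov'⟩ s hpos (by omega)
          ⟨(h.leftEnd_le (by omega)).trans_lt hp.1, hp.2⟩
    · rw [hlab _ s (by omega) rfl, hlab _ s' (by omega) rfl]
      by_contra hn
      exact absurd hp.2 (h.y_le (not_lt.1 hn) (by omega)).not_gt

theorem overArcs_old (f : N × N) (hf : f ∈ overArcs r (y 0) O) :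
    f ∈ overArcs r (y 0) (oldArcs O x y t) := ⟨Or.inl hf.1, hf.2⟩

theorem overArcs_new (f : N × N) (hf : f ∈ overArcs r (y 0) O) :
    f ∈ overArcs r (y 0) (newArcs O x y t) := ⟨Or.inl hf.1, hf.2⟩

theorem old_prec (h : IsExchange r O x y t K) {s s' : ℕ} (h1 : 1 ≤ s) (hs : s < s')
    (hs' : s' ≤ K) : Prec (leftEnd x t s, y s) (leftEnd x t s', y s') :=
  ⟨h.leftEnd_lt h1 hs hs', h.y_lt _ _ hs hs'⟩

theorem new_prec (h : IsExchange r O x y t K) {s s' : ℕ} (hs : s < s') (hs' : s' ≤ K) :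
    Prec (x s, y s) (x s', y s') :=
  ⟨h.x_lt _ _ hs hs', h.y_lt _ _ hs hs'⟩

/-- Labelling by ranks of the old arcs, if the chain of the exchange is pointwise minimal. -/
theorem exists_labelling_forward (h : IsExchange r O x y t K)
    (hno : ∀ D : Finset (N × N), (D : Set (N × N)) ⊆ overArcs r (y 0) (oldArcs O x y t) →
      ArcChain D → D.card ≠ K + 1)
    (hmin : ∀ i j : Fin K → N, StrictMono i → StrictMono j →
      (∀ s, (i s, j s) ∈ overArcs r (y 0) (oldArcs O x y t)) → ∀ s : Fin K, y (s + 1) ≤ j s) :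
    ∃ lab, IsLabelling r O x y t K lab ∧
      ∀ f ∈ overArcs r (y 0) (oldArcs O x y t), ∀ s, 1 ≤ s → s ≤ K →
        (s < K → f.1 < leftEnd x t (s + 1)) → f.2 < y s → lab f < s := by
  classical
  have hle := h.le
  obtain ⟨rk, hrange, hlt, hex, hmax⟩ := exists_rank Prec (fun _ _ _ => Prec.trans) Prec.irrefl
    (overArcs r (y 0) (oldArcs O x y t)) K (fun D hD hc => hno D hD hc)
  have hcard : ∀ D : Finset (N × N), (D : Set (N × N)) ⊆ overArcs r (y 0) (oldArcs O x y t) →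
      ArcChain D → D.card ≤ K := by
    intro D hD hc
    by_contra hgt
    obtain ⟨E, hE, hEc⟩ := Finset.exists_subset_card_eq (show K + 1 ≤ D.card by omega)
    exact hno E (fun e he => hD (hE he)) (hc.subset hE) hEc
  -- the end of the chain of the exchange
  have htl : ∀ s, ArcChain ((Finset.Ioc s K).image fun s => (leftEnd x t s, y s)) ∧
      ((Finset.Ioc s K).image fun s => (leftEnd x t s, y s)).card = K - s := by
    intro s
    have := ArcChain.of_indexed (Finset.Ioc s K) (fun s => (leftEnd x t s, y s)) (by
      intro a ha b hb hab
      simp only [Finset.mem_Ioc] at ha hb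
      exact h.old_prec (by omega) hab hb.2)
    rwa [Nat.card_Ioc] at this
  have htlS : ∀ s, (((Finset.Ioc s K).image fun s => (leftEnd x t s, y s) : Finset (N × N)) :
      Set (N × N)) ⊆ overArcs r (y 0) (oldArcs O x y t) := by
    intro s e he
    simp only [Finset.coe_image, Set.mem_image, Finset.mem_coe, Finset.mem_Ioc] at he
    obtain ⟨a, ha, rfl⟩ := he
    exact h.old_over (by omega) ha.2
  -- A chain preceding the old chain arc with index `s + 1` can be prolonged by the rest of the old
  -- chain; the bound `K` on the result bounds the chain itself by `s`.
  have hjoin : ∀ D : Finset (N × N), (D : Set (N × N)) ⊆ overArcs r (y 0) (oldArcs O x y t) →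
      ArcChain D → ∀ s ≤ K, (s < K → ∀ d ∈ D, Prec d (leftEnd x t (s + 1), y (s + 1))) →
      ArcChain (D ∪ (Finset.Ioc s K).image fun s => (leftEnd x t s, y s)) ∧
      ((D ∪ (Finset.Ioc s K).image fun s => (leftEnd x t s, y s) : Finset (N × N)) :
        Set (N × N)) ⊆ overArcs r (y 0) (oldArcs O x y t) ∧
      (D ∪ (Finset.Ioc s K).image fun s => (leftEnd x t s, y s)).card = D.card + (K - s) := by
    intro D hD hc s hs hp
    have := ArcChain.union hc (htl s).1 (by
      intro d hd e he
      simp only [Finset.mem_image, Finset.mem_Ioc] at he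
      obtain ⟨a, ha, rfl⟩ := he
      have h1 := hp (by omega) d hd
      rcases Nat.lt_or_ge (s + 1) a with hlt' | hge
      · exact h1.trans (h.old_prec (by omega) hlt' ha.2)
      · have : a = s + 1 := by omega
        exact this ▸ h1)
    refine ⟨this.1, ?_, by rw [this.2, (htl s).2]⟩
    rw [Finset.coe_union]
    exact Set.union_subset hD (htlS s)
  -- The first `s` chain arcs give rank at least `s`; a longer chain ending there, followed by the
  -- rest of the old chain, would exceed `K`.
  have hc : ∀ s, 1 ≤ s → s ≤ K → rk (leftEnd x t s, y s) = s := by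
    intro s h1 hs
    apply le_antisymm
    · obtain ⟨D, ⟨hDS, hDc, hfD, hDf⟩, hDcard⟩ := hex _ (h.old_over h1 hs)
      obtain ⟨k1, k2, k3⟩ := hjoin D hDS hDc s hs (by
        intro hsK d hd
        have hp := h.old_prec h1 (Nat.lt_succ_self s) hsK
        rcases hDf d hd with rfl | hd'
        · exact hp
        · exact hd'.trans hp)
      have := hcard _ k2 k1
      omega
    · have h2 := ArcChain.of_indexed (Finset.Icc 1 s) (fun s => (leftEnd x t s, y s)) (by
        intro a ha b hb hab
        simp only [Finset.mem_Icc] at ha hb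
        exact h.old_prec (by omega) hab (by omega))
      rw [Nat.card_Icc] at h2
      have := hmax _ (h.old_over h1 hs) _ ⟨?_, h2.1, ?_, ?_⟩
      · rw [h2.2] at this
        omega
      · intro e he
        simp only [Finset.coe_image, Set.mem_image, Finset.mem_coe, Finset.mem_Icc] at he
        obtain ⟨a, ha, rfl⟩ := he
        exact h.old_over (by omega) (by omega)
      · exact Finset.mem_image_of_mem (fun s => (leftEnd x t s, y s))
          (Finset.mem_Icc.2 ⟨h1, le_rfl⟩)
      · intro e he
        simp only [Finset.mem_image, Finset.mem_Icc] at he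
        obtain ⟨a, ha, rfl⟩ := he
        rcases Nat.lt_or_ge a s with hlt' | hge
        · exact Or.inr (h.old_prec (by omega) hlt' hs)
        · have : a = s := by omega
          exact Or.inl (by rw [this])
  -- A longest chain up to `f` with at least `s` arcs, prolonged by the end of the old chain, would
  -- have exactly `K` arcs, with `f` in position `s`. Pointwise minimality would then give `y s ≤
  -- f.2`.
  have hR : ∀ f ∈ overArcs r (y 0) (oldArcs O x y t), ∀ s, 1 ≤ s → s ≤ K →
      (s < K → f.1 < leftEnd x t (s + 1)) → f.2 < y s → rk f < s := by
    intro f hf s h1 hs hfx hfy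
    by_contra hge
    obtain ⟨D, ⟨hDS, hDc, hfD, hDf⟩, hDcard⟩ := hex f hf
    obtain ⟨k1, k2, k3⟩ := hjoin D hDS hDc s hs (by
      intro hsK d hd
      have hp : Prec f (leftEnd x t (s + 1), y (s + 1)) :=
        ⟨hfx hsK, hfy.trans (h.y_lt _ _ (Nat.lt_succ_self s) hsK)⟩
      rcases hDf d hd with rfl | hd'
      · exact hp
      · exact hd'.trans hp)
    have h3 := hcard _ k2 k1
    obtain ⟨i, j, hi, hj, hmem, hsurj⟩ := k1.exists_fun (m := K) (by omega)
    obtain ⟨p, hp⟩ := hsurj f (Finset.mem_union_left _ hfD)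
    have h4 := hmin i j hi hj (fun s => k2 (hmem s)) p
    have h5 : y ((p : ℕ) + 1) < y s := by rw [hp] at hfy; exact h4.trans_lt hfy
    have h6 : (p : ℕ) + 1 < s := by
      by_contra hn
      exact absurd h5 (h.y_le (not_lt.1 hn) (by omega)).not_gt
    have h7 : D ⊆ (Finset.Iic p).image fun q => (i q, j q) := by
      intro d hd
      obtain ⟨q, hq⟩ := hsurj d (Finset.mem_union_left _ hd)
      refine Finset.mem_image.2 ⟨q, Finset.mem_Iic.2 ?_, hq.symm⟩
      rcases hDf d hd with h' | h'
      · rw [hq, hp] at h'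
        exact (hi.injective (congrArg Prod.fst h')).le
      · rw [hq, hp] at h'
        exact (hi.lt_iff_lt.1 h'.1).le
    have h8 := (Finset.card_le_card h7).trans Finset.card_image_le
    rw [Fin.card_Iic] at h8
    omega
  obtain ⟨lab, hl, hlO⟩ := h.exists_labelling_of_rank rk
    (fun f hf => hrange f (overArcs_old f hf))
    (fun f hf g hg => hlt f (overArcs_old f hf) g (overArcs_old g hg))
    (by
      intro f hf s h1 hs hp
      refine hR f (overArcs_old f hf) s h1 hs (fun hsK => ?_) hp.2
      exact hp.1.trans_le ((h.x_pred_le_leftEnd (s := s + 1) hsK)))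
    (by
      intro f hf s h1 hs hp
      have := hlt _ (h.old_over h1 hs) f (overArcs_old f hf) hp
      rwa [hc s h1 hs] at this)
    (by
      intro s hts hs
      have := hc s (by omega) hs
      rwa [leftEnd, if_neg (by omega)] at this)
  refine ⟨lab, hl, ?_⟩
  rintro f ⟨hf | ⟨s', h1', hs', rfl⟩, hov⟩ s h1 hs hfx hfy
  · rw [hlO f ⟨hf, hov⟩]
    exact hR f ⟨Or.inl hf, hov⟩ s h1 hs hfx hfy
  · have := hl.lab_old s' h1' (by omega)
    rw [leftEnd, if_pos hs'] at this
    rw [this]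
    by_contra hn
    exact absurd hfy (h.y_le (not_lt.1 hn) (by omega)).not_gt

/-- Labelling by coranks of the new arcs, if the chain of the exchange is lexicographically
maximal. -/
theorem exists_labelling_backward (h : IsExchange r O x y t K)
    (hno : ∀ D : Finset (N × N), (D : Set (N × N)) ⊆ overArcs r (y 0) (newArcs O x y t) →
      ArcChain D → D.card ≠ K + 1)
    (hmax : ∀ s, 1 ≤ s → s ≤ t → ∀ F : Finset (N × N),
      (F : Set (N × N)) ⊆ overArcs r (y 0) (newArcs O x y t) → ArcChain F →
      F.card = K + 1 - s → ¬ ∀ f ∈ F, x (s - 1) < f.1 ∧ y s < f.2) :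
    ∃ lab, IsLabelling r O x y t K lab := by
  classical
  have hle := h.le
  -- The reversed order makes `ck f` the size of a longest chain of new arcs starting at `f`; the
  -- label will be `K + 1 - ck f`.
  obtain ⟨ck, hrange, hlt, hex, hge⟩ := exists_rank (fun e f : N × N => Prec f e)
    (fun _ _ _ h1 h2 => Prec.trans h2 h1) Prec.irrefl
    (overArcs r (y 0) (newArcs O x y t)) K (fun D hD hc => hno D hD (isChain_flip.1 hc))
  have hcard : ∀ D : Finset (N × N), (D : Set (N × N)) ⊆ overArcs r (y 0) (newArcs O x y t) →
      ArcChain D → D.card ≤ K := by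
    intro D hD hc
    by_contra hgt
    obtain ⟨E, hE, hEc⟩ := Finset.exists_subset_card_eq (show K + 1 ≤ D.card by omega)
    exact hno E (fun e he => hD (hE he)) (hc.subset hE) hEc
  have hch : ∀ I : Finset ℕ, (∀ s ∈ I, 1 ≤ s ∧ s ≤ K) →
      ArcChain (I.image fun s => (x s, y s)) ∧ (I.image fun s => (x s, y s)).card = I.card ∧
      ((I.image fun s => (x s, y s) : Finset (N × N)) : Set (N × N)) ⊆
        overArcs r (y 0) (newArcs O x y t) := by
    intro I hI
    obtain ⟨h1, h2⟩ := ArcChain.of_indexed I (fun s => (x s, y s))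
      (fun a ha b hb hab => h.new_prec hab (hI b hb).2)
    refine ⟨h1, h2, ?_⟩
    intro e he
    simp only [Finset.coe_image, Set.mem_image, Finset.mem_coe] at he
    obtain ⟨a, ha, rfl⟩ := he
    exact h.new_over (hI a ha).1 (hI a ha).2
  have hc : ∀ s, 1 ≤ s → s ≤ K → ck (x s, y s) = K + 1 - s := by
    intro s h1 hs
    apply le_antisymm
    · obtain ⟨D, ⟨hDS, hDc, hfD, hDf⟩, hDcard⟩ := hex _ (h.new_over h1 hs)
      obtain ⟨k1, k2, k3⟩ := hch (Finset.Ico 1 s) (by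
        intro a ha; simp only [Finset.mem_Ico] at ha; omega)
      have h2 := ArcChain.union k1 (isChain_flip.1 hDc) (by
        intro e he d hd
        simp only [Finset.mem_image, Finset.mem_Ico] at he
        obtain ⟨a, ha, rfl⟩ := he
        have hp := h.new_prec ha.2 hs
        rcases hDf d hd with rfl | hd'
        · exact hp
        · exact hp.trans hd')
      have h3 := hcard _ (by rw [Finset.coe_union]; exact Set.union_subset k3 hDS) h2.1
      rw [Nat.card_Ico] at k2
      omega
    · obtain ⟨k1, k2, k3⟩ := hch (Finset.Icc s K) (by
        intro a ha; simp only [Finset.mem_Icc] at ha; omega)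
      have := hge _ (h.new_over h1 hs) _ ⟨k3, isChain_flip.2 k1, ?_, ?_⟩
      · rw [k2, Nat.card_Icc] at this
        exact this
      · exact Finset.mem_image_of_mem (fun s => (x s, y s)) (Finset.mem_Icc.2 ⟨le_rfl, hs⟩)
      · intro e he
        simp only [Finset.mem_image, Finset.mem_Icc] at he
        obtain ⟨a, ha, rfl⟩ := he
        rcases Nat.lt_or_ge s a with hlt' | hge'
        · exact Or.inr (h.new_prec hlt' ha.2)
        · have : a = s := by omega
          exact Or.inl (by rw [this])
  -- For `s > t` the chain arc is the same before and after the exchange. For `s ≤ t` a failure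
  -- would give a chain of `K + 1 - s` new arcs beyond `(x (s - 1), y s)`, which `hmax` excludes.
  have hafter : ∀ f ∈ overArcs r (y 0) O, ∀ s, 1 ≤ s → s ≤ K →
      Prec (leftEnd x t s, y s) f → s < K + 1 - ck f := by
    intro f hf s h1 hs hp
    have hf' := overArcs_new (x := x) (y := y) (t := t) f hf
    have hrf := hrange f hf'
    by_cases hst : s ≤ t
    · by_contra hn
      obtain ⟨D, ⟨hDS, hDc, hfD, hDf⟩, hDcard⟩ := hex f hf'
      obtain ⟨E, hE, hEc⟩ := Finset.exists_subset_card_eq (show K + 1 - s ≤ D.card by omega)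
      refine hmax s h1 hst E (fun e he => hDS (hE he)) ((isChain_flip.1 hDc).subset hE) hEc ?_
      intro e he
      rw [leftEnd, if_pos hst] at hp
      rcases hDf e (hE he) with rfl | h'
      · exact hp
      · exact hp.trans h'
    · rw [leftEnd, if_neg hst] at hp
      have := hlt f hf' _ (h.new_over h1 hs) hp
      rw [hc s h1 hs] at this
      omega
  obtain ⟨lab, hl, -⟩ := h.exists_labelling_of_rank (fun f => K + 1 - ck f)
    (fun f hf => by have := hrange f (overArcs_new f hf); constructor <;> omega)
    (fun f hf g hg hp => by
      have h1 := hlt g (overArcs_new g hg) f (overArcs_new f hf) hp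
      have h2 := hrange f (overArcs_new f hf)
      have h3 := hrange g (overArcs_new g hg)
      omega)
    (by
      intro f hf s h1 hs hp
      have h2 := hlt _ (h.new_over h1 hs) f (overArcs_new f hf) hp
      have h3 := hrange f (overArcs_new f hf)
      rw [hc s h1 hs] at h2
      omega)
    hafter
    (by
      intro s hts hs
      simp only [hc s (by omega) hs]
      omega)
  exact ⟨lab, hl⟩

/-- Strictly increasing integers filling an interval of their own number have no room to deviate.
Hence in a competing chain of full length every label equals the position. -/
theorem lab_eq_of_strictMono {m : ℕ} (g : Fin m → ℕ) (hg : StrictMono g) (c : ℕ)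
    (h0 : ∀ p, c ≤ g p) (h1 : ∀ p, g p < c + m) (p : Fin m) : g p = p + c := by
  have hlow : ∀ q : ℕ, ∀ hq : q < m, q + c ≤ g ⟨q, hq⟩ := by
    intro q
    induction q with
    | zero => intro hq; simpa using h0 ⟨0, hq⟩
    | succ q ih =>
      intro hq
      have := ih (by omega)
      have h2 : g ⟨q, by omega⟩ < g ⟨q + 1, hq⟩ := hg (by simp)
      omega
  have hup : ∀ d : ℕ, ∀ q : ℕ, ∀ hq : q < m, q + d + 1 = m → g ⟨q, hq⟩ ≤ q + c := by
    intro d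
    induction d with
    | zero => intro q hq hqm; have := h1 ⟨q, hq⟩; omega
    | succ d ih =>
      intro q hq hqm
      have := ih (q + 1) (by omega) (by omega)
      have h2 : g ⟨q, hq⟩ < g ⟨q + 1, by omega⟩ := hg (by simp)
      omega
  have := hlow p p.2
  have := hup (m - p - 1) p p.2 (by omega)
  simp only [Fin.eta] at *
  omega

/-- Chains of new arcs that start at `y 0` do not exceed the chain of the exchange, up to `t`. -/
theorem le_of_new (h : IsExchange r O x y t K) {lab : N × N → ℕ}
    (hl : IsLabelling r O x y t K lab) {i j : Fin (K + 1) → N} (hi : StrictMono i)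
    (hj : StrictMono j) (hmem : ∀ p, (i p, j p) ∈ newArcs O x y t) (hr : ∀ p, r (i p) (y 0))
    (h0 : j 0 = y 0) (p : Fin (K + 1)) (hp : (p : ℕ) ≤ t) : j p ≤ y p := by
  have hle := h.le
  have hzero : (i 0, j 0) = (x 0, y 0) := h.eq_of_new (hmem 0) (Nat.zero_le _) h0
  have hov : ∀ p : Fin (K + 1), p ≠ 0 → (i p, j p) ∈ overArcs r (y 0) (newArcs O x y t) := by
    intro p hp
    exact ⟨hmem p, hr p, by rw [← h0]; exact hj (Fin.pos_iff_ne_zero.2 hp)⟩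
  have hlab : ∀ p : Fin (K + 1), lab (i p, j p) = p := by
    intro p
    refine lab_eq_of_strictMono (fun p => lab (i p, j p)) ?_ 0 (fun _ => Nat.zero_le _) ?_ p
    · intro p q hpq
      have hq : q ≠ 0 := (hpq.trans_le' (Fin.zero_le _)).ne'
      by_cases hp : p = 0
      · subst hp
        simp only
        rw [hzero, hl.lab_new 0 (Nat.zero_le _)]
        exact (hl.new_range _ (hov q hq)).1
      · exact hl.new_lt _ (hov p hp) _ (hov q hq) ⟨hi hpq, hj hpq⟩
    · intro p
      by_cases hp : p = 0
      · subst hp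
        rw [hzero, hl.lab_new 0 (Nat.zero_le _)]
        omega
      · have := (hl.new_range _ (hov p hp)).2
        omega
  -- Both inequalities are needed for the induction. A fixed arc starting beyond `x q` and ending
  -- beyond `y (q + 1)` would follow the old arc `(x q, y (q + 1))` with the same label; once its
  -- right end is bounded, starting before `x (q + 1)` would make it precede the new arc with that
  -- label.
  have key : ∀ q : ℕ, ∀ hq : q < K + 1, q ≤ t → x q ≤ i ⟨q, hq⟩ ∧ j ⟨q, hq⟩ ≤ y q := by
    intro q
    induction q with
    | zero =>
      intro hq _
      exact ⟨(congrArg Prod.fst hzero).ge, (congrArg Prod.snd hzero).le⟩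
    | succ q ih =>
      intro hq hqt
      have hlt : x q < i ⟨q + 1, hq⟩ := (ih (by omega) (by omega)).1.trans_lt (hi (by simp))
      have hlq := hlab ⟨q + 1, hq⟩
      simp only at hlq
      have hovq := hov ⟨q + 1, hq⟩ (by simp [Fin.ext_iff])
      rcases hmem ⟨q + 1, hq⟩ with hO | ⟨s, hs, he⟩
      · have hy : j ⟨q + 1, hq⟩ < y (q + 1) := by
          refine lt_of_le_of_ne (not_lt.1 fun hgt => ?_) (h.ne_y _ hO (q + 1) hqt)
          have := hl.old_lt _ (h.old_over (s := q + 1) (by omega) (by omega)) _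
            ⟨Or.inl hO, hovq.2⟩ ⟨by rw [leftEnd, if_pos hqt]; exact hlt, hgt⟩
          rw [hl.lab_old _ (by omega) (by omega)] at this
          omega
        refine ⟨not_lt.1 fun hgt => ?_, hy.le⟩
        have := hl.new_lt _ hovq _ (h.new_over (s := q + 1) (by omega) (by omega)) ⟨hgt, hy⟩
        rw [hl.lab_new _ (by omega)] at this
        omega
      · rw [he, hl.lab_new s (by omega)] at hlq
        subst hlq
        exact ⟨(congrArg Prod.fst he).ge, (congrArg Prod.snd he).le⟩
  exact (key p p.2 hp).2

/-- A lexicographically minimal chain of old arcs agrees with the chain of the exchange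
up to `t`. -/
theorem eq_of_old_of_lex_le (h : IsExchange r O x y t K) {lab : N × N → ℕ}
    (hl : IsLabelling r O x y t K lab)
    (hno : ∀ F : Finset (N × N), (F : Set (N × N)) ⊆ newArcs O x y t → ArcChain F →
      F.card = K + 1 → (x t, y t) ∉ F → ¬ ∀ e ∈ F, y 0 ≤ e.2 ∧ r e.1 (y 0))
    {i j : Fin K → N} (hi : StrictMono i) (hj : StrictMono j)
    (hmem : ∀ p, (i p, j p) ∈ overArcs r (y 0) (oldArcs O x y t))
    (hlex : ∀ p : Fin K, (∀ q < p, j q = y (q + 1)) → j p ≤ y (p + 1))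
    (p : Fin K) (hp : (p : ℕ) < t) : j p = y (p + 1) := by
  classical
  have hle := h.le
  have hlab : ∀ p : Fin K, lab (i p, j p) = p + 1 :=
    lab_eq_of_strictMono (fun p => lab (i p, j p))
      (fun p q hpq => hl.old_lt _ (hmem p) _ (hmem q) ⟨hi hpq, hj hpq⟩) 1
      (fun p => (hl.old_range _ (hmem p)).1)
      (fun p => by have := (hl.old_range _ (hmem p)).2; omega)
  by_contra hne
  -- The first disagreement `p` is examined; by lexicographic minimality the competitor is smaller
  -- there.
  obtain ⟨p, ⟨hp, hne⟩, hpmin⟩ : ∃ p : Fin K, ((p : ℕ) < t ∧ j p ≠ y (p + 1)) ∧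
      ∀ q < p, j q = y (q + 1) := by
    have hex : ∃ p : Fin K, (p : ℕ) < t ∧ j p ≠ y (p + 1) := ⟨p, hp, hne⟩
    obtain ⟨m, hm, hmin⟩ := WellFounded.has_min (wellFounded_lt (α := Fin K))
      {p : Fin K | (p : ℕ) < t ∧ j p ≠ y (p + 1)} hex
    refine ⟨m, hm, fun q hq => ?_⟩
    by_contra hq'
    exact hmin q ⟨(Fin.lt_def.1 hq).trans hm.1, hq'⟩ hq
  have hlt : j p < y (p + 1) := lt_of_le_of_ne (hlex p hpmin) hne
  -- from `p` to `t` the arcs stay to the right of the chain of the exchange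
  have hstep : ∀ q : Fin K, (q : ℕ) < t → j q < y (q + 1) →
      (i q, j q) ∈ O ∧ x (q + 1) < i q := by
    intro q hq hjq
    have hO : (i q, j q) ∈ O := by
      rcases (hmem q).1 with hO | ⟨s, h1, hs, he⟩
      · exact hO
      · have h2 := hlab q
        have h3 := hl.lab_old s h1 (by omega)
        rw [leftEnd, if_pos hs] at h3
        rw [he, h3] at h2
        rw [h2] at he
        exact absurd (congrArg Prod.snd he) hjq.ne
    refine ⟨hO, lt_of_le_of_ne (not_lt.1 fun hgt => ?_)
      (h.ne_x _ hO ((q : ℕ) + 1) (by omega)).symm⟩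
    have := hl.new_lt _ ⟨Or.inl hO, (hmem q).2⟩ _
      (h.new_over (s := (q : ℕ) + 1) (by omega) (by omega)) ⟨hgt, hjq⟩
    rw [hl.lab_new _ (by omega), hlab q] at this
    omega
  have hright : ∀ d : ℕ, ∀ hd : (p : ℕ) + d < K, (p : ℕ) + d < t →
      j ⟨p + d, hd⟩ < y (p + d + 1) := by
    intro d
    induction d with
    | zero => intro _ _; exact hlt
    | succ d ih =>
      intro hd hdt
      have h1 := hstep ⟨p + d, by omega⟩ (by simp only; omega) (ih (by omega) (by omega))
      have h2 : x (p + d + 1) < i ⟨p + (d + 1), hd⟩ :=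
        h1.2.trans (hi (Fin.lt_def.2 (by simp only; omega)))
      have h3 := hlab ⟨p + (d + 1), hd⟩
      refine lt_of_le_of_ne (not_lt.1 fun hgt => ?_) fun heq => ?_
      · have := hl.old_lt _ (h.old_over (s := p + (d + 1) + 1) (by omega) (by omega)) _
          (hmem ⟨p + (d + 1), hd⟩) ⟨by rw [leftEnd, if_pos (by omega)]; exact h2, hgt⟩
        rw [hl.lab_old _ (by omega) (by omega)] at this
        simp only at h3
        omega
      · have := h.eq_of_old (hmem ⟨p + (d + 1), hd⟩).1 (s := p + (d + 1) + 1) (by omega)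
          (by omega) heq
        rw [leftEnd, if_pos (by omega)] at this
        exact absurd (congrArg Prod.fst this) h2.ne'
  -- From `p` on the competitor consists of fixed arcs, so this part of it is also a chain of new
  -- arcs.
  have hO : ∀ q : Fin K, p ≤ q → (i q, j q) ∈ O := by
    intro q hpq
    have hpq' := Fin.le_def.1 hpq
    by_cases hqt : (q : ℕ) < t
    · have h1 := hright (q - p) (by omega) (by omega)
      have h2 : (⟨(p : ℕ) + ((q : ℕ) - p), by omega⟩ : Fin K) = q := by
        ext; simp only; omega
      rw [h2] at h1
      refine (hstep q hqt ?_).1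
      convert h1 using 2
      omega
    · have h1 := hright (t - 1 - p) (by omega) (by omega)
      have h2 := (hstep _ (by simp only; omega) h1).2
      have h3 : x t < i q := by
        refine lt_of_le_of_lt (h.x_le ?_ ?_) (h2.trans (hi (Fin.lt_def.2 ?_)))
        all_goals simp only; omega
      rcases (hmem q).1 with hO | ⟨s, h1, hs, he⟩
      · exact hO
      · have h4 := congrArg Prod.fst he
        simp only at h4
        rw [h4] at h3
        exact absurd h3 (h.x_le (by omega) hle).not_gt
  -- Splicing the new chain arcs with indices `0, ..., p` with the competitor from position `p` on
  -- gives `(p + 1) + (K - p) = K + 1` new arcs. Since `p < t`, the arc `(x t, y t)` is not among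
  -- them, against `hno`.
  have hch1 := ArcChain.of_indexed (Finset.range ((p : ℕ) + 1)) (fun s => (x s, y s)) (by
    intro a ha b hb hab
    simp only [Finset.mem_range] at ha hb
    exact h.new_prec hab (by omega))
  have hch2 := ArcChain.of_indexed (Finset.Ici p) (fun q => (i q, j q))
    (fun a _ b _ hab => ⟨hi hab, hj hab⟩)
  have hlast : Prec (x p, y p) (i p, j p) := by
    refine ⟨(h.x_lt _ _ (Nat.lt_succ_self _) (by omega)).trans (hstep p hp hlt).2, ?_⟩
    rcases Nat.eq_zero_or_pos (p : ℕ) with h0 | hpos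
    · rw [h0]; exact (hmem p).2.2
    · have h1 := hpmin ⟨p - 1, by omega⟩ (Fin.lt_def.2 (by simp only; omega))
      have h2 : j ⟨p - 1, by omega⟩ < j p := hj (Fin.lt_def.2 (by simp only; omega))
      rw [h1] at h2
      convert h2 using 2
      simp only; omega
  have hch := ArcChain.union hch1.1 hch2.1 (by
    intro d hd e he
    simp only [Finset.mem_image, Finset.mem_range, Finset.mem_Ici] at hd he
    obtain ⟨a, ha, rfl⟩ := hd
    obtain ⟨b, hb, rfl⟩ := he
    have h1 : Prec (x a, y a) (i p, j p) :=
      ⟨(h.x_le (by omega) (by omega)).trans_lt hlast.1,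
        (h.y_le (by omega) (by omega)).trans_lt hlast.2⟩
    exact ⟨h1.1.trans_le (hi.monotone hb), h1.2.trans_le (hj.monotone hb)⟩)
  refine hno _ ?_ hch.1 ?_ ?_ ?_
  · intro e he
    simp only [Finset.coe_union, Finset.coe_image, Set.mem_union, Set.mem_image, Finset.mem_coe,
      Finset.mem_range, Finset.mem_Ici] at he
    rcases he with ⟨a, ha, rfl⟩ | ⟨b, hb, rfl⟩
    · exact h.new_mem (by omega)
    · exact Or.inl (hO b hb)
  · rw [hch.2, hch1.2, hch2.2, Finset.card_range, Fin.card_Ici]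
    omega
  · intro hmem'
    simp only [Finset.mem_union, Finset.mem_image, Finset.mem_range, Finset.mem_Ici] at hmem'
    rcases hmem' with ⟨a, ha, he⟩ | ⟨b, hb, he⟩
    · have := h.y_inj (by omega) hle (congrArg Prod.snd he)
      omega
    · exact h.ne_x _ (hO b hb) t le_rfl (congrArg Prod.fst he)
  · intro e he
    simp only [Finset.mem_union, Finset.mem_image, Finset.mem_range, Finset.mem_Ici] at he
    rcases he with ⟨a, ha, rfl⟩ | ⟨b, hb, rfl⟩
    · exact ⟨h.y_le (Nat.zero_le _) (by omega), h.r_x a (by omega)⟩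
    · exact ⟨(hmem b).2.2.le, (hmem b).2.1⟩

end IsExchange
end Exchange

/-! ### Set partitions as sets of strict arcs. -/

section Partition

variable {n : ℕ}

theorem mem_part_comm (P : SetPartition n) (i j : Fin n) : j ∈ P.part i ↔ i ∈ P.part j := by
  rw [P.mem_part_iff_part_eq_part (Finset.mem_univ _) (Finset.mem_univ _),
    P.mem_part_iff_part_eq_part (Finset.mem_univ _) (Finset.mem_univ _)]
  exact eq_comm

theorem mem_part_iff_eq (P : SetPartition n) (i j : Fin n) :
    j ∈ P.part i ↔ P.part j = P.part i :=
  P.mem_part_iff_part_eq_part (Finset.mem_univ _) (Finset.mem_univ _)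

theorem self_mem_part (P : SetPartition n) (i : Fin n) : i ∈ P.part i :=
  P.mem_part (Finset.mem_univ i)

theorem mem_part_trans (P : SetPartition n) {i j l : Fin n} (h : j ∈ P.part i)
    (h' : l ∈ P.part j) : l ∈ P.part i := by
  rw [mem_part_iff_eq] at *
  exact h'.trans h

theorem parts_eq_image (P : SetPartition n) : P.parts = Finset.univ.image P.part := by
  ext s
  constructor
  · intro hs
    obtain ⟨i, hi⟩ := P.nonempty_of_mem_parts hs
    exact Finset.mem_image.2 ⟨i, Finset.mem_univ _, P.part_eq_of_mem hs hi⟩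
  · intro hs
    obtain ⟨i, _, rfl⟩ := Finset.mem_image.1 hs
    exact P.part_mem.2 (Finset.mem_univ i)

theorem eq_of_part_eq {P Q : SetPartition n} (h : ∀ i, P.part i = Q.part i) : P = Q := by
  apply Finpartition.ext
  rw [parts_eq_image, parts_eq_image]
  exact Finset.image_congr fun i _ => h i

/-- The arcs that are not loops. -/
def strictArcs (P : SetPartition n) : Set (Fin n × Fin n) := {e | e.1 < e.2 ∧ IsArc P e.1 e.2}

theorem mem_strictArcs {P : SetPartition n} {i j : Fin n} :
    (i, j) ∈ strictArcs P ↔ i < j ∧ j ∈ P.part i ∧ ∀ l ∈ P.part i, ¬ (i < l ∧ l < j) := by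
  constructor
  · rintro ⟨hlt, h | h⟩
    · exact h
    · exact absurd h.1 hlt.ne
  · exact fun h => ⟨h.1, Or.inl h⟩

theorem strictArcs_inj_fst (P : SetPartition n) :
    ∀ f ∈ strictArcs P, ∀ g ∈ strictArcs P, f.1 = g.1 → f = g := by
  rintro ⟨i, j⟩ hf ⟨i', j'⟩ hg h
  simp only at h
  subst h
  rw [mem_strictArcs] at hf hg
  rcases lt_trichotomy j j' with h | h | h
  · exact absurd ⟨hf.1, h⟩ (hg.2.2 j hf.2.1)
  · rw [h]
  · exact absurd ⟨hg.1, h⟩ (hf.2.2 j' hg.2.1)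

theorem strictArcs_inj_snd (P : SetPartition n) :
    ∀ f ∈ strictArcs P, ∀ g ∈ strictArcs P, f.2 = g.2 → f = g := by
  rintro ⟨i, j⟩ hf ⟨i', j'⟩ hg h
  simp only at h
  subst h
  rw [mem_strictArcs] at hf hg
  have h1 : i' ∈ P.part i := mem_part_trans P hf.2.1 ((mem_part_comm P _ _).1 hg.2.1)
  rcases lt_trichotomy i i' with h | h | h
  · exact absurd ⟨h, hg.1⟩ (hf.2.2 i' h1)
  · rw [h]
  · exact absurd ⟨h, hf.1⟩ (hg.2.2 i ((mem_part_comm P _ _).1 h1))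

theorem exists_succ (P : SetPartition n) {i j : Fin n} (hij : i < j) (h : j ∈ P.part i) :
    ∃ l, (i, l) ∈ strictArcs P ∧ l ≤ j := by
  obtain ⟨l, ⟨hl1, hl2⟩, hmin⟩ := WellFounded.has_min (wellFounded_lt (α := Fin n))
    {l | i < l ∧ l ∈ P.part i} ⟨j, hij, h⟩
  refine ⟨l, mem_strictArcs.2 ⟨hl1, hl2, fun m hm hlt => hmin m ⟨hlt.1, hm⟩ hlt.2⟩, ?_⟩
  exact not_lt.1 fun hlt => hmin j ⟨hij, h⟩ hlt

theorem exists_pred (P : SetPartition n) {i j : Fin n} (hij : i < j) (h : j ∈ P.part i) :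
    ∃ l, (l, j) ∈ strictArcs P ∧ i ≤ l := by
  obtain ⟨l, ⟨hl1, hl2⟩, hmin⟩ := WellFounded.has_min (wellFounded_gt (α := Fin n))
    {l | l < j ∧ l ∈ P.part j} ⟨i, hij, (mem_part_comm P _ _).1 h⟩
  have hlj := (mem_part_comm P _ _).1 hl2
  refine ⟨l, mem_strictArcs.2 ⟨hl1, hlj, fun m hm hlt => ?_⟩, ?_⟩
  · exact hmin m ⟨hlt.2, mem_part_trans P hl2 hm⟩ hlt.1
  · exact not_lt.1 fun hlt => hmin i ⟨hij, (mem_part_comm P _ _).1 h⟩ hlt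

/-- Descending from an element to its predecessor in the block connects the whole block by strict
arcs. Consequently the strict arcs determine the partition. -/
theorem part_subset_of_strictArcs_subset {P Q : SetPartition n}
    (h : strictArcs P ⊆ strictArcs Q) {i j : Fin n} (hij : j ∈ P.part i) : j ∈ Q.part i := by
  have key : ∀ j i : Fin n, i ≤ j → j ∈ P.part i → j ∈ Q.part i := by
    intro j
    induction j using WellFoundedLT.induction with
    | _ j ih =>
      intro i hle hj
      rcases hle.eq_or_lt with rfl | hlt
      · exact self_mem_part Q i
      · obtain ⟨l, hl, hil⟩ := exists_pred P hlt hj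
        have h1 := mem_strictArcs.1 hl
        have h2 := mem_strictArcs.1 (h hl)
        have h3 : l ∈ P.part i := mem_part_trans P hj ((mem_part_comm P _ _).1 h1.2.1)
        exact mem_part_trans Q (ih l h1.1 i hil h3) h2.2.1
  rcases le_total i j with hle | hle
  · exact key j i hle hij
  · exact (mem_part_comm Q _ _).1 (key i j hle ((mem_part_comm P _ _).1 hij))

theorem eq_of_strictArcs_eq {P Q : SetPartition n} (h : strictArcs P = strictArcs Q) : P = Q :=
  eq_of_part_eq fun i => by
    ext j
    exact ⟨part_subset_of_strictArcs_subset h.subset,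
      part_subset_of_strictArcs_subset h.symm.subset⟩

/-- The ends of the arcs in a set. -/
def ends (A : Set (Fin n × Fin n)) : Set (Fin n) := {i | ∃ e ∈ A, e.1 = i ∨ e.2 = i}

/-- Loops carry no information of their own: they sit at the nodes untouched by strict arcs. All
constructions can therefore work with strict arcs, and loops are restored at the end. -/
theorem isArc_self_iff (P : SetPartition n) (i : Fin n) :
    IsArc P i i ↔ i ∉ ends (strictArcs P) := by
  constructor
  · rintro (h | ⟨-, h⟩)
    · exact absurd h.1 (lt_irrefl _)
    · rintro ⟨⟨u, v⟩, he, rfl | rfl⟩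
      · have h1 := mem_strictArcs.1 he
        have h2 := h1.2.1
        simp only [h, Finset.mem_singleton] at h2
        exact h1.1.ne' h2
      · have h1 := mem_strictArcs.1 he
        have h2 := (mem_part_comm P _ _).1 h1.2.1
        simp only [h, Finset.mem_singleton] at h2
        exact h1.1.ne h2
  · intro h
    refine Or.inr ⟨rfl, ?_⟩
    ext j
    rw [Finset.mem_singleton]
    constructor
    · intro hj
      rcases lt_trichotomy i j with hlt | heq | hlt
      · obtain ⟨l, hl, -⟩ := exists_succ P hlt hj
        exact absurd ⟨_, hl, Or.inl rfl⟩ h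
      · exact heq.symm
      · obtain ⟨l, hl, -⟩ := exists_pred P hlt ((mem_part_comm P _ _).1 hj)
        exact absurd ⟨_, hl, Or.inr rfl⟩ h
    · rintro rfl
      exact self_mem_part P _

theorem isArc_le {P : SetPartition n} {i j : Fin n} (h : IsArc P i j) : i ≤ j := by
  rcases h with h | h
  · exact h.1.le
  · exact h.1.le

theorem isArc_iff (P : SetPartition n) (e : Fin n × Fin n) :
    IsArc P e.1 e.2 ↔ e ∈ strictArcs P ∨ e.1 = e.2 ∧ e.1 ∉ ends (strictArcs P) := by
  obtain ⟨i, j⟩ := e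
  constructor
  · intro h
    rcases (isArc_le h).eq_or_lt with heq | hlt
    · simp only at heq h
      subst heq
      exact Or.inr ⟨rfl, (isArc_self_iff P i).1 h⟩
    · exact Or.inl ⟨hlt, h⟩
  · rintro (h | ⟨heq, h⟩)
    · exact h.2
    · simp only at heq h ⊢
      subst heq
      exact (isArc_self_iff P i).2 h

/-- Each block is counted by its minimum, its only element without an incoming strict arc. -/
theorem numBlocks_eq_card (P : SetPartition n) [DecidablePred fun i => ∀ u, (u, i) ∉ strictArcs P] :
    numBlocks P = (Finset.univ.filter fun i => ∀ u, (u, i) ∉ strictArcs P).card := by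
  symm
  refine Finset.card_bij (fun i _ => P.part i) (fun i _ => P.part_mem.2 (Finset.mem_univ i)) ?_ ?_
  · intro i hi j hj hij
    simp only [Finset.mem_filter, Finset.mem_univ, true_and] at hi hj
    rcases lt_trichotomy i j with h | h | h
    · obtain ⟨l, hl, -⟩ := exists_pred P h ((mem_part_iff_eq P _ _).2 hij.symm)
      exact absurd hl (hj l)
    · exact h
    · obtain ⟨l, hl, -⟩ := exists_pred P h ((mem_part_iff_eq P _ _).2 hij)
      exact absurd hl (hi l)
  · intro s hs
    have hne := P.nonempty_of_mem_parts hs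
    refine ⟨s.min' hne, ?_, P.part_eq_of_mem hs (s.min'_mem hne)⟩
    simp only [Finset.mem_filter, Finset.mem_univ, true_and]
    intro u hu
    have h1 := mem_strictArcs.1 hu
    have h2 := (mem_part_comm P _ _).1 h1.2.1
    rw [P.part_eq_of_mem hs (s.min'_mem hne)] at h2
    exact absurd (s.min'_le u h2) h1.1.not_ge

theorem numBlocks_congr {P Q : SetPartition n}
    (h : ∀ i, (∃ u, (u, i) ∈ strictArcs P) ↔ ∃ u, (u, i) ∈ strictArcs Q) :
    numBlocks P = numBlocks Q := by
  classical
  rw [numBlocks_eq_card, numBlocks_eq_card]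
  congr 1
  ext i
  have := h i
  simp only [Finset.mem_filter, Finset.mem_univ, true_and]
  rw [← not_exists, ← not_exists, this]

/-- A partition with a prescribed block and prescribed arcs outside this block. -/
theorem exists_partition (S : Finset (Fin n)) (B : Set (Fin n × Fin n))
    (hlt : ∀ e ∈ B, e.1 < e.2) (h1 : ∀ f ∈ B, ∀ g ∈ B, f.1 = g.1 → f = g)
    (h2 : ∀ f ∈ B, ∀ g ∈ B, f.2 = g.2 → f = g) (hS : ∀ e ∈ B, e.1 ∉ S ∧ e.2 ∉ S) :
    ∃ Q : SetPartition n, (∀ i ∈ S, Q.part i = S) ∧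
      ∀ e : Fin n × Fin n, e.1 ∉ S → (e ∈ strictArcs Q ↔ e ∈ B) := by
  classical
  -- Steps along `B` are unique in both directions and increase, so `B` splits into disjoint
  -- increasing paths avoiding `S`. The blocks are `S` and these paths, trivial ones included.
  let st : Fin n → Fin n → Prop := fun i j => (i, j) ∈ B
  let path : Fin n → Fin n → Prop := Relation.ReflTransGen st
  have hR : Relator.RightUnique st := fun a b c hb hc =>
    congrArg Prod.snd (h1 _ hb _ hc rfl)
  have hL : Relator.RightUnique (Function.swap st) := fun a b c hb hc =>
    congrArg Prod.fst (h2 _ hb _ hc rfl)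
  have htotR : ∀ a b c, path a b → path a c → path b c ∨ path c b := fun a b c hb hc =>
    Relation.ReflTransGen.total_of_right_unique hR hb hc
  have htotL : ∀ a b c, path b a → path c a → path b c ∨ path c b := fun a b c hb hc => by
    rcases Relation.ReflTransGen.total_of_right_unique hL (Relation.reflTransGen_swap.2 hb)
      (Relation.reflTransGen_swap.2 hc) with h | h
    · exact Or.inr (Relation.reflTransGen_swap.1 h)
    · exact Or.inl (Relation.reflTransGen_swap.1 h)
  have hle : ∀ a b, path a b → a ≤ b := by
    intro a b h
    induction h with
    | refl => exact le_rfl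
    | tail _ hs ih => exact ih.trans (hlt _ hs).le
  have hSl : ∀ a b, path a b → a ∈ S → a = b := by
    intro a b h ha
    rcases Relation.ReflTransGen.cases_head h with rfl | ⟨c, hc, -⟩
    · rfl
    · exact absurd ha (hS _ hc).1
  have hSr : ∀ a b, path a b → b ∈ S → a = b := by
    intro a b h hb
    rcases Relation.ReflTransGen.cases_tail h with rfl | ⟨c, -, hc⟩
    · rfl
    · exact absurd hb (hS _ hc).2
  let rel : Fin n → Fin n → Prop := fun i j => (i ∈ S ∧ j ∈ S) ∨ path i j ∨ path j i
  have hsymm : ∀ i j, rel i j → rel j i := by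
    rintro i j (h | h | h)
    · exact Or.inl h.symm
    · exact Or.inr (Or.inr h)
    · exact Or.inr (Or.inl h)
  have htrans : ∀ i j l, rel i j → rel j l → rel i l := by
    rintro i j l (h | h | h) (h' | h' | h')
    · exact Or.inl ⟨h.1, h'.2⟩
    · rw [← hSl _ _ h' h.2]; exact Or.inl h
    · rw [hSr _ _ h' h.2]; exact Or.inl h
    · rw [hSr _ _ h h'.1]; exact Or.inl h'
    · exact Or.inr (Or.inl (h.trans h'))
    · exact Or.inr (htotL _ _ _ h h')
    · rw [← hSl _ _ h h'.1]; exact Or.inl h'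
    · exact Or.inr (htotR _ _ _ h h')
    · exact Or.inr (Or.inr (h'.trans h))
  let sd : Setoid (Fin n) :=
    ⟨rel, ⟨fun i => Or.inr (Or.inl Relation.ReflTransGen.refl), hsymm _ _, htrans _ _ _⟩⟩
  have hmem : ∀ i j, j ∈ (Finpartition.ofSetoid sd).part i ↔ rel i j := fun i j =>
    Finpartition.mem_part_ofSetoid_iff_rel
  refine ⟨Finpartition.ofSetoid sd, ?_, ?_⟩
  · intro i hi
    ext j
    rw [hmem]
    constructor
    · rintro (h | h | h)
      · exact h.2
      · exact hSl _ _ h hi ▸ hi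
      · exact (hSr _ _ h hi).symm ▸ hi
    · exact fun hj => Or.inl ⟨hi, hj⟩
  · rintro ⟨i, j⟩ hi
    simp only at hi
    have hpath : ∀ l, i < l → l ∈ (Finpartition.ofSetoid sd).part i →
        ∃ c, (i, c) ∈ B ∧ path c l := by
      intro l hil hl
      rw [hmem] at hl
      rcases hl with h | h | h
      · exact absurd h.1 hi
      · rcases Relation.ReflTransGen.cases_head h with heq | h
        · exact absurd heq hil.ne
        · exact h
      · exact absurd (hle _ _ h) hil.not_ge
    rw [mem_strictArcs]
    constructor
    · rintro ⟨hij, hj, hno⟩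
      obtain ⟨c, hc, hcj⟩ := hpath j hij hj
      have hci : c ∈ (Finpartition.ofSetoid sd).part i :=
        (hmem _ _).2 (Or.inr (Or.inl (Relation.ReflTransGen.single hc)))
      rcases (hle _ _ hcj).eq_or_lt with heq | hlt'
      · rw [← heq]; exact hc
      · exact absurd ⟨hlt _ hc, hlt'⟩ (hno c hci)
    · intro h
      refine ⟨hlt _ h, (hmem _ _).2 (Or.inr (Or.inl (Relation.ReflTransGen.single h))), ?_⟩
      rintro l hl ⟨hil, hlj⟩
      obtain ⟨c, hc, hcl⟩ := hpath l hil hl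
      have := congrArg Prod.snd (h1 _ hc _ h rfl)
      simp only at this
      subst this
      exact absurd (hle _ _ hcl) hlj.not_ge

end Partition

/-! ### The red block and the black arcs. -/

section Red

variable {n : ℕ}

/-- The black arcs that are not loops. -/
def blackStrict (P : SetPartition (n + 1)) : Set (Fin (n + 1) × Fin (n + 1)) :=
  {e | e ∈ strictArcs P ∧ e.1 ∉ red P}

theorem zero_mem_red (P : SetPartition (n + 1)) : 0 ∈ red P := self_mem_part P 0

theorem mem_red_iff_of_mem_part {P : SetPartition (n + 1)} {i j : Fin (n + 1)}
    (h : j ∈ P.part i) : i ∈ red P ↔ j ∈ red P :=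
  ⟨fun hi => mem_part_trans P hi h, fun hj => mem_part_trans P hj ((mem_part_comm P _ _).1 h)⟩

theorem mem_red_iff_of_arc {P : SetPartition (n + 1)} {e : Fin (n + 1) × Fin (n + 1)}
    (h : e ∈ strictArcs P) : e.1 ∈ red P ↔ e.2 ∈ red P :=
  mem_red_iff_of_mem_part (mem_strictArcs.1 h).2.1

theorem part_eq_red {P : SetPartition (n + 1)} {i : Fin (n + 1)} (h : i ∈ red P) :
    P.part i = red P := (mem_part_iff_eq P 0 i).1 h

theorem mem_part_of_mem_red {P : SetPartition (n + 1)} {i j : Fin (n + 1)} (hi : i ∈ red P)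
    (hj : j ∈ red P) : j ∈ P.part i := by rwa [part_eq_red hi]

theorem blackStrict_snd_notMem_red {P : SetPartition (n + 1)} {e : Fin (n + 1) × Fin (n + 1)}
    (h : e ∈ blackStrict P) : e.2 ∉ red P := fun h' => h.2 ((mem_red_iff_of_arc h.1).2 h')

/-- Red arcs do not contain red nodes in their interior. -/
theorem le_or_le_of_red_arc {P : SetPartition (n + 1)} {u v c : Fin (n + 1)}
    (h : (u, v) ∈ strictArcs P) (hu : u ∈ red P) (hc : c ∈ red P) : c ≤ u ∨ v ≤ c := by
  by_contra hn
  push Not at hn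
  exact (mem_strictArcs.1 h).2.2 c (mem_part_of_mem_red hu hc) hn

/-- A strict arc with a black end is black altogether, so black strict arcs alone decide whether a
black node carries a loop. -/
theorem blackArcs_eq_iff_blackStrict (P : SetPartition (n + 1)) (e : Fin (n + 1) × Fin (n + 1)) :
    e ∈ blackArcs P ↔
      e ∈ blackStrict P ∨ e.1 = e.2 ∧ e.1 ∉ red P ∧ e.1 ∉ ends (blackStrict P) := by
  have h1 := isArc_iff P e
  have hends : ∀ i ∉ red P, (i ∈ ends (strictArcs P) ↔ i ∈ ends (blackStrict P)) := by
    intro i hi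
    constructor
    · rintro ⟨e, he, rfl | rfl⟩
      · exact ⟨e, ⟨he, hi⟩, Or.inl rfl⟩
      · exact ⟨e, ⟨he, fun h => hi ((mem_red_iff_of_arc he).1 h)⟩, Or.inr rfl⟩
    · rintro ⟨e, he, h⟩
      exact ⟨e, he.1, h⟩
  simp only [blackArcs, blackStrict, Set.mem_ofPred_eq] at *
  rw [h1]
  constructor
  · rintro ⟨h | h, hr⟩
    · exact Or.inl ⟨h, hr⟩
    · exact Or.inr ⟨h.1, hr, fun h' => h.2 ((hends _ hr).2 h')⟩
  · rintro (h | h)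
    · exact ⟨Or.inl h.1, h.2⟩
    · exact ⟨Or.inr ⟨h.1, fun h' => h.2.2 ((hends _ h.2.1).1 h')⟩, h.2.1⟩

/-- If the red arcs of `P` up to a red node `b` are arcs of `Q`, then `P` and `Q` have the same
red nodes up to `b`. -/
theorem mem_red_iff_of_le {P Q : SetPartition (n + 1)} {b : Fin (n + 1)} (hb : b ∈ red P)
    (h : ∀ e ∈ strictArcs P, e.1 ∈ red P → e.2 ≤ b → e ∈ strictArcs Q) (c : Fin (n + 1))
    (hc : c ≤ b) : c ∈ red P ↔ c ∈ red Q := by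
  induction c using WellFoundedLT.induction with
  | _ c ih =>
    rcases eq_or_ne c 0 with rfl | h0
    · exact iff_of_true (zero_mem_red P) (zero_mem_red Q)
    have hpos : 0 < c := Fin.pos_iff_ne_zero.2 h0
    constructor
    · intro hcP
      obtain ⟨l, hl, -⟩ := exists_pred P hpos hcP
      have hlc : l < c := hl.1
      have hlP : l ∈ red P := (mem_red_iff_of_arc hl).2 hcP
      have hlQ := (ih l hlc (hlc.le.trans hc)).1 hlP
      exact (mem_red_iff_of_arc (h _ hl hlP hc)).1 hlQ
    · intro hcQ
      obtain ⟨l, hl, -⟩ := exists_pred Q hpos hcQ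
      have hlc : l < c := hl.1
      have hlQ : l ∈ red Q := (mem_red_iff_of_arc hl).2 hcQ
      have hlP := (ih l hlc (hlc.le.trans hc)).2 hlQ
      -- The arc of `P` leaving the red node `l` ends by `b`, hence it is also an arc of `Q` and
      -- must be the one leading to `c`.
      obtain ⟨m, hm, hmb⟩ := exists_succ P (hlc.trans_le hc) (mem_part_of_mem_red hlP hb)
      have := strictArcs_inj_fst Q _ hl _ (h _ hm hlP hmb) rfl
      rw [Prod.mk.injEq] at this
      exact this.2 ▸ (mem_red_iff_of_arc hm).1 hlP

end Red

/-! ### Crossings as finite chains of arcs. -/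

section Crossings

variable {N : Type*} [LinearOrder N]

/-- A finite set of `m` arcs of `A` that is a crossing with respect to the relation `r` between
left and right ends. -/
def IsXing (r : N → N → Prop) (A : Set (N × N)) (m : ℕ) (D : Finset (N × N)) : Prop :=
  ArcChain D ∧ D.card = m ∧ (D : Set (N × N)) ⊆ A ∧ ∀ e ∈ D, ∀ f ∈ D, r e.1 f.2

theorem isXing_of_fun {r : N → N → Prop} {A : Set (N × N)} {m : ℕ} {i j : Fin m → N}
    (hi : StrictMono i) (hj : StrictMono j) (hA : ∀ s, (i s, j s) ∈ A)
    (hr : ∀ s t, r (i s) (j t)) [DecidableEq N] :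
    IsXing r A m (Finset.univ.image fun s => (i s, j s)) := by
  have h := ArcChain.of_indexed Finset.univ (fun s => (i s, j s))
    (fun a _ b _ hab => ⟨hi hab, hj hab⟩)
  refine ⟨?_, ?_, ?_, ?_⟩
  · convert h.1
  · rw [Finset.card_univ, Fintype.card_fin] at h
    convert h.2
  · intro e he
    simp only [Finset.coe_image, Set.mem_image, Finset.mem_coe] at he
    obtain ⟨s, -, rfl⟩ := he
    exact hA s
  · intro e he f hf
    obtain ⟨s, -, rfl⟩ := Finset.mem_image.1 he
    obtain ⟨s', -, rfl⟩ := Finset.mem_image.1 hf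
    exact hr s s'

theorem IsXing.exists_fun {r : N → N → Prop} {A : Set (N × N)} {m : ℕ} {D : Finset (N × N)}
    (h : IsXing r A m D) : ∃ i j : Fin m → N, StrictMono i ∧ StrictMono j ∧
      (∀ s, (i s, j s) ∈ D) ∧ (∀ e ∈ D, ∃ s, e = (i s, j s)) ∧ (∀ s, (i s, j s) ∈ A) ∧
      ∀ s t, r (i s) (j t) := by
  obtain ⟨i, j, hi, hj, hm, hs⟩ := h.1.exists_fun h.2.1
  exact ⟨i, j, hi, hj, hm, hs, fun s => h.2.2.1 (hm s), fun s t => h.2.2.2 _ (hm s) _ (hm t)⟩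

variable {n : ℕ}

theorem isCrossing_iff {k : ℕ} {P : SetPartition n} {i j : Fin k → Fin n} :
    IsCrossing P i j ↔ StrictMono i ∧ StrictMono j ∧ (∀ s, (i s, j s) ∈ strictArcs P) ∧
      ∀ s t, i s < j t :=
  ⟨fun h => ⟨h.2.1, h.2.2.1, fun s => ⟨h.2.2.2 s s, h.1 s⟩, h.2.2.2⟩,
    fun h => ⟨fun s => (h.2.2.1 s).2, h.1, h.2.1, h.2.2.2⟩⟩

theorem isBlackCrossing_iff {k : ℕ} {P : SetPartition (n + 1)} {i j : Fin k → Fin (n + 1)} :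
    IsBlackCrossing P i j ↔ StrictMono i ∧ StrictMono j ∧ (∀ s, (i s, j s) ∈ blackStrict P) ∧
      ∀ s t, i s < j t := by
  rw [IsBlackCrossing, isCrossing_iff]
  exact ⟨fun h => ⟨h.1.1, h.1.2.1, fun s => ⟨h.1.2.2.1 s, h.2 s⟩, h.1.2.2.2⟩,
    fun h => ⟨⟨h.1, h.2.1, fun s => (h.2.2.1 s).1, h.2.2.2⟩, fun s => (h.2.2.1 s).2⟩⟩

/-- A single loop is a weak 1-crossing; with at least two arcs the centre separates left from right
ends, so all arcs are strict. This is where `1 ≤ K` matters. -/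
theorem isWeakCrossing_iff {K : ℕ} (hK : 1 ≤ K) {P : SetPartition n} {i j : Fin (K + 1) → Fin n} :
    IsWeakCrossing P i j ↔ StrictMono i ∧ StrictMono j ∧ (∀ s, (i s, j s) ∈ strictArcs P) ∧
      i (Fin.last K) = j 0 := by
  have h0 : (0 : Fin (K + 1)) < Fin.last K :=
    Fin.lt_def.2 (by simp only [Fin.val_zero, Fin.val_last]; omega)
  constructor
  · rintro ⟨ha, hi, hj, he⟩
    have he' : i (Fin.last K) = j 0 := he _ _ (by simp) (by simp)
    refine ⟨hi, hj, fun s => ⟨?_, ha s⟩, he'⟩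
    rcases (Fin.zero_le s).eq_or_lt with rfl | hs
    · exact (hi h0).trans_eq he'
    · exact ((hi.monotone (Fin.le_last s)).trans_eq he').trans_lt (hj hs)
  · rintro ⟨hi, hj, ha, he⟩
    refine ⟨fun s => (ha s).2, hi, hj, fun s t hs ht => ?_⟩
    have h1 : s = Fin.last K := Fin.ext (by simp only [Fin.val_last]; omega)
    have h2 : t = 0 := Fin.ext (by simpa using ht)
    rw [h1, h2, he]

theorem isBlackWeakCrossing_iff {K : ℕ} (hK : 1 ≤ K) {P : SetPartition (n + 1)}
    {i j : Fin (K + 1) → Fin (n + 1)} :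
    IsBlackWeakCrossing P i j ↔ StrictMono i ∧ StrictMono j ∧ (∀ s, (i s, j s) ∈ blackStrict P) ∧
      i (Fin.last K) = j 0 := by
  rw [IsBlackWeakCrossing, isWeakCrossing_iff hK]
  exact ⟨fun h => ⟨h.1.1, h.1.2.1, fun s => ⟨h.1.2.2.1 s, h.2 s⟩, h.1.2.2.2⟩,
    fun h => ⟨⟨h.1, h.2.1, fun s => (h.2.2.1 s).1, h.2.2.2⟩, fun s => (h.2.2.1 s).2⟩⟩

end Crossings

/-! ### Lexicographic against pointwise minimality. -/

section Lex

variable {N : Type*} [LinearOrder N]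

theorem toLex_lt_of {m : ℕ} {f g : Fin m → N} (p : Fin m) (h : ∀ q < p, f q = g q)
    (hp : f p < g p) : toLex f < toLex g := ⟨p, h, hp⟩

theorem le_of_toLex_le {m : ℕ} {f g : Fin m → N} (hfg : toLex f ≤ toLex g) (p : Fin m)
    (h : ∀ q < p, f q = g q) : f p ≤ g p := by
  by_contra hn
  exact absurd (toLex_lt_of p (fun q hq => (h q hq).symm) (not_le.1 hn)) hfg.not_gt

/-- Among the chains of maximal length, the lexicographically smallest one is pointwise
smallest. -/
theorem le_of_forall_toLex_le {V : Set (N × N)}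
    (h2 : ∀ f ∈ V, ∀ g ∈ V, f.2 = g.2 → f = g) {K : ℕ}
    (hno : ∀ D : Finset (N × N), (D : Set (N × N)) ⊆ V → ArcChain D → D.card ≠ K + 1)
    {i j : Fin K → N} (hi : StrictMono i) (hj : StrictMono j) (hV : ∀ s, (i s, j s) ∈ V)
    (hlex : ∀ i' j' : Fin K → N, StrictMono i' → StrictMono j' → (∀ s, (i' s, j' s) ∈ V) →
      toLex j ≤ toLex j')
    {i' j' : Fin K → N} (hi' : StrictMono i') (hj' : StrictMono j')
    (hV' : ∀ s, (i' s, j' s) ∈ V) (s : Fin K) : j s ≤ j' s := by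
  classical
  -- If the arc in position `s` of one chain preceded the arc in position `s` of another, the first
  -- chain up to `s` and the second from `s` on would make a chain of size `K + 1`.
  have key : ∀ i j i' j' : Fin K → N, StrictMono i → StrictMono j → (∀ s, (i s, j s) ∈ V) →
      StrictMono i' → StrictMono j' → (∀ s, (i' s, j' s) ∈ V) → ∀ s,
      ¬ Prec (i s, j s) (i' s, j' s) := by
    intro i j i' j' hi hj hV hi' hj' hV' s hp
    have c1 := ArcChain.of_indexed (Finset.Iic s) (fun q => (i q, j q))
      (fun a _ b _ hab => ⟨hi hab, hj hab⟩)
    have c2 := ArcChain.of_indexed (Finset.Ici s) (fun q => (i' q, j' q))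
      (fun a _ b _ hab => ⟨hi' hab, hj' hab⟩)
    have c3 := ArcChain.union c1.1 c2.1 (by
      intro d hd e he
      simp only [Finset.mem_image, Finset.mem_Iic, Finset.mem_Ici] at hd he
      obtain ⟨a, ha, rfl⟩ := hd
      obtain ⟨b, hb, rfl⟩ := he
      exact ⟨(hi.monotone ha).trans_lt (hp.1.trans_le (hi'.monotone hb)),
        (hj.monotone ha).trans_lt (hp.2.trans_le (hj'.monotone hb))⟩)
    refine hno _ ?_ c3.1 ?_
    · intro e he
      simp only [Finset.coe_union, Finset.coe_image, Set.mem_union, Set.mem_image,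
        Finset.mem_coe] at he
      rcases he with ⟨a, -, rfl⟩ | ⟨a, -, rfl⟩
      · exact hV a
      · exact hV' a
    · rw [c3.2, c1.2, c2.2, Fin.card_Iic, Fin.card_Ici]
      omega
  -- Arcs in equal positions are therefore nested or equal, and this pair is the inner one. The
  -- inner arcs form a chain whose right ends are bounded by `j`; lexicographic minimality makes
  -- them equal to `j`.
  have hmem : ∀ s, (max (i s) (i' s), min (j s) (j' s)) ∈ V := by
    intro s
    rcases lt_trichotomy (j s) (j' s) with h | h | h
    · rw [min_eq_left h.le, max_eq_left]
      · exact hV s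
      · exact not_lt.1 fun hlt => key i j i' j' hi hj hV hi' hj' hV' s ⟨hlt, h⟩
    · have := h2 _ (hV s) _ (hV' s) h
      rw [Prod.mk.injEq] at this
      rw [← this.1, ← this.2, max_self, min_self]
      exact hV s
    · rw [min_eq_right h.le, max_eq_right]
      · exact hV' s
      · exact not_lt.1 fun hlt => key i' j' i j hi' hj' hV' hi hj hV s ⟨hlt, h⟩
  have hle := hlex (fun s => max (i s) (i' s)) (fun s => min (j s) (j' s))
    (fun a b hab => max_lt_max (hi hab) (hi' hab)) (fun a b hab => min_lt_min (hj hab) (hj' hab))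
    hmem
  have hge : toLex (fun s => min (j s) (j' s)) ≤ toLex j :=
    Pi.toLex_monotone fun s => min_le_left _ _
  have heq : j = fun s => min (j s) (j' s) := toLex.injective (le_antisymm hle hge)
  have := congrFun heq s
  rw [this]
  exact min_le_right _ _

end Lex

/-! ### Exchanges written as replacement of a whole crossing, and their labellings. -/

section Packages

variable {N : Type*} [LinearOrder N] {r : N → N → Prop} {O : Set (N × N)} {x y : ℕ → N}
  {t K : ℕ}

namespace IsExchange

theorem inj_new (h : IsExchange r O x y t K) :
    (∀ f ∈ newArcs O x y t, ∀ g ∈ newArcs O x y t, f.1 = g.1 → f = g) ∧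
      ∀ f ∈ newArcs O x y t, ∀ g ∈ newArcs O x y t, f.2 = g.2 → f = g := by
  have hle := h.le
  constructor
  · rintro f (hf | ⟨s, hs, rfl⟩) g (hg | ⟨s', hs', rfl⟩) he
    · exact h.inj_fst f hf g hg he
    · exact absurd he (h.ne_x f hf s' hs')
    · exact absurd he.symm (h.ne_x g hg s hs)
    · rcases lt_trichotomy s s' with hlt | rfl | hlt
      · exact absurd he (h.x_lt _ _ hlt (by omega)).ne
      · rfl
      · exact absurd he (h.x_lt _ _ hlt (by omega)).ne'
  · rintro f (hf | ⟨s, hs, rfl⟩) g (hg | ⟨s', hs', rfl⟩) he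
    · exact h.inj_snd f hf g hg he
    · exact absurd he (h.ne_y f hf s' hs')
    · exact absurd he.symm (h.ne_y g hg s hs)
    · rw [h.y_inj (by omega) (by omega) he]

theorem inj_old (h : IsExchange r O x y t K) :
    (∀ f ∈ oldArcs O x y t, ∀ g ∈ oldArcs O x y t, f.1 = g.1 → f = g) ∧
      ∀ f ∈ oldArcs O x y t, ∀ g ∈ oldArcs O x y t, f.2 = g.2 → f = g := by
  have hle := h.le
  constructor
  · rintro f (hf | ⟨s, h1, hs, rfl⟩) g (hg | ⟨s', h1', hs', rfl⟩) he
    · exact h.inj_fst f hf g hg he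
    · exact absurd he (h.ne_x f hf _ (by omega))
    · exact absurd he.symm (h.ne_x g hg _ (by omega))
    · rcases lt_trichotomy s s' with hlt | rfl | hlt
      · exact absurd he (h.x_lt _ _ (by omega) (by omega)).ne
      · rfl
      · exact absurd he (h.x_lt _ _ (by omega) (by omega)).ne'
  · rintro f (hf | ⟨s, h1, hs, rfl⟩) g (hg | ⟨s', h1', hs', rfl⟩) he
    · exact h.inj_snd f hf g hg he
    · exact absurd he (h.ne_y f hf s' hs')
    · exact absurd he.symm (h.ne_y g hg s hs)
    · rw [h.y_inj (by omega) (by omega) he]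

theorem ne_old (h : IsExchange r O x y t K) : ∀ f ∈ oldArcs O x y t, f.1 ≠ x t ∧ f.2 ≠ y 0 := by
  have hle := h.le
  rintro f (hf | ⟨s, h1, hs, rfl⟩)
  · exact ⟨h.ne_x f hf t le_rfl, h.ne_y f hf 0 (Nat.zero_le _)⟩
  · exact ⟨(h.x_lt _ _ (by omega) hle).ne, (h.y_lt _ _ (by omega) (by omega)).ne'⟩

/-- The operations remove and reinsert a whole crossing, while an exchange touches only indices up
to `t`. Both descriptions agree because the tail arcs are removed and put back. -/
theorem newArcs_eq (h : IsExchange r O x y t K) : newArcs O x y t =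
    (oldArcs O x y t \ {e | ∃ s, 1 ≤ s ∧ s ≤ K ∧ e = (leftEnd x t s, y s)}) ∪
      {e | ∃ s ≤ K, e = (x s, y s)} := by
  have hle := h.le
  ext e
  constructor
  · rintro (he | ⟨s, hs, rfl⟩)
    · by_cases hex : ∃ s, 1 ≤ s ∧ s ≤ K ∧ e = (leftEnd x t s, y s)
      · obtain ⟨s, h1, hs, rfl⟩ := hex
        by_cases hst : s ≤ t
        · exact absurd rfl (h.ne_y _ he s hst)
        · exact Or.inr ⟨s, hs, by rw [leftEnd, if_neg hst]⟩
      · exact Or.inl ⟨Or.inl he, hex⟩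
    · exact Or.inr ⟨s, by omega, rfl⟩
  · rintro (⟨he | ⟨s, h1, hs, rfl⟩, hn⟩ | ⟨s, hs, rfl⟩)
    · exact Or.inl he
    · exact absurd ⟨s, h1, by omega, by rw [leftEnd, if_pos hs]⟩ hn
    · exact h.new_mem hs

theorem oldArcs_eq (h : IsExchange r O x y t K) : oldArcs O x y t =
    (newArcs O x y t \ {e | ∃ s ≤ K, e = (x s, y s)}) ∪
      {e | ∃ s, 1 ≤ s ∧ s ≤ K ∧ e = (leftEnd x t s, y s)} := by
  have hle := h.le
  ext e
  constructor
  · rintro (he | ⟨s, h1, hs, rfl⟩)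
    · by_cases hex : ∃ s ≤ K, e = (x s, y s)
      · obtain ⟨s, hs, rfl⟩ := hex
        by_cases hst : s ≤ t
        · exact absurd rfl (h.ne_y _ he s hst)
        · exact Or.inr ⟨s, by omega, hs, by rw [leftEnd, if_neg hst]⟩
      · exact Or.inl ⟨Or.inl he, hex⟩
    · exact Or.inr ⟨s, h1, by omega, by rw [leftEnd, if_pos hs]⟩
  · rintro (⟨he | ⟨s, hs, rfl⟩, hn⟩ | ⟨s, h1, hs, rfl⟩)
    · exact Or.inl he
    · exact absurd ⟨s, by omega, rfl⟩ hn
    · exact h.old_mem h1 hs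

/-- The labelling of an exchange whose old chain is lexicographically minimal. -/
theorem exists_labelling_of_lex_min (h : IsExchange r O x y t K)
    (hno : ∀ D, IsXing r (oldArcs O x y t) (K + 1) D → ∃ e ∈ D, e.2 ≤ y 0)
    {i j : Fin K → N} (hij : ∀ s : Fin K, i s = leftEnd x t (s + 1) ∧ j s = y (s + 1))
    (hlex : ∀ i' j' : Fin K → N, StrictMono i' → StrictMono j' →
      (∀ s, (i' s, j' s) ∈ overArcs r (y 0) (oldArcs O x y t)) → toLex j ≤ toLex j') :
    ∃ lab, IsLabelling r O x y t K lab ∧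
      ∀ f ∈ overArcs r (y 0) (oldArcs O x y t), ∀ s, 1 ≤ s → s ≤ K →
        (s < K → f.1 < leftEnd x t (s + 1)) → f.2 < y s → lab f < s := by
  have hno' : ∀ D : Finset (N × N), (D : Set (N × N)) ⊆ overArcs r (y 0) (oldArcs O x y t) →
      ArcChain D → D.card ≠ K + 1 := by
    intro D hD hc hcard
    obtain ⟨e, he, hle⟩ := hno D ⟨hc, hcard, fun e he => (hD he).1, fun e he f hf =>
      h.r_mono _ _ _ _ (hD he).2.1 le_rfl (hD hf).2.2.le⟩
    exact absurd (hD he).2.2 hle.not_gt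
  refine h.exists_labelling_forward hno' ?_
  intro i' j' hi' hj' hV' s
  rw [← (hij s).2]
  refine le_of_forall_toLex_le (V := overArcs r (y 0) (oldArcs O x y t))
    (fun f hf g hg => h.inj_old.2 f hf.1 g hg.1)
    hno' (i := i) ?_ ?_ ?_ hlex hi' hj' hV' s
  · intro a b hab
    rw [(hij a).1, (hij b).1]
    exact h.leftEnd_lt (by omega) (by simpa using hab) (by omega)
  · intro a b hab
    rw [(hij a).2, (hij b).2]
    exact h.y_lt _ _ (by simpa using hab) (by omega)
  · intro a
    rw [(hij a).1, (hij a).2]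
    exact h.old_over (by omega) (by omega)

/-- The labelling of an exchange whose new chain is lexicographically maximal. -/
theorem exists_labelling_of_lex_max (h : IsExchange r O x y t K)
    (hno : ∀ D, IsXing r (newArcs O x y t) (K + 1) D → ∃ e ∈ D, e.2 ≤ y 0)
    (hno' : ∀ D, IsXing r (newArcs O x y t) (K + 1) D → (x t, y t) ∉ D → ∃ e ∈ D, e.2 < y 0)
    {Y : Fin (K + 1) → N} (hY : ∀ s : Fin (K + 1), Y s = y s)
    (hlex : ∀ i' j' : Fin (K + 1) → N, StrictMono i' → StrictMono j' →
      (∀ s, (i' s, j' s) ∈ newArcs O x y t) → (∀ s s', r (i' s) (j' s')) →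
      (∃ s, (x t, y t) = (i' s, j' s)) → toLex j' ≤ toLex Y) :
    ∃ lab, IsLabelling r O x y t K lab := by
  classical
  have hle := h.le
  refine h.exists_labelling_backward ?_ ?_
  · intro D hD hc hcard
    obtain ⟨e, he, hle⟩ := hno D ⟨hc, hcard, fun e he => (hD he).1, fun e he f hf =>
      h.r_mono _ _ _ _ (hD he).2.1 le_rfl (hD hf).2.2.le⟩
    exact absurd (hD he).2.2 hle.not_gt
  · intro s h1 hs F hF hFc hFcard hFs
    obtain ⟨i, j, hi, hj, hm, -⟩ := hFc.exists_fun hFcard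
    -- `F` is spliced onto the first `s` new chain arcs. If the result contains `(x t, y t)`, it
    -- beats `Y` lexicographically at index `s`; otherwise `hno'` excludes it, since all its right
    -- ends are at least `y 0`.
    let i' : Fin (K + 1) → N := fun p => if hp : (p : ℕ) < s then x p else i ⟨p - s, by omega⟩
    let j' : Fin (K + 1) → N := fun p => if hp : (p : ℕ) < s then y p else j ⟨p - s, by omega⟩
    have hi'1 : ∀ p : Fin (K + 1), (p : ℕ) < s → i' p = x p ∧ j' p = y p := fun p hp =>
      ⟨dif_pos hp, dif_pos hp⟩
    have hi'2 : ∀ p : Fin (K + 1), ∀ hp : ¬ (p : ℕ) < s,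
        i' p = i ⟨p - s, by omega⟩ ∧ j' p = j ⟨p - s, by omega⟩ := fun p hp =>
      ⟨dif_neg hp, dif_neg hp⟩
    have hp : ∀ p q : Fin (K + 1), p < q → Prec (i' p, j' p) (i' q, j' q) := by
      intro p q hpq
      have hpq' := Fin.lt_def.1 hpq
      by_cases hps : (p : ℕ) < s
      · rw [(hi'1 p hps).1, (hi'1 p hps).2]
        by_cases hqs : (q : ℕ) < s
        · rw [(hi'1 q hqs).1, (hi'1 q hqs).2]
          exact h.new_prec hpq' (by omega)
        · rw [(hi'2 q hqs).1, (hi'2 q hqs).2]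
          have := hFs _ (hm ⟨q - s, by omega⟩)
          exact ⟨(h.x_le (by omega) (by omega)).trans_lt this.1,
            (h.y_lt _ _ (by omega) (by omega)).trans this.2⟩
      · have hqs : ¬ (q : ℕ) < s := by omega
        rw [(hi'2 p hps).1, (hi'2 p hps).2, (hi'2 q hqs).1, (hi'2 q hqs).2]
        exact ⟨hi (Fin.lt_def.2 (by simp only; omega)), hj (Fin.lt_def.2 (by simp only; omega))⟩
    have hi' : StrictMono i' := fun p q hpq => (hp p q hpq).1
    have hj' : StrictMono j' := fun p q hpq => (hp p q hpq).2
    have hmem : ∀ p, (i' p, j' p) ∈ newArcs O x y t ∧ r (i' p) (y 0) ∧ y 0 ≤ j' p := by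
      intro p
      by_cases hps : (p : ℕ) < s
      · rw [(hi'1 p hps).1, (hi'1 p hps).2]
        exact ⟨h.new_mem (by omega), h.r_x _ (by omega), h.y_le (Nat.zero_le _) (by omega)⟩
      · rw [(hi'2 p hps).1, (hi'2 p hps).2]
        have := hF (hm ⟨p - s, by omega⟩)
        exact ⟨this.1, this.2.1, this.2.2.le⟩
    have hr : ∀ p q, r (i' p) (j' q) := fun p q =>
      h.r_mono _ _ _ _ (hmem p).2.1 le_rfl (hmem q).2.2
    have hX := isXing_of_fun (r := r) hi' hj' (fun p => (hmem p).1) hr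
    by_cases ht : ∃ p, (x t, y t) = (i' p, j' p)
    · refine absurd (hlex i' j' hi' hj' (fun p => (hmem p).1) hr ht) (not_le.2 ?_)
      refine toLex_lt_of ⟨s, by omega⟩ ?_ ?_
      · intro q hq
        have hqs : (q : ℕ) < s := Fin.lt_def.1 hq
        rw [hY, (hi'1 q hqs).2]
      · rw [hY, (hi'2 ⟨s, by omega⟩ (lt_irrefl _)).2]
        exact (hFs _ (hm _)).2
    · obtain ⟨e, he, hlt⟩ := hno' _ hX (by
        intro hmem'
        obtain ⟨p, -, hp⟩ := Finset.mem_image.1 hmem'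
        exact ht ⟨p, hp.symm⟩)
      obtain ⟨p, -, rfl⟩ := Finset.mem_image.1 he
      exact absurd hlt (hmem p).2.2.not_gt

end IsExchange
end Packages

/-! ### Inserting `a` and `b` into the words of a crossing. -/

section Insert

variable {n K : ℕ}

/-- The extension of a word to all indices. -/
def extend (f : Fin (K + 1) → Fin n) (s : ℕ) : Fin n := f (Fin.ofNat (K + 1) s)

theorem extend_of_lt (f : Fin (K + 1) → Fin n) {s : ℕ} (hs : s < K + 1) :
    extend f s = f ⟨s, hs⟩ := by
  unfold extend
  congr 1
  ext
  exact Nat.mod_eq_of_lt hs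

theorem extend_val (f : Fin (K + 1) → Fin n) (s : Fin (K + 1)) : extend f s = f s :=
  extend_of_lt f s.2

theorem extend_insertAt_self (T : Fin (K + 1)) (b : Fin n) (i : Fin K → Fin n) :
    extend (insertAt T b i) T = b := by
  rw [extend_val, insertAt, Fin.insertNth_apply_same]

theorem extend_insertAt_lt (T : Fin (K + 1)) (b : Fin n) (i : Fin K → Fin n) (q : Fin K)
    (hq : (q : ℕ) < T) : extend (insertAt T b i) q = i q := by
  rw [extend_of_lt _ (by omega)]
  have : (⟨q, by omega⟩ : Fin (K + 1)) = T.succAbove q := by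
    rw [Fin.succAbove_of_castSucc_lt _ _ (Fin.lt_def.2 (by simpa using hq))]
    rfl
  rw [this, insertAt, Fin.insertNth_apply_succAbove]

theorem extend_insertAt_ge (T : Fin (K + 1)) (b : Fin n) (i : Fin K → Fin n) (q : Fin K)
    (hq : (T : ℕ) ≤ q) : extend (insertAt T b i) (q + 1) = i q := by
  rw [extend_of_lt _ (by omega)]
  have : (⟨q + 1, by omega⟩ : Fin (K + 1)) = T.succAbove q := by
    rw [Fin.succAbove_of_le_castSucc _ _ (Fin.le_def.2 (by simpa using hq))]
    rfl
  rw [this, insertAt, Fin.insertNth_apply_succAbove]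

/-- Skipping the inserted `b` recovers the word `i`: indices shift by one up to position `T` and not
after it, which is exactly the case distinction in `leftEnd`. -/
theorem leftEnd_extend_insertAt (T : Fin (K + 1)) (b : Fin n) (i : Fin K → Fin n) (q : Fin K) :
    leftEnd (extend (insertAt T b i)) T (q + 1) = i q := by
  unfold leftEnd
  split_ifs with h
  · exact extend_insertAt_lt T b i q (by omega)
  · exact extend_insertAt_ge T b i q (by omega)

theorem extend_prepend_zero (a : Fin n) (j : Fin K → Fin n) : extend (prepend a j) 0 = a := by
  rw [extend_of_lt _ (Nat.succ_pos K)]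
  rfl

theorem extend_prepend_succ (a : Fin n) (j : Fin K → Fin n) (q : Fin K) :
    extend (prepend a j) (q + 1) = j q := by
  rw [extend_of_lt _ (by omega)]
  exact Fin.cons_succ (α := fun _ => Fin n) a j q

/-- This presents the shift as the case `T = K`, `b = a` of the insertion used for rotations. -/
theorem append_eq_insertAt (a : Fin n) (i : Fin K → Fin n) :
    append i a = insertAt (Fin.last K) a i := by
  rw [append, insertAt, Fin.insertNth_last']

theorem pairs_insertAt_prepend (T : Fin (K + 1)) (a b : Fin n) (i j : Fin K → Fin n) :
    pairs (insertAt T b i) (prepend a j) =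
      {e | ∃ s ≤ K, e = (extend (insertAt T b i) s, extend (prepend a j) s)} := by
  ext e
  constructor
  · rintro ⟨s, rfl⟩
    exact ⟨s, by omega, by rw [extend_val, extend_val]⟩
  · rintro ⟨s, hs, rfl⟩
    exact ⟨⟨s, by omega⟩, by rw [extend_of_lt _ (by omega), extend_of_lt _ (by omega)]⟩

theorem pairs_eq_leftEnd (T : Fin (K + 1)) (a b : Fin n) (i j : Fin K → Fin n) :
    pairs i j = {e | ∃ s, 1 ≤ s ∧ s ≤ K ∧
      e = (leftEnd (extend (insertAt T b i)) T s, extend (prepend a j) s)} := by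
  ext e
  constructor
  · rintro ⟨s, rfl⟩
    exact ⟨s + 1, by omega, by omega, by rw [leftEnd_extend_insertAt, extend_prepend_succ]⟩
  · rintro ⟨s, h1, hs, rfl⟩
    obtain ⟨q, rfl⟩ : ∃ q, s = q + 1 := ⟨s - 1, by omega⟩
    refine ⟨⟨q, by omega⟩, ?_⟩
    have h1 := leftEnd_extend_insertAt T b i ⟨q, by omega⟩
    have h2 := extend_prepend_succ a j ⟨q, by omega⟩
    simp only at h1 h2
    rw [h1, h2]

/-- `T.cycleRange` sends `T` to `0` and `T.succAbove q` to `q.succ`. Thus `b` receives the right end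
`a`, and every other left end recovers its partner in the smaller crossing. -/
theorem pairs_cycleRange (T : Fin (K + 1)) (a b : Fin n) (i j : Fin K → Fin n) :
    pairs (insertAt T b i) (fun s => prepend a j (T.cycleRange s)) = pairs i j ∪ {(b, a)} := by
  ext e
  constructor
  · rintro ⟨s, rfl⟩
    rcases Fin.eq_self_or_eq_succAbove T s with rfl | ⟨q, rfl⟩
    · right
      simp only [Fin.cycleRange_self, insertAt, prepend, Fin.insertNth_apply_same, Fin.cons_zero]
      rfl
    · left
      refine ⟨q, ?_⟩
      simp only [Fin.cycleRange_succAbove, insertAt, prepend, Fin.insertNth_apply_succAbove,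
        Fin.cons_succ]
  · rintro (⟨q, rfl⟩ | rfl)
    · refine ⟨T.succAbove q, ?_⟩
      simp only [Fin.cycleRange_succAbove, insertAt, prepend, Fin.insertNth_apply_succAbove,
        Fin.cons_succ]
    · refine ⟨T, ?_⟩
      simp only [Fin.cycleRange_self, insertAt, prepend, Fin.insertNth_apply_same, Fin.cons_zero]

theorem strictMono_extend {f : Fin (K + 1) → Fin n} (hf : StrictMono f) (s s' : ℕ) (h : s < s')
    (h' : s' ≤ K) : extend f s < extend f s' := by
  rw [extend_of_lt _ (by omega), extend_of_lt _ (by omega)]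
  exact hf (Fin.lt_def.2 h)

theorem strictMono_insertAt {T : Fin (K + 1)} {b : Fin n} {i : Fin K → Fin n} (hi : StrictMono i)
    (hb : ∀ s : Fin K, ((s : ℕ) < T → i s < b) ∧ ((T : ℕ) ≤ s → b < i s)) :
    StrictMono (insertAt T b i) := by
  intro p q hpq
  rcases Fin.eq_self_or_eq_succAbove T p with hp | ⟨p, rfl⟩ <;>
    rcases Fin.eq_self_or_eq_succAbove T q with hq | ⟨q, rfl⟩
  · exact absurd hpq (by rw [hp, hq]; exact lt_irrefl _)
  · rw [hp] at hpq ⊢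
    simp only [insertAt, Fin.insertNth_apply_same, Fin.insertNth_apply_succAbove]
    refine (hb q).2 ?_
    rw [Fin.lt_succAbove_iff_le_castSucc] at hpq
    exact hpq
  · rw [hq] at hpq ⊢
    simp only [insertAt, Fin.insertNth_apply_same, Fin.insertNth_apply_succAbove]
    refine (hb p).1 ?_
    rw [Fin.succAbove_lt_iff_castSucc_lt] at hpq
    exact hpq
  · simp only [insertAt, Fin.insertNth_apply_succAbove]
    exact hi ((Fin.strictMono_succAbove T).lt_iff_lt.1 hpq)

theorem strictMono_prepend {a : Fin n} {j : Fin K → Fin n} (hj : StrictMono j)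
    (ha : ∀ s, a < j s) : StrictMono (prepend a j) := by
  intro p q hpq
  refine Fin.cases (fun hpq => ?_) (fun p hpq => ?_) p hpq
  · obtain ⟨q', rfl⟩ := Fin.exists_succ_eq.2 (Fin.pos_iff_ne_zero.1 hpq)
    exact ha q'
  · obtain ⟨q', rfl⟩ := Fin.exists_succ_eq.2 ((Fin.zero_le _).trans_lt hpq).ne'
    exact hj (Fin.succ_lt_succ_iff.1 hpq)

/-- The exchange that inserts `a` and `b` into a chain of arcs of `A`. -/
theorem exists_isExchange_of_old {r : Fin n → Fin n → Prop} {A : Set (Fin n × Fin n)}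
    (hr : ∀ u v u' v', r u v → u' ≤ u → v ≤ v' → r u' v')
    (h1 : ∀ f ∈ A, ∀ g ∈ A, f.1 = g.1 → f = g) (h2 : ∀ f ∈ A, ∀ g ∈ A, f.2 = g.2 → f = g)
    {i j : Fin K → Fin n} (hi : StrictMono i) (hj : StrictMono j) (hA : ∀ s, (i s, j s) ∈ A)
    {a b : Fin n} {T : Fin (K + 1)} (hT : 1 ≤ (T : ℕ))
    (hb : ∀ s : Fin K, ((s : ℕ) < T → i s < b) ∧ ((T : ℕ) ≤ s → b < i s))
    (ha : ∀ s, a < j s) (hra : ∀ s, r (i s) a) (hrb : r b a) (hbA : ∀ e ∈ A, e.1 ≠ b)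
    (haA : ∀ e ∈ A, e.2 ≠ a) :
    ∃ O, IsExchange r O (extend (insertAt T b i)) (extend (prepend a j)) T K ∧
      oldArcs O (extend (insertAt T b i)) (extend (prepend a j)) T = A ∧
      newArcs O (extend (insertAt T b i)) (extend (prepend a j)) T =
        (A \ pairs i j) ∪ pairs (insertAt T b i) (prepend a j) := by
  set x := extend (insertAt T b i) with hx
  set y := extend (prepend a j) with hy
  have hxm := strictMono_extend (strictMono_insertAt hi hb)
  have hym := strictMono_extend (strictMono_prepend hj ha)
  rw [← hx] at hxm
  rw [← hy] at hym
  have hTK : (T : ℕ) ≤ K := by omega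
  have hmem : ∀ s, 1 ≤ s → s ≤ K → (leftEnd x T s, y s) ∈ A := by
    intro s hs1 hs
    obtain ⟨q, rfl⟩ : ∃ q, s = q + 1 := ⟨s - 1, by omega⟩
    have e1 := leftEnd_extend_insertAt T b i ⟨q, by omega⟩
    have e2 := extend_prepend_succ a j ⟨q, by omega⟩
    simp only at e1 e2
    rw [hx, hy, e1, e2]
    exact hA _
  have hsub : ∀ s, 1 ≤ s → s ≤ (T : ℕ) → (x (s - 1), y s) ∈ A := by
    intro s hs1 hs
    have := hmem s hs1 (by omega)
    rwa [leftEnd, if_pos hs] at this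
  -- Only the arcs with indices up to `T` are taken out of `A`; the tail of the crossing stays among
  -- the fixed arcs.
  have hex : IsExchange r (A \ {e | ∃ s, 1 ≤ s ∧ s ≤ (T : ℕ) ∧ e = (x (s - 1), y s)}) x y T K := by
    refine ⟨hT, hTK, hxm, hym, ?_, fun f hf g hg => h1 f hf.1 g hg.1,
      fun f hf g hg => h2 f hf.1 g hg.1, ?_, ?_, hr, ?_⟩
    · intro s hs hsK
      have := hmem s (by omega) hsK
      rw [leftEnd, if_neg (by omega)] at this
      refine ⟨this, ?_⟩
      rintro ⟨s', -, hs', he⟩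
      exact absurd (congrArg Prod.snd he) (hym s' s (by omega) hsK).ne'
    · rintro f ⟨hf, hn⟩ s hs he
      rcases hs.eq_or_lt with rfl | hlt
      · exact hbA f hf (he.trans (extend_insertAt_self T b i))
      · have := hsub (s + 1) (by omega) (by omega)
        exact hn ⟨s + 1, by omega, by omega, h1 f hf _ this he⟩
    · rintro f ⟨hf, hn⟩ s hs he
      rcases Nat.eq_zero_or_pos s with rfl | hpos
      · exact haA f hf (he.trans (extend_prepend_zero a j))
      · exact hn ⟨s, hpos, hs, h2 f hf _ (hsub s hpos hs) he⟩
    · intro s hs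
      rw [hy, extend_prepend_zero]
      rcases lt_trichotomy s T with hlt | heq | hgt
      · have := extend_insertAt_lt T b i ⟨s, by omega⟩ hlt
        simp only at this
        rw [hx, this]
        exact hra _
      · rw [heq, hx, extend_insertAt_self]
        exact hrb
      · obtain ⟨q, rfl⟩ : ∃ q, s = q + 1 := ⟨s - 1, by omega⟩
        have := extend_insertAt_ge T b i ⟨q, by omega⟩ (by simp only; omega)
        simp only at this
        rw [hx, this]
        exact hra _
  have hold : oldArcs (A \ {e | ∃ s, 1 ≤ s ∧ s ≤ (T : ℕ) ∧ e = (x (s - 1), y s)}) x y T = A := by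
    unfold oldArcs
    rw [Set.sdiff_union_of_subset]
    rintro e ⟨s, hs1, hs, rfl⟩
    exact hsub s hs1 hs
  refine ⟨_, hex, hold, ?_⟩
  rw [hex.newArcs_eq, hold, pairs_eq_leftEnd T a b i j, pairs_insertAt_prepend]

/-- The exchange that removes `a` and `b` from a chain of arcs of `A`. -/
theorem exists_isExchange_of_new {r : Fin n → Fin n → Prop} {A : Set (Fin n × Fin n)}
    (hr : ∀ u v u' v', r u v → u' ≤ u → v ≤ v' → r u' v')
    (h1 : ∀ f ∈ A, ∀ g ∈ A, f.1 = g.1 → f = g) (h2 : ∀ f ∈ A, ∀ g ∈ A, f.2 = g.2 → f = g)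
    {i j : Fin K → Fin n} {a b : Fin n} {T : Fin (K + 1)} (hT : 1 ≤ (T : ℕ))
    (hx : StrictMono (insertAt T b i)) (hy : StrictMono (prepend a j))
    (hA : ∀ s, (insertAt T b i s, prepend a j s) ∈ A) (hra : ∀ s, r (insertAt T b i s) a) :
    ∃ O, IsExchange r O (extend (insertAt T b i)) (extend (prepend a j)) T K ∧
      newArcs O (extend (insertAt T b i)) (extend (prepend a j)) T = A ∧
      oldArcs O (extend (insertAt T b i)) (extend (prepend a j)) T =
        (A \ pairs (insertAt T b i) (prepend a j)) ∪ pairs i j := by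
  have hxm := strictMono_extend hx
  have hym := strictMono_extend hy
  set x := extend (insertAt T b i) with hx'
  set y := extend (prepend a j) with hy'
  have hTK : (T : ℕ) ≤ K := by omega
  have hmem : ∀ s ≤ K, (x s, y s) ∈ A := by
    intro s hs
    rw [hx', hy', extend_of_lt _ (by omega), extend_of_lt _ (by omega)]
    exact hA _
  have hex : IsExchange r (A \ {e | ∃ s, s ≤ (T : ℕ) ∧ e = (x s, y s)}) x y T K := by
    refine ⟨hT, hTK, hxm, hym, ?_, fun f hf g hg => h1 f hf.1 g hg.1,
      fun f hf g hg => h2 f hf.1 g hg.1, ?_, ?_, hr, ?_⟩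
    · intro s hs hsK
      refine ⟨hmem s hsK, ?_⟩
      rintro ⟨s', hs', he⟩
      exact absurd (congrArg Prod.snd he) (hym s' s (by omega) hsK).ne'
    · rintro f ⟨hf, hn⟩ s hs he
      exact hn ⟨s, hs, h1 f hf _ (hmem s (by omega)) he⟩
    · rintro f ⟨hf, hn⟩ s hs he
      exact hn ⟨s, hs, h2 f hf _ (hmem s (by omega)) he⟩
    · intro s hs
      rw [hy', extend_prepend_zero, hx', extend_of_lt _ (by omega)]
      exact hra _
  have hnew : newArcs (A \ {e | ∃ s, s ≤ (T : ℕ) ∧ e = (x s, y s)}) x y T = A := by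
    unfold newArcs
    rw [Set.sdiff_union_of_subset]
    rintro e ⟨s, hs, rfl⟩
    exact hmem s (by omega)
  refine ⟨_, hex, hnew, ?_⟩
  rw [hex.oldArcs_eq, hnew, pairs_eq_leftEnd T a b i j, pairs_insertAt_prepend]

end Insert

/-! ### Consequences of an exchange for partitions. -/

section Common

variable {n K : ℕ}

theorem IsXing.mono {N : Type*} [LinearOrder N] {r r' : N → N → Prop} {A A' : Set (N × N)} {m : ℕ}
    {D : Finset (N × N)} (h : IsXing r A m D) (hr : ∀ u v, r u v → r' u v) (hA : A ⊆ A') :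
    IsXing r' A' m D :=
  ⟨h.1, h.2.1, h.2.2.1.trans hA, fun e he f hf => hr _ _ (h.2.2.2 e he f hf)⟩

theorem mem_coveredRed_iff {P : SetPartition (n + 1)} {c : Fin (n + 1)} :
    c ∈ coveredRed K P ↔ c ∈ red P ∧
      ∃ D, IsXing (· < ·) (blackStrict P) K D ∧ ∀ e ∈ D, e.1 < c ∧ c < e.2 := by
  constructor
  · rintro ⟨hc, i, j, hij, hu⟩
    rw [isBlackCrossing_iff] at hij
    refine ⟨hc, _, isXing_of_fun hij.1 hij.2.1 hij.2.2.1 hij.2.2.2, ?_⟩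
    intro e he
    obtain ⟨s, -, rfl⟩ := Finset.mem_image.1 he
    exact hu s
  · rintro ⟨hc, D, hD, hu⟩
    obtain ⟨i, j, hi, hj, hm, -, hA, hr⟩ := hD.exists_fun
    exact ⟨hc, i, j, isBlackCrossing_iff.2 ⟨hi, hj, hA, hr⟩, fun s => hu _ (hm s)⟩

theorem exists_isInnermost {P : SetPartition (n + 1)} {a : Fin (n + 1)}
    (h : a ∈ coveredRed K P) : ∃ i j : Fin K → Fin (n + 1), IsInnermost P a i j := by
  obtain ⟨-, i, j, hij⟩ := h
  obtain ⟨p, hp, hmin⟩ := Set.exists_min_image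
    {p : (Fin K → Fin (n + 1)) × (Fin K → Fin (n + 1)) |
      IsBlackCrossing P p.1 p.2 ∧ Under p.1 p.2 a} (fun p => toLex p.2) (Set.toFinite _)
    ⟨(i, j), hij⟩
  exact ⟨p.1, p.2, hp.1, hp.2, fun i' j' h1 h2 => hmin (i', j') ⟨h1, h2⟩⟩

theorem IsInnermost.unique {P : SetPartition (n + 1)} {a : Fin (n + 1)}
    {i j i' j' : Fin K → Fin (n + 1)} (h : IsInnermost P a i j) (h' : IsInnermost P a i' j') :
    i = i' ∧ j = j' := by
  have hj : j = j' := toLex.injective (le_antisymm (h.2.2 _ _ h'.1 h'.2.1) (h'.2.2 _ _ h.1 h.2.1))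
  subst hj
  refine ⟨funext fun s => ?_, rfl⟩
  exact congrArg Prod.fst (strictArcs_inj_snd P _ ((isCrossing_iff.1 h.1.1).2.2.1 s) _
    ((isCrossing_iff.1 h'.1.1).2.2.1 s) rfl)

/-- Red arcs join consecutive elements of the red block, so the red block and the black strict arcs
together give all strict arcs. -/
theorem eq_of_red_black {P Q : SetPartition (n + 1)} (hr : red P = red Q)
    (hb : blackStrict P = blackStrict Q) : P = Q := by
  have key : ∀ P Q : SetPartition (n + 1), red P = red Q → blackStrict P = blackStrict Q →
      strictArcs P ⊆ strictArcs Q := by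
    rintro P Q hr hb ⟨u, v⟩ he
    by_cases hu : u ∈ red P
    · have h := mem_strictArcs.1 he
      have hv := (mem_red_iff_of_arc he).1 hu
      rw [part_eq_red hu] at h
      have hu' : u ∈ red Q := hr ▸ hu
      rw [mem_strictArcs, part_eq_red hu', ← hr]
      exact h
    · have : (u, v) ∈ blackStrict P := ⟨he, hu⟩
      rw [hb] at this
      exact this.1
  exact eq_of_strictArcs_eq ((key P Q hr hb).antisymm (key Q P hr.symm hb.symm))

/-- The new arcs use only two extra ends, `x t` on the left and `y 0` on the right. This controls
which nodes carry loops. -/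
theorem ends_newArcs {r : Fin n → Fin n → Prop} {O : Set (Fin n × Fin n)} {x y : ℕ → Fin n}
    {t : ℕ} (h : IsExchange r O x y t K) (i : Fin n) :
    i ∈ ends (newArcs O x y t) ↔ i = x t ∨ i = y 0 ∨ i ∈ ends (oldArcs O x y t) := by
  have h1 := h.one_le
  constructor
  · rintro ⟨e, he | ⟨s, hs, rfl⟩, hi⟩
    · exact Or.inr (Or.inr ⟨e, Or.inl he, hi⟩)
    · rcases hi with rfl | rfl
      · rcases hs.eq_or_lt with rfl | hlt
        · exact Or.inl rfl
        · exact Or.inr (Or.inr ⟨_, Or.inr ⟨s + 1, by omega, by omega, rfl⟩, Or.inl rfl⟩)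
      · rcases Nat.eq_zero_or_pos s with rfl | hpos
        · exact Or.inr (Or.inl rfl)
        · exact Or.inr (Or.inr ⟨_, Or.inr ⟨s, by omega, by omega, rfl⟩, Or.inr rfl⟩)
  · rintro (rfl | rfl | ⟨e, he | ⟨s, h1, hs, rfl⟩, hi⟩)
    · exact ⟨_, Or.inr ⟨t, le_rfl, rfl⟩, Or.inl rfl⟩
    · exact ⟨_, Or.inr ⟨0, Nat.zero_le _, rfl⟩, Or.inr rfl⟩
    · exact ⟨e, Or.inl he, hi⟩
    · rcases hi with rfl | rfl
      · exact ⟨_, Or.inr ⟨s - 1, by omega, rfl⟩, Or.inl rfl⟩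
      · exact ⟨_, Or.inr ⟨s, by omega, rfl⟩, Or.inr rfl⟩

/-- Since only `y 0` gains an incoming arc, this yields the invariance of the number of blocks. -/
theorem snd_newArcs {O : Set (Fin n × Fin n)} {x y : ℕ → Fin n} {t : ℕ} (c : Fin n) :
    (∃ u, (u, c) ∈ newArcs O x y t) ↔
      c = y 0 ∨ ∃ u, (u, c) ∈ oldArcs O x y t := by
  constructor
  · rintro ⟨u, he | ⟨s, hs, he⟩⟩
    · exact Or.inr ⟨u, Or.inl he⟩
    · rw [Prod.mk.injEq] at he
      rcases Nat.eq_zero_or_pos s with rfl | hpos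
      · exact Or.inl he.2
      · exact Or.inr ⟨_, Or.inr ⟨s, by omega, by omega, by rw [he.2]⟩⟩
  · rintro (rfl | ⟨u, he | ⟨s, h1, hs, he⟩⟩)
    · exact ⟨_, Or.inr ⟨0, Nat.zero_le _, rfl⟩⟩
    · exact ⟨u, Or.inl he⟩
    · rw [Prod.mk.injEq] at he
      exact ⟨_, Or.inr ⟨s, by omega, by rw [he.2]⟩⟩

theorem exists_snd_iff (P : SetPartition (n + 1)) (c : Fin (n + 1)) :
    (∃ u, (u, c) ∈ strictArcs P) ↔ (c ∈ red P ∧ c ≠ 0) ∨ ∃ u, (u, c) ∈ blackStrict P := by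
  constructor
  · rintro ⟨u, hu⟩
    by_cases hr : u ∈ red P
    · exact Or.inl ⟨(mem_red_iff_of_arc hu).1 hr, ((Fin.zero_le u).trans_lt hu.1).ne'⟩
    · exact Or.inr ⟨u, hu, hr⟩
  · rintro (⟨hc, h0⟩ | ⟨u, hu⟩)
    · obtain ⟨l, hl, -⟩ := exists_pred P (Fin.pos_iff_ne_zero.2 h0) hc
      exact ⟨l, hl⟩
    · exact ⟨u, hu.1⟩

/-- Lifts an identity of strict arcs to all black arcs: `hends` says that the black loops are the
same, and none of them lies in `X`. -/
theorem blackArcs_eq_of {P Q : SetPartition (n + 1)} {X Y : Set (Fin (n + 1) × Fin (n + 1))}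
    (h : blackStrict P = (blackStrict Q \ X) ∪ Y) (hX : ∀ e ∈ X, e.1 < e.2)
    (hends : ∀ i, (i ∉ red P ∧ i ∉ ends (blackStrict P)) ↔
      (i ∉ red Q ∧ i ∉ ends (blackStrict Q))) :
    blackArcs P = (blackArcs Q \ X) ∪ Y := by
  ext e
  rw [blackArcs_eq_iff_blackStrict, hends, h]
  constructor
  · rintro ((h' | h') | ⟨h1, h2⟩)
    · exact Or.inl ⟨(blackArcs_eq_iff_blackStrict Q e).2 (Or.inl h'.1), h'.2⟩
    · exact Or.inr h'
    · exact Or.inl ⟨(blackArcs_eq_iff_blackStrict Q e).2 (Or.inr ⟨h1, h2⟩),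
        fun h' => absurd h1 (hX e h').ne⟩
  · rintro (⟨h1, h2⟩ | h')
    · rcases (blackArcs_eq_iff_blackStrict Q e).1 h1 with h1 | h1
      · exact Or.inl (Or.inl ⟨h1, h2⟩)
      · exact Or.inr h1
    · exact Or.inl (Or.inr h')

theorem blackStrict_eq_of {P Q : SetPartition (n + 1)} {X Y : Set (Fin (n + 1) × Fin (n + 1))}
    (h : blackArcs P = (blackArcs Q \ X) ∪ Y) (hY : ∀ e ∈ Y, e.1 < e.2) :
    blackStrict P = (blackStrict Q \ X) ∪ Y := by
  have hb : ∀ P : SetPartition (n + 1), ∀ e, e ∈ blackStrict P ↔ e ∈ blackArcs P ∧ e.1 < e.2 :=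
    fun P e => ⟨fun h => ⟨⟨h.1.2, h.2⟩, h.1.1⟩, fun h => ⟨⟨h.2, h.1.1⟩, h.1.2⟩⟩
  ext e
  rw [hb, h]
  constructor
  · rintro ⟨⟨h1, h2⟩ | h1, h3⟩
    · exact Or.inl ⟨(hb Q e).2 ⟨h1, h3⟩, h2⟩
    · exact Or.inr h1
  · rintro (⟨h1, h2⟩ | h1)
    · exact ⟨Or.inl ⟨((hb Q e).1 h1).1, h2⟩, h1.1.1⟩
    · exact ⟨Or.inr h1, hY e h1⟩

theorem toLex_prepend_le {m : ℕ} {a : Fin n} {j j' : Fin m → Fin n} (h : toLex j' ≤ toLex j) :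
    toLex (prepend a j') ≤ toLex (prepend a j) := by
  rcases h.eq_or_lt with heq | ⟨p, hp, hlt⟩
  · rw [toLex.injective heq]
  · refine (toLex_lt_of p.succ ?_ hlt).le
    intro q hq
    refine Fin.cases (fun _ => rfl) (fun q hq => ?_) q hq
    exact hp q (Fin.succ_lt_succ_iff.1 hq)

end Common

/-! ### The invariant of the shift phase and its exchanges. -/

section Shift

variable {n K : ℕ}

/-- The partitions that occur while performing enhanced left shifts. -/
def ShiftInv (K : ℕ) (P : SetPartition (n + 1)) : Prop :=
  (∀ D, ¬ IsXing (· < ·) (blackStrict P) (K + 1) D) ∧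
    ∀ c ∈ coveredRed K P, ∀ D, IsXing (· ≤ ·) (blackStrict P) (K + 1) D → ∃ e ∈ D, e.2 < c

theorem le_mono (u v u' v' : Fin n) (h : u ≤ v) (hu : u' ≤ u) (hv : v ≤ v') : u' ≤ v' :=
  hu.trans (h.trans hv)

theorem append_castSucc (i : Fin K → Fin n) (a : Fin n) (s : Fin K) :
    append i a s.castSucc = i s := Fin.snoc_castSucc (α := fun _ => Fin n) a i s

theorem append_last (i : Fin K → Fin n) (a : Fin n) : append i a (Fin.last K) = a :=
  Fin.snoc_last (α := fun _ => Fin n) a i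

theorem append_lt_prepend (hK : 1 ≤ K) {i j : Fin K → Fin n} {a : Fin n}
    (hx : StrictMono (append i a)) (hy : StrictMono (prepend a j)) (s : Fin (K + 1)) :
    append i a s < prepend a j s := by
  rcases (Fin.zero_le s).eq_or_lt with rfl | hs
  · have : (0 : Fin (K + 1)) < Fin.last K :=
      Fin.lt_def.2 (by simp only [Fin.val_zero, Fin.val_last]; omega)
    exact (hx this).trans_eq (append_last i a)
  · exact ((hx.monotone (Fin.le_last s)).trans_eq (append_last i a)).trans_lt (hy hs)

theorem isBlackWeakCrossingAt_iff (hK : 1 ≤ K) {P : SetPartition (n + 1)} {a : Fin (n + 1)}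
    {i j : Fin K → Fin (n + 1)} :
    IsBlackWeakCrossingAt P a i j ↔ StrictMono (append i a) ∧ StrictMono (prepend a j) ∧
      ∀ s, (append i a s, prepend a j s) ∈ blackStrict P := by
  rw [IsBlackWeakCrossingAt, isBlackWeakCrossing_iff hK]
  refine ⟨fun h => ⟨h.1, h.2.1, h.2.2.1⟩, fun h => ⟨h.1, h.2.1, h.2.2, ?_⟩⟩
  rw [append_last]
  rfl

/-- A black crossing in the weak sense without strict crossing yields a weak crossing. -/
theorem exists_weakCrossingAt (hK : 1 ≤ K) {P : SetPartition (n + 1)}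
    (hP : ∀ D, ¬ IsXing (· < ·) (blackStrict P) (K + 1) D) {i j : Fin (K + 1) → Fin (n + 1)}
    (hi : StrictMono i) (hj : StrictMono j) (hA : ∀ s, (i s, j s) ∈ blackStrict P)
    (hr : ∀ s s', i s ≤ j s') :
    ∃ i' j' : Fin K → Fin (n + 1), IsBlackWeakCrossingAt P (j 0) i' j' ∧ i = append i' (j 0) ∧
      j = prepend (j 0) j' := by
  have heq : i (Fin.last K) = j 0 := by
    refine le_antisymm (hr _ _) (not_lt.1 fun hlt => ?_)
    refine hP _ (isXing_of_fun hi hj hA fun s s' => ?_)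
    exact (hi.monotone (Fin.le_last s)).trans_lt (hlt.trans_le (hj.monotone (Fin.zero_le s')))
  have h1 : i = append (Fin.init (α := fun _ => Fin (n + 1)) i) (j 0) := by
    rw [← heq, append, Fin.snoc_init_self]
  have h2 : j = prepend (j 0) (Fin.tail (α := fun _ => Fin (n + 1)) j) := by
    rw [prepend, Fin.cons_self_tail]
  refine ⟨_, _, (isBlackWeakCrossingAt_iff hK).2 ?_, h1, h2⟩
  rw [← h1, ← h2]
  exact ⟨hi, hj, hA⟩

theorem weakCrossingAt_isXing (hK : 1 ≤ K) {P : SetPartition (n + 1)} {a : Fin (n + 1)}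
    {i j : Fin K → Fin (n + 1)} (h : IsBlackWeakCrossingAt P a i j) :
    ∃ D, IsXing (· ≤ ·) (blackStrict P) (K + 1) D ∧ ∀ e ∈ D, a ≤ e.2 := by
  rw [isBlackWeakCrossingAt_iff hK] at h
  have ha : ∀ s, a ≤ prepend a j s := fun s => h.2.1.monotone (Fin.zero_le s)
  refine ⟨_, isXing_of_fun h.1 h.2.1 h.2.2 fun s s' => ?_, ?_⟩
  · exact ((h.1.monotone (Fin.le_last s)).trans_eq (append_last i a)).trans (ha s')
  · intro e he
    obtain ⟨s, -, rfl⟩ := Finset.mem_image.1 he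
    exact ha s

/-- The exchange performed by an enhanced left shift. -/
theorem shift_exchange (hK : 1 ≤ K) {P : SetPartition (n + 1)} {a : Fin (n + 1)}
    {i j : Fin K → Fin (n + 1)} (ha : a ∈ red P) (hij : IsBlackCrossing P i j)
    (hu : Under i j a) :
    ∃ O, IsExchange (· ≤ ·) O (extend (append i a)) (extend (prepend a j)) K K ∧
      oldArcs O (extend (append i a)) (extend (prepend a j)) K = blackStrict P ∧
      newArcs O (extend (append i a)) (extend (prepend a j)) K =
        (blackStrict P \ pairs i j) ∪ pairs (append i a) (prepend a j) := by
  rw [isBlackCrossing_iff] at hij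
  have h := exists_isExchange_of_old (T := Fin.last K) (a := a) (b := a) (r := (· ≤ ·))
    (A := blackStrict P) le_mono (fun f hf g hg => strictArcs_inj_fst P f hf.1 g hg.1)
    (fun f hf g hg => strictArcs_inj_snd P f hf.1 g hg.1) hij.1 hij.2.1 hij.2.2.1
    (by simpa using hK)
    (fun s => ⟨fun _ => (hu s).1, fun h => by simp only [Fin.val_last] at h; omega⟩)
    (fun s => (hu s).2) (fun s => (hu s).1.le) le_rfl (fun e he h => he.2 (h ▸ ha))
    (fun e he h => blackStrict_snd_notMem_red he (h ▸ ha))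
  rw [← append_eq_insertAt] at h
  exact h

/-- The exchange undone by undoing an enhanced left shift. -/
theorem undoShift_exchange (hK : 1 ≤ K) {Q : SetPartition (n + 1)} {a : Fin (n + 1)}
    {i j : Fin K → Fin (n + 1)} (h : IsBlackWeakCrossingAt Q a i j) :
    ∃ O, IsExchange (· ≤ ·) O (extend (append i a)) (extend (prepend a j)) K K ∧
      newArcs O (extend (append i a)) (extend (prepend a j)) K = blackStrict Q ∧
      oldArcs O (extend (append i a)) (extend (prepend a j)) K =
        (blackStrict Q \ pairs (append i a) (prepend a j)) ∪ pairs i j := by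
  rw [isBlackWeakCrossingAt_iff hK] at h
  have hx := h.1
  rw [append_eq_insertAt] at hx
  have h' := exists_isExchange_of_new (T := Fin.last K) (a := a) (b := a) (r := (· ≤ ·)) (i := i)
    (j := j) (A := blackStrict Q) le_mono (fun f hf g hg => strictArcs_inj_fst Q f hf.1 g hg.1)
    (fun f hf g hg => strictArcs_inj_snd Q f hf.1 g hg.1) (by simpa using hK) hx h.2.1
    (by rw [← append_eq_insertAt]; exact h.2.2)
    (fun s => by
      have := hx.monotone (Fin.le_last s)
      simpa only [← append_eq_insertAt, append_last] using this)
  rw [← append_eq_insertAt] at h'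
  exact h'

end Shift

/-! ### Enhanced left shifts and their undoing are mutually inverse. -/

section Shift

variable {n K : ℕ}

theorem exists_partition_of_black (S : Finset (Fin (n + 1)))
    (B : Set (Fin (n + 1) × Fin (n + 1))) (h0 : 0 ∈ S) (hlt : ∀ e ∈ B, e.1 < e.2)
    (h1 : ∀ f ∈ B, ∀ g ∈ B, f.1 = g.1 → f = g) (h2 : ∀ f ∈ B, ∀ g ∈ B, f.2 = g.2 → f = g)
    (hS : ∀ e ∈ B, e.1 ∉ S ∧ e.2 ∉ S) :
    ∃ Q : SetPartition (n + 1), red Q = S ∧ blackStrict Q = B := by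
  obtain ⟨Q, hQ, hQ'⟩ := exists_partition S B hlt h1 h2 hS
  have hr : red Q = S := hQ 0 h0
  refine ⟨Q, hr, ?_⟩
  ext e
  constructor
  · rintro ⟨he, hn⟩
    exact (hQ' e (hr ▸ hn)).1 he
  · intro he
    exact ⟨(hQ' e (hS e he).1).2 he, by rw [hr]; exact (hS e he).1⟩

theorem leftShift_exists (hK : 1 ≤ K) {P : SetPartition (n + 1)} (h : (coveredRed K P).Nonempty) :
    ∃ Q, LeftShift (K + 1) P Q := by
  obtain ⟨a, ha, hmin⟩ := WellFounded.has_min (wellFounded_lt (α := Fin (n + 1))) _ h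
  obtain ⟨i, j, hij⟩ := exists_isInnermost ha
  obtain ⟨O, hex, hold, hnew⟩ := shift_exchange hK ha.1 hij.1 hij.2.1
  have hi := isBlackCrossing_iff.1 hij.1
  -- Being under an arc, `a` is not the least node; so `0` stays in the red block.
  have h0 : (0 : Fin (n + 1)) ≠ a := by
    have := (hij.2.1 ⟨0, hK⟩).1
    exact ((Fin.zero_le _).trans_lt this).ne
  have hx : extend (append i a) K = a := by rw [extend_of_lt _ (by omega)]; exact append_last i a
  have hy : extend (prepend a j) 0 = a := extend_prepend_zero a j
  have hends : ∀ c ∈ ends (newArcs O (extend (append i a)) (extend (prepend a j)) K),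
      c ∉ red P \ {a} := by
    intro c hc
    rw [ends_newArcs hex, hx, hy, hold] at hc
    rw [Finset.mem_sdiff, Finset.mem_singleton]
    rcases hc with rfl | rfl | ⟨e, he, rfl | rfl⟩
    · exact fun h => h.2 rfl
    · exact fun h => h.2 rfl
    · exact fun h => he.2 h.1
    · exact fun h => blackStrict_snd_notMem_red he h.1
  have hlt : ∀ e ∈ newArcs O (extend (append i a)) (extend (prepend a j)) K, e.1 < e.2 := by
    intro e he
    rw [hnew] at he
    rcases he with he | ⟨s, rfl⟩
    · exact he.1.1.1
    · refine append_lt_prepend hK ?_ (strictMono_prepend hi.2.1 fun s => (hij.2.1 s).2) s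
      rw [append_eq_insertAt]
      exact strictMono_insertAt hi.1 fun s =>
        ⟨fun _ => (hij.2.1 s).1, fun h => by simp only [Fin.val_last] at h; omega⟩
  obtain ⟨Q, hQr, hQb⟩ := exists_partition_of_black (red P \ {a}) _
    (by rw [Finset.mem_sdiff, Finset.mem_singleton]; exact ⟨zero_mem_red P, h0⟩) hlt
    hex.inj_new.1 hex.inj_new.2
    (fun e he => ⟨hends _ ⟨e, he, Or.inl rfl⟩, hends _ ⟨e, he, Or.inr rfl⟩⟩)
  refine ⟨Q, a, i, j, ⟨ha, fun c hc => not_lt.1 (hmin c hc)⟩, hij, hQr, ?_⟩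
  refine blackArcs_eq_of (hQb.trans hnew) ?_ ?_
  · rintro e ⟨s, rfl⟩
    exact (hi.2.2.1 s).1.1
  · intro c
    rw [hQr, hQb, ends_newArcs hex, hold, hx, hy, Finset.mem_sdiff, Finset.mem_singleton]
    by_cases hca : c = a
    · subst hca
      exact iff_of_false (fun h => h.2 (Or.inl rfl)) (fun h => h.1 ha.1)
    · simp only [hca, not_false_eq_true, and_true, false_or]

theorem LeftShift.unique {P Q Q' : SetPartition (n + 1)} (h : LeftShift (K + 1) P Q)
    (h' : LeftShift (K + 1) P Q') : Q = Q' := by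
  obtain ⟨a, i, j, ha, hij, hr, hb⟩ := h
  obtain ⟨a', i', j', ha', hij', hr', hb'⟩ := h'
  obtain rfl := ha.unique ha'
  obtain ⟨rfl, rfl⟩ := hij.unique hij'
  refine eq_of_red_black (hr.trans hr'.symm) ?_
  have : blackArcs Q = blackArcs Q' := hb.trans hb'.symm
  ext e
  have hh : ∀ P : SetPartition (n + 1), e ∈ blackStrict P ↔ e ∈ blackArcs P ∧ e.1 < e.2 :=
    fun P => ⟨fun h => ⟨⟨h.1.2, h.2⟩, h.1.1⟩, fun h => ⟨⟨h.2, h.1.1⟩, h.1.2⟩⟩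
  rw [hh, hh, this]

/-- Enhanced crossings of `Q` entirely to the right of `a` are transported back to `P`, where the
invariant at `a` excludes them. Crossings whose left ends lie before `a` are transported without
losing this property, so nodes up to `a` covered in `Q` are already covered in `P`. Hence enhanced
crossings of `Q` have a right end up to `a`, while its covered red nodes lie beyond `a`. -/
theorem leftShift_forward (hK : 1 ≤ K) {P Q : SetPartition (n + 1)} (hP : ShiftInv K P)
    (h : LeftShift (K + 1) P Q) :
    ShiftInv K Q ∧ UndoShift (K + 1) Q P ∧ numBlocks Q = numBlocks P := by
  obtain ⟨a, i, j, ⟨ha, hmin⟩, hij, hr, hb⟩ := h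
  obtain ⟨O, hex, hold, hnew⟩ := shift_exchange hK ha.1 hij.1 hij.2.1
  have hi := isBlackCrossing_iff.1 hij.1
  have h0 : (0 : Fin (n + 1)) ≠ a := by
    have := (hij.2.1 ⟨0, hK⟩).1
    exact ((Fin.zero_le _).trans_lt this).ne
  have hxm : StrictMono (append i a) := by
    rw [append_eq_insertAt]
    exact strictMono_insertAt hi.1 fun s =>
      ⟨fun _ => (hij.2.1 s).1, fun h => by simp only [Fin.val_last] at h; omega⟩
  have hym : StrictMono (prepend a j) := strictMono_prepend hi.2.1 fun s => (hij.2.1 s).2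
  have hx : extend (append i a) K = a := by rw [extend_of_lt _ (by omega)]; exact append_last i a
  have hy : extend (prepend a j) 0 = a := extend_prepend_zero a j
  have hQ : blackStrict Q = newArcs O (extend (append i a)) (extend (prepend a j)) K := by
    rw [hnew]
    refine blackStrict_eq_of hb ?_
    rintro e ⟨s, rfl⟩
    exact append_lt_prepend hK hxm hym s
  have hno : ∀ D, IsXing (· ≤ ·) (blackStrict P) (K + 1) D → ∃ e ∈ D, e.2 ≤ a := fun D hD => by
    obtain ⟨e, he, hlt⟩ := hP.2 a ha D hD
    exact ⟨e, he, hlt.le⟩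
  obtain ⟨lab, hl, hR⟩ := hex.exists_labelling_of_lex_min (i := i) (j := j)
    (by rw [hold, hy]; exact hno)
    (fun s => ⟨by
      have := leftEnd_extend_insertAt (Fin.last K) a i s
      rw [← append_eq_insertAt] at this
      exact this.symm, (extend_prepend_succ a j s).symm⟩)
    (by
      intro i' j' hi' hj' hV
      rw [hold, hy] at hV
      -- With `r` equal to `≤`, an arc over `a` might start at `a`; black arcs do not, because `a`
      -- is red.
      have hu : Under i' j' a := fun s => ⟨lt_of_le_of_ne (hV s).2.1 fun he =>
        (hV s).1.2 (he ▸ ha.1), (hV s).2.2⟩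
      exact hij.2.2 i' j' (isBlackCrossing_iff.2 ⟨hi', hj', fun s => (hV s).1,
        fun s s' => (hu s).1.trans (hu s').2⟩) hu)
  rw [hold, hy] at hR
  -- no crossings to the right of `a`
  have hright : ∀ D, IsXing (· ≤ ·) (blackStrict Q) (K + 1) D → ∃ e ∈ D, e.2 ≤ a := by
    intro D hD
    by_contra hn
    push Not at hn
    rw [hQ] at hD
    obtain ⟨D', h1, h2, h3, h4, h5⟩ := hex.exists_old_of_new hl hD.1 hD.2.2.1
      (by rw [hy]; exact hn) hD.2.2.2
    rw [hold] at h3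
    rw [hy] at h4
    obtain ⟨e, he, hle⟩ := hno D' ⟨h1, h2.trans hD.2.1, h3, h5⟩
    exact absurd (h4 e he) hle.not_gt
  -- transfer of crossings to the left of `a`
  have hleft : ∀ m D c, c ≤ a → IsXing (· < ·) (blackStrict Q) m D → (∀ e ∈ D, e.1 < c) →
      ∃ D', IsXing (· < ·) (blackStrict P) m D' ∧ ∀ e ∈ D', e.1 < c ∧ (e ∈ D ∨ a < e.2) := by
    intro m D c hca hD hc
    rw [hQ] at hD
    obtain ⟨D', h1, h2, h3, h4, h5⟩ := hex.exists_old_of_new_left hl (by rw [hold, hy]; exact hR)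
      hD.1 hD.2.2.1
      -- As `t = K`, the arc to be avoided starts at `x K = a`, while all left ends in `D` lie
      -- before `c ≤ a`.
      (fun hmem => by
        have := hc _ hmem
        rw [hx] at this
        exact absurd this hca.not_gt)
      (fun e he _ => by rw [hy]; exact (hc e he).le.trans hca)
    rw [hold] at h3
    rw [hy] at h5
    have hfst : ∀ e ∈ D', e.1 < c := fun e he => by
      obtain ⟨f, hf, hle⟩ := h4 e he
      exact hle.trans_lt (hc f hf)
    refine ⟨D', ⟨h1, h2.trans hD.2.1, h3, fun e he f hf => ?_⟩, fun e he =>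
      ⟨hfst e he, (h5 e he).imp (fun h => h.1) (fun h => h.1)⟩⟩
    rcases h5 f hf with hf' | hf'
    · obtain ⟨g, hg, hle⟩ := h4 e he
      exact hle.trans_lt (hD.2.2.2 g hg f hf'.1)
    · exact (hfst e he).trans_le (hca.trans hf'.1.le)
  have hcov : ∀ c ∈ coveredRed K Q, a < c := by
    intro c hc
    rw [mem_coveredRed_iff] at hc
    obtain ⟨hcr, D, hD, hu⟩ := hc
    rw [hr, Finset.mem_sdiff, Finset.mem_singleton] at hcr
    by_contra hn
    obtain ⟨D', hD', hc'⟩ := hleft K D c (not_lt.1 hn) hD fun e he => (hu e he).1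
    refine hcr.2 (le_antisymm (not_lt.1 hn) (hmin ?_))
    refine mem_coveredRed_iff.2 ⟨hcr.1, D', hD', fun e he => ⟨(hc' e he).1, ?_⟩⟩
    rcases (hc' e he).2 with h' | h'
    · exact (hu e h').2
    · exact (not_lt.1 hn).trans_lt h'
  refine ⟨⟨?_, ?_⟩, ?_, ?_⟩
  · intro D hD
    obtain ⟨e, he, hle⟩ := hright D (hD.mono (fun _ _ h => h.le) Set.Subset.rfl)
    obtain ⟨D', hD', -⟩ := hleft (K + 1) D a le_rfl hD
      fun f hf => (hD.2.2.2 f hf e he).trans_le hle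
    exact hP.1 D' hD'
  · intro c hc D hD
    obtain ⟨e, he, hle⟩ := hright D hD
    exact ⟨e, he, hle.trans_lt (hcov c hc)⟩
  · have hat : IsBlackWeakCrossingAt Q a i j := by
      refine (isBlackWeakCrossingAt_iff hK).2 ⟨hxm, hym, fun s => ?_⟩
      rw [hQ, hnew]
      exact Or.inr ⟨s, rfl⟩
    refine ⟨a, i, j, ⟨⟨i, j, hat⟩, ?_⟩, hat, ?_, ?_, ?_⟩
    · rintro c ⟨i', j', h'⟩
      obtain ⟨D, hD, hc⟩ := weakCrossingAt_isXing hK h'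
      obtain ⟨e, he, hle⟩ := hright D hD
      exact (hc e he).trans hle
    · intro i' j' h'
      rw [isBlackWeakCrossingAt_iff hK] at h'
      -- Since `t = K`, the bound holds at every index: the new weak crossing is pointwise, hence
      -- lexicographically, greatest.
      have hle := hex.le_of_new hl h'.1 h'.2.1 (fun p => hQ ▸ h'.2.2 p)
        (fun p => by
          rw [hy]
          exact (h'.1.monotone (Fin.le_last p)).trans_eq (append_last i' a))
        hy.symm
      refine Pi.toLex_monotone fun s => ?_
      have := hle s.succ (by simp only [Fin.val_succ]; omega)
      rw [extend_val] at this
      exact this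
    · rw [hr]
      ext c
      simp only [Finset.mem_insert, Finset.mem_sdiff, Finset.mem_singleton]
      by_cases hca : c = a
      · subst hca
        simp only [true_or, iff_true]
        exact ha.1
      · simp only [hca, not_false_eq_true, and_true, false_or]
    · refine blackArcs_eq_of ?_ ?_ ?_
      · rw [hQ, ← hold, hex.oldArcs_eq, pairs_eq_leftEnd (Fin.last K) a a i j,
          append_eq_insertAt, pairs_insertAt_prepend]
        rfl
      · rintro e ⟨s, rfl⟩
        exact append_lt_prepend hK hxm hym s
      · intro c
        rw [hr, hQ, ends_newArcs hex, hold, hx, hy, Finset.mem_sdiff, Finset.mem_singleton]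
        by_cases hca : c = a
        · subst hca
          exact iff_of_false (fun h => h.1 ha.1) (fun h => h.2 (Or.inl rfl))
        · simp only [hca, not_false_eq_true, and_true, false_or]
  -- Before the shift `a ≠ 0` has a red predecessor, after it `a` is the right end of a black arc;
  -- no other node gains or loses its incoming arc.
  · refine numBlocks_congr fun c => ?_
    rw [exists_snd_iff, exists_snd_iff, hQ, snd_newArcs, hold, hy, hr, Finset.mem_sdiff,
      Finset.mem_singleton]
    by_cases hca : c = a
    · subst hca
      exact iff_of_true (Or.inr (Or.inl rfl)) (Or.inl ⟨ha.1, h0.symm⟩)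
    · simp only [hca, not_false_eq_true, and_true, false_or]

theorem undoShift_exists (hK : 1 ≤ K) {Q : SetPartition (n + 1)}
    (h : ∃ i j : Fin (K + 1) → Fin (n + 1), IsBlackWeakCrossing Q i j) :
    ∃ P, UndoShift (K + 1) Q P := by
  have hne : {c | ∃ i j : Fin K → Fin (n + 1), IsBlackWeakCrossingAt Q c i j}.Nonempty := by
    obtain ⟨i, j, hij⟩ := h
    have hij' := (isBlackWeakCrossing_iff hK).1 hij
    refine ⟨j 0, Fin.init (α := fun _ => Fin (n + 1)) i, Fin.tail (α := fun _ => Fin (n + 1)) j, ?_⟩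
    rw [IsBlackWeakCrossingAt, ← hij'.2.2.2, append, Fin.snoc_init_self, hij'.2.2.2, prepend,
      Fin.cons_self_tail]
    exact hij
  obtain ⟨a, ha, hmax⟩ := WellFounded.has_min (wellFounded_gt (α := Fin (n + 1))) _ hne
  obtain ⟨i₀, j₀, h₀⟩ := ha
  obtain ⟨p, hp, hpmax⟩ := Set.exists_max_image
    {p : (Fin K → Fin (n + 1)) × (Fin K → Fin (n + 1)) | IsBlackWeakCrossingAt Q a p.1 p.2}
    (fun p => toLex p.2) (Set.toFinite _) ⟨(i₀, j₀), h₀⟩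
  obtain ⟨i, j⟩ := p
  have hp : IsBlackWeakCrossingAt Q a i j := hp
  obtain ⟨O, hex, hnew, hold⟩ := undoShift_exchange hK hp
  have hat := (isBlackWeakCrossingAt_iff hK).1 hp
  have hx : extend (append i a) K = a := by rw [extend_of_lt _ (by omega)]; exact append_last i a
  have hy : extend (prepend a j) 0 = a := extend_prepend_zero a j
  have haQ : a ∉ red Q := by
    have := (hat.2.2 (Fin.last K)).2
    rwa [append_last] at this
  have hsub : ∀ c ∈ ends (oldArcs O (extend (append i a)) (extend (prepend a j)) K),
      c ∉ insert a (red Q) := by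
    rintro c ⟨e, he, hc⟩
    have h1 := hex.ne_old e he
    rw [hx, hy] at h1
    have h2 : c ∈ ends (blackStrict Q) := by
      rw [← hnew, ends_newArcs hex]
      exact Or.inr (Or.inr ⟨e, he, hc⟩)
    rw [Finset.mem_insert, not_or]
    refine ⟨?_, ?_⟩
    · rcases hc with rfl | rfl
      · exact h1.1
      · exact h1.2
    · obtain ⟨f, hf, rfl | rfl⟩ := h2
      · exact hf.2
      · exact blackStrict_snd_notMem_red hf
  have hlt : ∀ e ∈ oldArcs O (extend (append i a)) (extend (prepend a j)) K, e.1 < e.2 := by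
    intro e he
    rw [hold] at he
    rcases he with he | ⟨s, rfl⟩
    · exact he.1.1.1
    · have h1 := hat.1 (Fin.castSucc_lt_last s)
      have h2 := hat.2.1 (Fin.succ_pos s)
      rw [append_castSucc, append_last] at h1
      exact h1.trans h2
  obtain ⟨P, hPr, hPb⟩ := exists_partition_of_black (insert a (red Q)) _
    (Finset.mem_insert_of_mem (zero_mem_red Q)) hlt hex.inj_old.1 hex.inj_old.2
    (fun e he => ⟨hsub _ ⟨e, he, Or.inl rfl⟩, hsub _ ⟨e, he, Or.inr rfl⟩⟩)
  refine ⟨P, a, i, j, ⟨⟨i, j, hp⟩, fun c hc => not_lt.1 (hmax c hc)⟩, hp,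
    fun i' j' h' => hpmax (i', j') h', hPr, ?_⟩
  refine blackArcs_eq_of (hPb.trans hold) ?_ ?_
  · rintro e ⟨s, rfl⟩
    exact (hat.2.2 s).1.1
  · intro c
    rw [hPr, hPb, ← hnew, ends_newArcs hex, hx, hy, Finset.mem_insert]
    by_cases hca : c = a
    · subst hca
      exact iff_of_false (fun h => h.1 (Or.inl rfl)) (fun h => h.2 (Or.inl rfl))
    · simp only [hca, false_or]

theorem UndoShift.unique {Q P P' : SetPartition (n + 1)} (hK : 1 ≤ K) (h : UndoShift (K + 1) Q P)
    (h' : UndoShift (K + 1) Q P') : P = P' := by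
  obtain ⟨a, i, j, ha, hij, hmax, hr, hb⟩ := h
  obtain ⟨a', i', j', ha', hij', hmax', hr', hb'⟩ := h'
  obtain rfl := ha.unique ha'
  obtain rfl : j = j' := toLex.injective (le_antisymm (hmax' _ _ hij) (hmax _ _ hij'))
  have hi : i = i' := by
    funext s
    have h1 := ((isBlackWeakCrossingAt_iff hK).1 hij).2.2 s.castSucc
    have h2 := ((isBlackWeakCrossingAt_iff hK).1 hij').2.2 s.castSucc
    have := congrArg Prod.fst (strictArcs_inj_snd Q _ h1.1 _ h2.1 rfl)
    simpa only [append_castSucc] using this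
  subst hi
  refine eq_of_red_black (hr.trans hr'.symm) ?_
  have : blackArcs P = blackArcs P' := hb.trans hb'.symm
  ext e
  have hh : ∀ P : SetPartition (n + 1), e ∈ blackStrict P ↔ e ∈ blackArcs P ∧ e.1 < e.2 :=
    fun P => ⟨fun h => ⟨⟨h.1.2, h.2⟩, h.1.1⟩, fun h => ⟨⟨h.2, h.1.1⟩, h.1.2⟩⟩
  rw [hh, hh, this]

/-- As there is no black `(K + 1)`-crossing, each enhanced one is weak, with its first right end as
centre; maximality of `a` and of the chosen crossing then supplies the labelling. Transport runs
from old to new, opposite to the shift. -/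
theorem undoShift_backward (hK : 1 ≤ K) {P Q : SetPartition (n + 1)} (hQ : ShiftInv K Q)
    (h : UndoShift (K + 1) Q P) : ShiftInv K P ∧ LeftShift (K + 1) P Q := by
  obtain ⟨a, (i : Fin K → Fin (n + 1)), (j : Fin K → Fin (n + 1)), ha, hij, hlex, hr, hb⟩ := h
  obtain ⟨O, hex, hnew, hold⟩ := undoShift_exchange hK hij
  have hat := (isBlackWeakCrossingAt_iff hK).1 hij
  have hx : extend (append i a) K = a := by rw [extend_of_lt _ (by omega)]; exact append_last i a
  have hy : extend (prepend a j) 0 = a := extend_prepend_zero a j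
  have hu : Under i j a := fun s => by
    have h1 := hat.1 (Fin.castSucc_lt_last s)
    have h2 := hat.2.1 (Fin.succ_pos s)
    rw [append_castSucc, append_last] at h1
    exact ⟨h1, h2⟩
  have hP : blackStrict P = oldArcs O (extend (append i a)) (extend (prepend a j)) K := by
    rw [hold]
    refine blackStrict_eq_of hb ?_
    rintro e ⟨s, rfl⟩
    exact (hu s).1.trans (hu s).2
  have haQ : a ∉ red Q := by
    have := (hat.2.2 (Fin.last K)).2
    rwa [append_last] at this
  have haK : (a, extend (prepend a j) K) ∈ blackStrict Q := by
    have := hat.2.2 (Fin.last K)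
    rw [append_last] at this
    rw [extend_of_lt _ (by omega)]
    exact this
  have hno : ∀ D, IsXing (· ≤ ·) (blackStrict Q) (K + 1) D →
      ∃ i' j' : Fin (K + 1) → Fin (n + 1), (∀ s, (i' s, j' s) ∈ D) ∧ j' 0 ≤ a ∧
        i' (Fin.last K) = j' 0 := by
    intro D hD
    obtain ⟨i', j', hi', hj', hm, -, hA, hr'⟩ := hD.exists_fun
    obtain ⟨i'', j'', h1, h2, h3⟩ := exists_weakCrossingAt hK hQ.1 hi' hj' hA hr'
    refine ⟨i', j', hm, ha.2 ⟨i'', j'', h1⟩, ?_⟩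
    rw [h2, append_last]
  have hB1 : ∀ D, IsXing (· ≤ ·) (blackStrict Q) (K + 1) D → ∃ e ∈ D, e.2 ≤ a := fun D hD => by
    obtain ⟨i', j', hm, hle, -⟩ := hno D hD
    exact ⟨_, hm 0, hle⟩
  -- A weak crossing with centre `a` contains the arc leaving `a`, which is `(x K, y K)`; without
  -- this arc the centre lies strictly before `a`.
  have hB2 : ∀ D, IsXing (· ≤ ·) (blackStrict Q) (K + 1) D →
      (a, extend (prepend a j) K) ∉ D → ∃ e ∈ D, e.2 < a := fun D hD hD' => by
    obtain ⟨i', j', hm, hle, heq⟩ := hno D hD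
    rcases hle.eq_or_lt with hle | hlt
    · refine absurd ?_ hD'
      have h1 := hm (Fin.last K)
      have h2 := strictArcs_inj_fst Q _ (hD.2.2.1 h1).1 _ haK.1 (heq.trans hle)
      exact h2 ▸ h1
    · exact ⟨_, hm 0, hlt⟩
  obtain ⟨lab, hl⟩ := hex.exists_labelling_of_lex_max (Y := prepend a j)
    (by rw [hnew, hy]; exact hB1) (by rw [hnew, hy, hx]; exact hB2)
    (fun s => (extend_val _ s).symm)
    (by
      rw [hnew, hx]
      rintro i' j' hi' hj' hA hr' ⟨s, hs⟩
      rw [Prod.mk.injEq] at hs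
      obtain ⟨i'', j'', h1, h2, h3⟩ := exists_weakCrossingAt hK hQ.1 hi' hj' hA hr'
      have h4 : j' 0 = a := by
        refine le_antisymm (ha.2 ⟨_, _, h1⟩) ?_
        have := hi'.monotone (Fin.le_last s)
        rw [← hs.1, h2, append_last] at this
        exact this
      rw [h4] at h1 h3
      rw [h3]
      exact toLex_prepend_le (hlex _ _ h1))
  have hright : ∀ D, IsXing (· ≤ ·) (blackStrict P) (K + 1) D → ∃ e ∈ D, e.2 ≤ a := by
    intro D hD
    by_contra hn
    push Not at hn
    rw [hP] at hD
    obtain ⟨D', h1, h2, h3, h4, h5⟩ := hex.exists_new_of_old hl hD.1 hD.2.2.1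
      (by rw [hy]; exact hn) hD.2.2.2
    rw [hnew] at h3
    rw [hy] at h4
    obtain ⟨e, he, hle⟩ := hB1 D' ⟨h1, h2.trans hD.2.1, h3, h5⟩
    exact absurd (h4 e he) hle.not_gt
  have hleft : ∀ m D c, c ≤ a → IsXing (· < ·) (blackStrict P) m D → (∀ e ∈ D, e.1 < c) →
      ∃ D', IsXing (· < ·) (blackStrict Q) m D' ∧ ∀ e ∈ D', e.1 < c ∧ (e ∈ D ∨ a ≤ e.2) := by
    intro m D c hca hD hc
    rw [hP] at hD
    obtain ⟨D', h1, h2, h3, -, h4, h5⟩ := hex.exists_new_of_old_left hl hD.1 hD.2.2.1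
      (fun e he _ => by rw [hy]; exact (hc e he).le.trans hca)
    rw [hnew] at h3
    rw [hy] at h5
    have hfst : ∀ e ∈ D', e.1 < c := fun e he => by
      obtain ⟨f, hf, hle⟩ := h4 e he
      exact hle.trans_lt (hc f hf)
    refine ⟨D', ⟨h1, h2.trans hD.2.1, h3, fun e he f hf => ?_⟩, fun e he =>
      ⟨hfst e he, (h5 e he).imp (fun h => h.1) (fun h => h.1)⟩⟩
    rcases h5 f hf with hf' | hf'
    · obtain ⟨g, hg, hle⟩ := h4 e he
      exact hle.trans_lt (hD.2.2.2 g hg f hf'.1)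
    · exact (hfst e he).trans_le (hca.trans hf'.1)
  have hcov : ∀ c ∈ coveredRed K P, a ≤ c := by
    intro c hc
    rw [mem_coveredRed_iff] at hc
    obtain ⟨hcr, D, hD, hcu⟩ := hc
    by_contra hn
    have hca := not_le.1 hn
    rw [hr, Finset.mem_insert] at hcr
    have hcQ : c ∈ red Q := hcr.resolve_left hca.ne
    obtain ⟨D', hD', hc'⟩ := hleft K D c hca.le hD fun e he => (hcu e he).1
    -- All right ends of the chosen weak crossing are at least `a`, whereas the invariant of `Q`
    -- would require one to the left of the covered node `c < a`.
    obtain ⟨E, hE, hEa⟩ := weakCrossingAt_isXing hK hij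
    obtain ⟨e, he, hlt⟩ := hQ.2 c (mem_coveredRed_iff.2 ⟨hcQ, D', hD', fun e he =>
      ⟨(hc' e he).1, by
        rcases (hc' e he).2 with h' | h'
        · exact (hcu e h').2
        · exact hca.trans_le h'⟩⟩) E hE
    exact absurd (hEa e he) (hlt.trans hca).not_ge
  have hblack : IsBlackCrossing P i j := by
    refine isBlackCrossing_iff.2 ⟨?_, ?_, ?_, fun s s' => (hu s).1.trans (hu s').2⟩
    · intro s s' hs
      have := hat.1 (Fin.castSucc_lt_castSucc_iff.2 hs)
      simpa only [append_castSucc] using this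
    · intro s s' hs
      exact hat.2.1 (Fin.succ_lt_succ_iff.2 hs)
    · intro s
      rw [hP, hold]
      exact Or.inr ⟨s, rfl⟩
  refine ⟨⟨?_, ?_⟩, a, i, j, ⟨⟨?_, i, j, hblack, hu⟩, hcov⟩, ⟨hblack, hu, ?_⟩, ?_, ?_⟩
  · intro D hD
    obtain ⟨e, he, hle⟩ := hright D (hD.mono (fun _ _ h => h.le) Set.Subset.rfl)
    obtain ⟨D', hD', -⟩ := hleft (K + 1) D a le_rfl hD
      fun f hf => (hD.2.2.2 f hf e he).trans_le hle
    exact hQ.1 D' hD'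
  · intro c hc D hD
    obtain ⟨e, he, hle⟩ := hright D hD
    -- No old arc ends at `y 0 = a`, which makes the inequality strict.
    refine ⟨e, he, (lt_of_le_of_ne hle ?_).trans_le (hcov c hc)⟩
    rw [← hy]
    exact (hex.ne_old e (hP ▸ hD.2.2.1 he)).2
  · rw [hr]
    exact Finset.mem_insert_self _ _
  · intro i' j' h1 h2
    by_contra hn
    have hle := (not_le.1 hn).le
    have h1' := isBlackCrossing_iff.1 h1
    -- A lexicographically smaller crossing over `a` would agree with `j` at every index, again
    -- because `t = K`; so `(i, j)` is innermost.
    have key := hex.eq_of_old_of_lex_le hl (i := i') (j := j') (by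
        rw [hnew, hx, hy]
        intro F hF hFc hFcard hFn hall
        obtain ⟨e, he, hlt⟩ := hB2 F ⟨hFc, hFcard, hF, fun e he f hf =>
          (hall e he).2.trans (hall f hf).1⟩ hFn
        exact absurd (hall e he).1 hlt.not_ge) h1'.1 h1'.2.1
      (by
        rw [← hP, hy]
        exact fun s => ⟨h1'.2.2.1 s, (h2 s).1.le, (h2 s).2⟩)
      (by
        intro p hp
        rw [extend_prepend_succ]
        exact le_of_toLex_le hle p fun q hq => by
          have := hp q hq
          rwa [extend_prepend_succ] at this)
    have : j' = j := funext fun p => by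
      have := key p p.2
      rwa [extend_prepend_succ] at this
    rw [this] at hn
    exact hn le_rfl
  · rw [hr]
    ext c
    simp only [Finset.mem_insert, Finset.mem_sdiff, Finset.mem_singleton]
    by_cases hca : c = a
    · subst hca
      simp only [not_true_eq_false, and_false, iff_false]
      exact haQ
    · simp only [hca, not_false_eq_true, and_true, false_or]
  · refine blackArcs_eq_of ?_ ?_ ?_
    · rw [hP, ← hnew, hex.newArcs_eq, pairs_eq_leftEnd (Fin.last K) a a i j,
        append_eq_insertAt, pairs_insertAt_prepend]
      rfl
    · rintro e ⟨s, rfl⟩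
      exact (hu s).1.trans (hu s).2
    · intro c
      rw [hr, hP, ← hnew, ends_newArcs hex, hx, hy, Finset.mem_insert]
      by_cases hca : c = a
      · subst hca
        exact iff_of_false (fun h => h.2 (Or.inl rfl)) (fun h => h.1 (Or.inl rfl))
      · simp only [hca, false_or]

end Shift

/-! ### The invariant of the rotation phase, and undoing a rotation. -/

section Rotation

variable {n K : ℕ}

theorem lt_mono (u v u' v' : Fin n) (h : u < v) (hu : u' ≤ u) (hv : v ≤ v') : u' < v' :=
  hu.trans_lt (h.trans_le hv)

theorem mem_strictArcs_iff_arcs {P : SetPartition n} {e : Fin n × Fin n} :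
    e ∈ strictArcs P ↔ e ∈ arcs P ∧ e.1 < e.2 := and_comm

theorem eq_of_arcs_eq {P Q : SetPartition n} (h : arcs P = arcs Q) : P = Q :=
  eq_of_strictArcs_eq (by ext e; rw [mem_strictArcs_iff_arcs, mem_strictArcs_iff_arcs, h])

theorem strictArcs_eq_of {P Q : SetPartition n} {X Y : Set (Fin n × Fin n)}
    (h : arcs P = (arcs Q \ X) ∪ Y) (hY : ∀ e ∈ Y, e.1 < e.2) :
    strictArcs P = (strictArcs Q \ X) ∪ Y := by
  ext e
  rw [mem_strictArcs_iff_arcs, h]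
  constructor
  · rintro ⟨⟨h1, h2⟩ | h1, h3⟩
    · exact Or.inl ⟨mem_strictArcs_iff_arcs.2 ⟨h1, h3⟩, h2⟩
    · exact Or.inr h1
  · rintro (⟨h1, h2⟩ | h1)
    · exact ⟨Or.inl ⟨h1.2, h2⟩, h1.1⟩
    · exact ⟨Or.inr h1, hY e h1⟩

theorem arcs_eq_of {P Q : SetPartition n} {X Y : Set (Fin n × Fin n)}
    (h : strictArcs P = (strictArcs Q \ X) ∪ Y) (hX : ∀ e ∈ X, e.1 < e.2)
    (hends : ∀ i, i ∈ ends (strictArcs P) ↔ i ∈ ends (strictArcs Q)) :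
    arcs P = (arcs Q \ X) ∪ Y := by
  ext e
  change IsArc P e.1 e.2 ↔ (IsArc Q e.1 e.2 ∧ e ∉ X) ∨ e ∈ Y
  rw [isArc_iff, isArc_iff, hends, h]
  constructor
  · rintro ((h' | h') | ⟨h1, h2⟩)
    · exact Or.inl ⟨Or.inl h'.1, h'.2⟩
    · exact Or.inr h'
    · exact Or.inl ⟨Or.inr ⟨h1, h2⟩, fun h' => absurd h1 (hX e h').ne⟩
  · rintro (⟨h1 | h1, h2⟩ | h')
    · exact Or.inl (Or.inl ⟨h1, h2⟩)
    · exact Or.inr h1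
    · exact Or.inl (Or.inr h')

theorem exists_partition_of_arcs (B : Set (Fin n × Fin n)) (hlt : ∀ e ∈ B, e.1 < e.2)
    (h1 : ∀ f ∈ B, ∀ g ∈ B, f.1 = g.1 → f = g) (h2 : ∀ f ∈ B, ∀ g ∈ B, f.2 = g.2 → f = g) :
    ∃ Q : SetPartition n, strictArcs Q = B := by
  obtain ⟨Q, -, hQ⟩ := exists_partition ∅ B hlt h1 h2
    (fun e _ => ⟨Finset.notMem_empty _, Finset.notMem_empty _⟩)
  exact ⟨Q, Set.ext fun e => hQ e (Finset.notMem_empty _)⟩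

theorem IsExchange.eq_old_sdiff {r : Fin n → Fin n → Prop} {O : Set (Fin n × Fin n)}
    {x y : ℕ → Fin n} {t : ℕ} (h : IsExchange r O x y t K) :
    O = oldArcs O x y t \ {e | ∃ s, 1 ≤ s ∧ s ≤ t ∧ e = (x (s - 1), y s)} := by
  ext e
  constructor
  · refine fun he => ⟨Or.inl he, ?_⟩
    rintro ⟨s, -, hs, rfl⟩
    exact h.ne_y _ he s hs rfl
  · rintro ⟨he | he, he'⟩
    · exact he
    · exact absurd he he'

theorem IsExchange.eq_new_sdiff {r : Fin n → Fin n → Prop} {O : Set (Fin n × Fin n)}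
    {x y : ℕ → Fin n} {t : ℕ} (h : IsExchange r O x y t K) :
    O = newArcs O x y t \ {e | ∃ s, s ≤ t ∧ e = (x s, y s)} := by
  ext e
  constructor
  · refine fun he => ⟨Or.inl he, ?_⟩
    rintro ⟨s, hs, rfl⟩
    exact h.ne_y _ he s hs rfl
  · rintro ⟨he | he, he'⟩
    · exact he
    · exact absurd he he'

/-- Indices beyond `t` play no role in an exchange. The inverse operation may select a crossing with
a different tail, and this makes the difference harmless. -/
theorem IsExchange.newArcs_congr {r : Fin n → Fin n → Prop} {O O' : Set (Fin n × Fin n)}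
    {x y x' y' : ℕ → Fin n} {t : ℕ} (h : IsExchange r O x y t K) (h' : IsExchange r O' x' y' t K)
    (hx : ∀ s ≤ t, x s = x' s) (hy : ∀ s ≤ t, y s = y' s)
    (hold : oldArcs O x y t = oldArcs O' x' y' t) : newArcs O x y t = newArcs O' x' y' t := by
  have hO : O = O' := by
    rw [h.eq_old_sdiff, h'.eq_old_sdiff, hold]
    congr 1
    ext e
    constructor
    · rintro ⟨s, h1, hs, rfl⟩
      exact ⟨s, h1, hs, by rw [hx _ (by omega), hy s hs]⟩
    · rintro ⟨s, h1, hs, rfl⟩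
      exact ⟨s, h1, hs, by rw [hx _ (by omega), hy s hs]⟩
  subst hO
  refine congrArg _ (Set.ext fun e => ?_)
  constructor
  · rintro ⟨s, hs, rfl⟩
    exact ⟨s, hs, by rw [hx s hs, hy s hs]⟩
  · rintro ⟨s, hs, rfl⟩
    exact ⟨s, hs, by rw [hx s hs, hy s hs]⟩

theorem IsExchange.oldArcs_congr {r : Fin n → Fin n → Prop} {O O' : Set (Fin n × Fin n)}
    {x y x' y' : ℕ → Fin n} {t : ℕ} (h : IsExchange r O x y t K) (h' : IsExchange r O' x' y' t K)
    (hx : ∀ s ≤ t, x s = x' s) (hy : ∀ s ≤ t, y s = y' s)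
    (hnew : newArcs O x y t = newArcs O' x' y' t) : oldArcs O x y t = oldArcs O' x' y' t := by
  have hO : O = O' := by
    rw [h.eq_new_sdiff, h'.eq_new_sdiff, hnew]
    congr 1
    ext e
    constructor
    · rintro ⟨s, hs, rfl⟩
      exact ⟨s, hs, by rw [hx s hs, hy s hs]⟩
    · rintro ⟨s, hs, rfl⟩
      exact ⟨s, hs, by rw [hx s hs, hy s hs]⟩
  subst hO
  refine congrArg _ (Set.ext fun e => ?_)
  constructor
  · rintro ⟨s, h1, hs, rfl⟩
    exact ⟨s, h1, hs, by rw [hx _ (by omega), hy s hs]⟩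
  · rintro ⟨s, h1, hs, rfl⟩
    exact ⟨s, h1, hs, by rw [hx _ (by omega), hy s hs]⟩

/-- The partitions that occur while performing cyclic rotations. -/
def RotInv (K : ℕ) (P : SetPartition (n + 1)) : Prop :=
  (∀ D, ¬ IsXing (· < ·) (blackStrict P) (K + 1) D) ∧
    ∀ c ∈ coveredRed K P, ∀ D, IsXing (· < ·) (strictArcs P) (K + 1) D → ∃ e ∈ D, e.2 < c

/-- A red arc has no red node in its interior, so an arc over a red node is black. -/
theorem mem_blackStrict_of_over {P : SetPartition (n + 1)} {e : Fin (n + 1) × Fin (n + 1)}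
    {c : Fin (n + 1)} (he : e ∈ strictArcs P) (hc : c ∈ red P) (h1 : e.1 < c) (h2 : c < e.2) :
    e ∈ blackStrict P :=
  ⟨he, fun h => (le_or_le_of_red_arc he h hc).elim h1.not_ge h2.not_ge⟩

/-- The exchange performed when undoing a cyclic rotation. -/
theorem undoRotation_exchange {P : SetPartition (n + 1)} {a b : Fin (n + 1)}
    {i j : Fin K → Fin (n + 1)} {T : Fin (K + 1)} (hba : (b, a) ∈ strictArcs P)
    (hij : IsBlackCrossing P i j) (hu : Under i j a) (hT : 1 ≤ (T : ℕ))
    (hb : ∀ s : Fin K, ((s : ℕ) < T → i s < b) ∧ ((T : ℕ) ≤ s → b < i s)) :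
    ∃ O, IsExchange (· < ·) O (extend (insertAt T b i)) (extend (prepend a j)) T K ∧
      oldArcs O (extend (insertAt T b i)) (extend (prepend a j)) T = strictArcs P \ {(b, a)} ∧
      newArcs O (extend (insertAt T b i)) (extend (prepend a j)) T =
        (strictArcs P \ (pairs i j ∪ {(b, a)})) ∪ pairs (insertAt T b i) (prepend a j) := by
  rw [isBlackCrossing_iff] at hij
  obtain ⟨O, h1, h2, h3⟩ := exists_isExchange_of_old (T := T) (a := a) (b := b) (r := (· < ·))
    (A := strictArcs P \ {(b, a)}) lt_mono
    (fun f hf g hg => strictArcs_inj_fst P f hf.1 g hg.1)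
    (fun f hf g hg => strictArcs_inj_snd P f hf.1 g hg.1) hij.1 hij.2.1
    (fun s => ⟨(hij.2.2.1 s).1, fun h => (hu s).2.ne' (congrArg Prod.snd h)⟩) hT hb
    (fun s => (hu s).2) (fun s => (hu s).1) hba.1
    (fun e he h => he.2 (strictArcs_inj_fst P e he.1 _ hba h))
    (fun e he h => he.2 (strictArcs_inj_snd P e he.1 _ hba h))
  refine ⟨O, h1, h2, h3.trans ?_⟩
  rw [Set.sdiff_sdiff, Set.union_comm {(b, a)}]

theorem exists_insertAt_prepend (i j : Fin (K + 1) → Fin n) (p : Fin (K + 1)) :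
    ∃ i₀ j₀ : Fin K → Fin n, i = insertAt p (i p) i₀ ∧ j = prepend (j 0) j₀ :=
  ⟨Fin.removeNth (α := fun _ => Fin n) p i, Fin.tail (α := fun _ => Fin n) j,
    (Fin.insertNth_self_removeNth (α := fun _ => Fin n) p i).symm,
    (Fin.cons_self_tail (α := fun _ => Fin n) j).symm⟩

theorem insertAt_self (T : Fin (K + 1)) (b : Fin n) (i : Fin K → Fin n) : insertAt T b i T = b :=
  Fin.insertNth_apply_same (α := fun _ => Fin n) T b i

theorem insertAt_succAbove (T : Fin (K + 1)) (b : Fin n) (i : Fin K → Fin n) (s : Fin K) :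
    insertAt T b i (T.succAbove s) = i s :=
  Fin.insertNth_apply_succAbove (α := fun _ => Fin n) T b i s

/-- The exchange undone by a cyclic rotation. -/
theorem rotation_exchange {Q : SetPartition (n + 1)} {a b : Fin (n + 1)}
    {i j : Fin K → Fin (n + 1)} {T : Fin (K + 1)}
    (hij : IsCrossing Q (insertAt T b i) (prepend a j)) (hT : 1 ≤ (T : ℕ)) :
    ∃ O, IsExchange (· < ·) O (extend (insertAt T b i)) (extend (prepend a j)) T K ∧
      newArcs O (extend (insertAt T b i)) (extend (prepend a j)) T = strictArcs Q ∧
      oldArcs O (extend (insertAt T b i)) (extend (prepend a j)) T ∪ {(b, a)} =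
        (strictArcs Q \ pairs (insertAt T b i) (prepend a j)) ∪
          pairs (insertAt T b i) (fun s => prepend a j (T.cycleRange s)) := by
  rw [isCrossing_iff] at hij
  obtain ⟨O, h1, h2, h3⟩ := exists_isExchange_of_new (T := T) (a := a) (b := b) (r := (· < ·))
    (i := i) (j := j) (A := strictArcs Q) lt_mono (strictArcs_inj_fst Q) (strictArcs_inj_snd Q) hT
    hij.1 hij.2.1 hij.2.2.1 (fun s => hij.2.2.2 s 0)
  refine ⟨O, h1, h2, ?_⟩
  rw [h3, pairs_cycleRange, Set.union_assoc]

theorem lt_of_crossing_insertAt {Q : SetPartition (n + 1)} {a b : Fin (n + 1)}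
    {i j : Fin K → Fin (n + 1)} {T : Fin (K + 1)}
    (hij : IsCrossing Q (insertAt T b i) (prepend a j)) :
    b < a ∧ Under i j a := by
  rw [isCrossing_iff] at hij
  have h1 := hij.2.2.2 T 0
  rw [insertAt_self] at h1
  refine ⟨h1, fun s => ⟨?_, hij.2.1 (Fin.succ_pos s)⟩⟩
  have := hij.2.2.2 (T.succAbove s) 0
  rwa [insertAt_succAbove] at this

theorem exists_cut {i : Fin K → Fin n} (hi : StrictMono i) {b : Fin n} (hb : ∀ s, i s ≠ b) :
    ∃ T : Fin (K + 1), ∀ s : Fin K, ((s : ℕ) < T → i s < b) ∧ ((T : ℕ) ≤ s → b < i s) := by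
  have hex : ∃ m : ℕ, ∀ s : Fin K, m ≤ s → b < i s :=
    ⟨K, fun s hs => absurd s.2 (not_lt.2 hs)⟩
  classical
  refine ⟨⟨Nat.find hex, Nat.lt_succ_of_le (Nat.find_min' hex fun s hs =>
    absurd s.2 (not_lt.2 hs))⟩, fun s => ⟨fun hs => ?_, fun hs => Nat.find_spec hex s hs⟩⟩
  have := Nat.find_min hex hs
  push Not at this
  obtain ⟨s', h1, h2⟩ := this
  exact lt_of_le_of_ne ((hi.monotone (Fin.le_def.2 h1)).trans h2) (hb s)

/-- The data of undoing a cyclic rotation. -/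
structure UndoRotationData (K : ℕ) (P : SetPartition (n + 1)) (a b : Fin (n + 1))
    (i j : Fin K → Fin (n + 1)) (T : Fin (K + 1)) : Prop where
  least : IsLeast (coveredRed K P) a
  greatest : IsGreatest {c | c ∈ red P ∧ c < a} b
  innermost : IsInnermost P a i j
  one_le : 1 ≤ (T : ℕ)
  lt : (T : ℕ) < K
  cut : ∀ s : Fin K, ((s : ℕ) < T → i s < b) ∧ ((T : ℕ) ≤ s → b < i s)

theorem undoRotation_iff {P Q : SetPartition (n + 1)} : UndoRotation (K + 1) P Q ↔
    ∃ a b i j T, UndoRotationData K P a b i j T ∧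
      arcs Q = (arcs P \ (pairs i j ∪ {(b, a)})) ∪ pairs (insertAt T b i) (prepend a j) := by
  constructor
  · rintro ⟨a, b, i, j, T, h1, h2, h3, h4, h5, h6, h7⟩
    exact ⟨a, b, i, j, T, ⟨h1, h2, h3, h4, h5, h6⟩, h7⟩
  · rintro ⟨a, b, i, j, T, ⟨h1, h2, h3, h4, h5, h6⟩, h7⟩
    exact ⟨a, b, i, j, T, h1, h2, h3, h4, h5, h6, h7⟩

namespace UndoRotationData

variable {P : SetPartition (n + 1)} {a b : Fin (n + 1)} {i j : Fin K → Fin (n + 1)}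
  {T : Fin (K + 1)}

theorem arc (h : UndoRotationData K P a b i j T) : (b, a) ∈ strictArcs P :=
  mem_strictArcs.2 ⟨h.greatest.1.2, mem_part_of_mem_red h.greatest.1.1 h.least.1.1,
    fun l hl hlt => (h.greatest.2 ⟨by rwa [part_eq_red h.greatest.1.1] at hl, hlt.2⟩).not_gt hlt.1⟩

theorem exchange (h : UndoRotationData K P a b i j T) :
    ∃ O, IsExchange (· < ·) O (extend (insertAt T b i)) (extend (prepend a j)) T K ∧
      oldArcs O (extend (insertAt T b i)) (extend (prepend a j)) T = strictArcs P \ {(b, a)} ∧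
      newArcs O (extend (insertAt T b i)) (extend (prepend a j)) T =
        (strictArcs P \ (pairs i j ∪ {(b, a)})) ∪ pairs (insertAt T b i) (prepend a j) :=
  undoRotation_exchange h.arc h.innermost.1 h.innermost.2.1 h.one_le h.cut

theorem strictMono_left (h : UndoRotationData K P a b i j T) : StrictMono (insertAt T b i) :=
  strictMono_insertAt (isBlackCrossing_iff.1 h.innermost.1).1 h.cut

theorem strictMono_right (h : UndoRotationData K P a b i j T) : StrictMono (prepend a j) :=
  strictMono_prepend (isBlackCrossing_iff.1 h.innermost.1).2.1 fun s => (h.innermost.2.1 s).2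

theorem left_lt (h : UndoRotationData K P a b i j T) (s : Fin (K + 1)) :
    insertAt T b i s < a := by
  refine Fin.succAboveCases T ?_ (fun s => ?_) s
  · rw [insertAt_self]
    exact h.arc.1
  · rw [insertAt_succAbove]
    exact (h.innermost.2.1 s).1

theorem left_lt_right (h : UndoRotationData K P a b i j T) (s s' : Fin (K + 1)) :
    insertAt T b i s < prepend a j s' :=
  (h.left_lt s).trans_le (h.strictMono_right.monotone (Fin.zero_le s'))

theorem ends_eq (h : UndoRotationData K P a b i j T) {O : Set (Fin (n + 1) × Fin (n + 1))}
    (hex : IsExchange (· < ·) O (extend (insertAt T b i)) (extend (prepend a j)) T K)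
    (hold : oldArcs O (extend (insertAt T b i)) (extend (prepend a j)) T =
      strictArcs P \ {(b, a)}) (c : Fin (n + 1)) :
    c ∈ ends (newArcs O (extend (insertAt T b i)) (extend (prepend a j)) T) ↔
      c ∈ ends (strictArcs P) := by
  rw [ends_newArcs hex, extend_insertAt_self, extend_prepend_zero, hold]
  constructor
  · rintro (rfl | rfl | ⟨e, he, hc⟩)
    · exact ⟨_, h.arc, Or.inl rfl⟩
    · exact ⟨_, h.arc, Or.inr rfl⟩
    · exact ⟨e, he.1, hc⟩
  · rintro ⟨e, he, hc⟩
    by_cases hba : e = (b, a)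
    · subst hba
      exact hc.imp Eq.symm fun h => Or.inl h.symm
    · exact Or.inr (Or.inr ⟨e, ⟨he, hba⟩, hc⟩)

end UndoRotationData

/-- If `b` came before all left ends, `(b, a)` and the innermost crossing would form a `(K +
1)`-crossing with all right ends at least `a`, against the invariant. If `b` came after all of them,
it would be covered, against the minimality of `a`. -/
theorem exists_undoRotationData (hK : 1 ≤ K) {P : SetPartition (n + 1)} (hP : RotInv K P)
    (h : (coveredRed K P).Nonempty) : ∃ a b i j T, UndoRotationData K P a b i j T := by
  obtain ⟨a, ha, hmin⟩ := WellFounded.has_min (wellFounded_lt (α := Fin (n + 1))) _ h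
  obtain ⟨i, j, hij⟩ := exists_isInnermost ha
  have h0 : 0 < a := (Fin.zero_le _).trans_lt (hij.2.1 ⟨0, hK⟩).1
  obtain ⟨b, hb, hbmax⟩ := WellFounded.has_min (wellFounded_gt (α := Fin (n + 1)))
    {c | c ∈ red P ∧ c < a} ⟨0, zero_mem_red P, h0⟩
  have hi := isBlackCrossing_iff.1 hij.1
  obtain ⟨T, hT⟩ := exists_cut hi.1 (b := b) fun s h => (hi.2.2.1 s).2 (by
    change i s ∈ red P
    rw [h]
    exact hb.1)
  have hbg : IsGreatest {c | c ∈ red P ∧ c < a} b := ⟨hb, fun c hc => not_lt.1 (hbmax c hc)⟩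
  have harc : (b, a) ∈ strictArcs P :=
    mem_strictArcs.2 ⟨hb.2, mem_part_of_mem_red hb.1 ha.1,
      fun l hl hlt => hbmax l ⟨by rwa [part_eq_red hb.1] at hl, hlt.2⟩ hlt.1⟩
  refine ⟨a, b, i, j, T, ⟨ha, fun c hc => not_lt.1 (hmin c hc)⟩, hbg, hij, ?_, ?_, hT⟩
  · by_contra hn
    have hT0 : T = 0 := Fin.ext (by simp only [Fin.val_zero]; omega)
    subst hT0
    obtain ⟨e, he, hlt⟩ := hP.2 a ha _ (isXing_of_fun (i := prepend b i) (j := prepend a j)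
      (strictMono_prepend hi.1 fun s => (hT s).2 (Nat.zero_le _))
      (strictMono_prepend hi.2.1 fun s => (hij.2.1 s).2) (fun s => by
        refine Fin.cases ?_ (fun s => ?_) s
        · exact harc
        · exact (hi.2.2.1 s).1) (fun s s' => by
        refine Fin.cases ?_ (fun s => ?_) s
        · exact hb.2.trans_le ((strictMono_prepend hi.2.1 fun s => (hij.2.1 s).2).monotone
            (Fin.zero_le s'))
        · exact (hij.2.1 s).1.trans_le ((strictMono_prepend hi.2.1
            fun s => (hij.2.1 s).2).monotone (Fin.zero_le s'))))
    obtain ⟨s, -, rfl⟩ := Finset.mem_image.1 he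
    exact hlt.not_ge ((strictMono_prepend hi.2.1 fun s => (hij.2.1 s).2).monotone (Fin.zero_le s))
  · by_contra hn
    refine hmin b ⟨hb.1, i, j, hij.1, fun s => ⟨(hT s).1 (by omega), hb.2.trans (hij.2.1 s).2⟩⟩ hb.2

theorem undoRotation_exists (hK : 1 ≤ K) {P : SetPartition (n + 1)} (hP : RotInv K P)
    (h : (coveredRed K P).Nonempty) : ∃ Q, UndoRotation (K + 1) P Q := by
  obtain ⟨a, b, i, j, T, hd⟩ := exists_undoRotationData hK hP h
  obtain ⟨O, hex, hold, hnew⟩ := hd.exchange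
  have hlt : ∀ e ∈ newArcs O (extend (insertAt T b i)) (extend (prepend a j)) T, e.1 < e.2 := by
    intro e he
    rw [hnew] at he
    rcases he with he | ⟨s, rfl⟩
    · exact he.1.1
    · exact hd.left_lt_right s s
  obtain ⟨Q, hQ⟩ := exists_partition_of_arcs _ hlt hex.inj_new.1 hex.inj_new.2
  refine ⟨Q, undoRotation_iff.2 ⟨a, b, i, j, T, hd, arcs_eq_of (hQ.trans hnew) ?_ fun c => ?_⟩⟩
  · rintro e (⟨s, rfl⟩ | rfl)
    · exact ((isBlackCrossing_iff.1 hd.innermost.1).2.2.1 s).1.1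
    · exact hd.arc.1
  · rw [hQ, hd.ends_eq hex hold]

theorem UndoRotation.unique {P Q Q' : SetPartition (n + 1)} (h : UndoRotation (K + 1) P Q)
    (h' : UndoRotation (K + 1) P Q') : Q = Q' := by
  obtain ⟨a, b, i, j, T, hd, hQ⟩ := undoRotation_iff.1 h
  obtain ⟨a', b', i', j', T', hd', hQ'⟩ := undoRotation_iff.1 h'
  obtain rfl := hd.least.unique hd'.least
  obtain rfl := hd.greatest.unique hd'.greatest
  obtain ⟨rfl, rfl⟩ := hd.innermost.unique hd'.innermost
  have hle : ∀ T T', UndoRotationData K P a b i j T → UndoRotationData K P a b i j T' →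
      T ≤ T' := by
    intro T T' hd hd'
    by_contra hn
    have h1 := (hd.cut ⟨T', hd'.lt⟩).1 (Fin.lt_def.1 (not_le.1 hn))
    exact h1.not_gt ((hd'.cut ⟨T', hd'.lt⟩).2 le_rfl)
  obtain rfl := le_antisymm (hle _ _ hd hd') (hle _ _ hd' hd)
  exact eq_of_arcs_eq (hQ.trans hQ'.symm)

theorem CyclicRotation.unique {Q P P' : SetPartition (n + 1)} {k : ℕ} (h : CyclicRotation k Q P)
    (h' : CyclicRotation k Q P') : P = P' := by
  obtain ⟨i, j, p, hij, hr, hmax, hlex, hP⟩ := h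
  obtain ⟨i', j', p', hij', hr', hmax', hlex', hP'⟩ := h'
  have hjp : j p = j' p' := le_antisymm (hmax' _ _ _ hij hr) (hmax _ _ _ hij' hr')
  have hcr := isCrossing_iff.1 hij
  have hcr' := isCrossing_iff.1 hij'
  have hip : i p = i' p' := congrArg Prod.fst
    (strictArcs_inj_snd Q _ (hcr.2.2.1 p) _ (hcr'.2.2.1 p') hjp)
  obtain rfl : j = j' := toLex.injective
    (le_antisymm (hlex' _ _ _ hij hip hjp) (hlex _ _ _ hij' hip.symm hjp.symm))
  obtain rfl : i = i' := funext fun s => congrArg Prod.fst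
    (strictArcs_inj_snd Q _ (hcr.2.2.1 s) _ (hcr'.2.2.1 s) rfl)
  obtain rfl := hcr.1.injective hip
  exact eq_of_arcs_eq (hP.trans hP'.symm)

/-- The exchange acts on the strict arcs of `P` other than `(b, a)`. As for shifts, all `(K +
1)`-crossings of `Q` have a right end up to `a` and its covered red nodes lie beyond `a`. The last
clause drives termination. -/
theorem undoRotation_forward {P Q : SetPartition (n + 1)} (hP : RotInv K P)
    (h : UndoRotation (K + 1) P Q) :
    RotInv K Q ∧ CyclicRotation (K + 1) Q P ∧ numBlocks Q = numBlocks P ∧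
      ∃ a ∈ coveredRed K P, ∀ c ∈ coveredRed K Q, a < c := by
  obtain ⟨a, b, i, j, T, hd, hQ⟩ := undoRotation_iff.1 h
  obtain ⟨O, hex, hold, hnew⟩ := hd.exchange
  have hbr := hd.greatest.1.1
  have har := hd.least.1.1
  have hba : b < a := hd.arc.1
  have hx := extend_insertAt_self T b i
  have hy := extend_prepend_zero a j
  have hYT : a < extend (prepend a j) T := by
    rw [extend_val]
    have h0 : (0 : Fin (K + 1)) < T := Fin.lt_def.2 (by rw [Fin.val_zero]; exact hd.one_le)
    exact hd.strictMono_right h0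
  have hQs : strictArcs Q = newArcs O (extend (insertAt T b i)) (extend (prepend a j)) T := by
    rw [hnew]
    refine strictArcs_eq_of hQ ?_
    rintro e ⟨s, rfl⟩
    exact hd.left_lt_right s s
  have hbT : (b, extend (prepend a j) T) ∈ strictArcs Q := by
    have := hex.new_mem (s := T) (by omega)
    rwa [hx, ← hQs] at this
  obtain ⟨lab, hl, hR⟩ := hex.exists_labelling_of_lex_min (i := i) (j := j)
    (by
      rw [hold, hy]
      intro D hD
      obtain ⟨e, he, hlt⟩ := hP.2 a hd.least.1 D (hD.mono (fun _ _ h => h) Set.sdiff_subset)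
      exact ⟨e, he, hlt.le⟩)
    (fun s => ⟨(leftEnd_extend_insertAt T b i s).symm, (extend_prepend_succ a j s).symm⟩)
    (by
      intro i' j' hi' hj' hV
      rw [hold, hy] at hV
      exact hd.innermost.2.2 i' j' (isBlackCrossing_iff.2 ⟨hi', hj', fun s =>
        mem_blackStrict_of_over (hV s).1.1 har (hV s).2.1 (hV s).2.2,
        fun s s' => (hV s).2.1.trans (hV s').2.2⟩) fun s => (hV s).2)
  rw [hold, hy] at hR
  -- Red arcs ending by `b` are untouched, so the red blocks agree up to `b`; beyond `b` they may
  -- differ altogether.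
  have hred : ∀ c ≤ b, c ∈ red P ↔ c ∈ red Q := mem_red_iff_of_le hbr (by
    intro e he her hle
    rw [hQs, hnew]
    refine Or.inl ⟨he, ?_⟩
    rintro (⟨s, rfl⟩ | rfl)
    · exact ((isBlackCrossing_iff.1 hd.innermost.1).2.2.1 s).2 her
    · exact hba.not_ge hle)
  have hbQ := (hred b le_rfl).1 hbr
  have hright : ∀ D, IsXing (· < ·) (strictArcs Q) (K + 1) D → ∃ e ∈ D, e.2 ≤ a := by
    intro D hD
    by_contra hn
    push Not at hn
    rw [hQs] at hD
    obtain ⟨D', h1, h2, h3, h4, h5⟩ := hex.exists_old_of_new hl hD.1 hD.2.2.1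
      (by rw [hy]; exact hn) hD.2.2.2
    rw [hold] at h3
    rw [hy] at h4
    obtain ⟨e, he, hlt⟩ := hP.2 a hd.least.1 D'
      ⟨h1, h2.trans hD.2.1, h3.trans Set.sdiff_subset, h5⟩
    exact absurd (h4 e he) hlt.le.not_gt
  have hleft : ∀ m D c, c ≤ a → IsXing (· < ·) (strictArcs Q) m D →
      (b, extend (prepend a j) T) ∉ D → (∀ e ∈ D, e.1 < c) →
      ∃ D', IsXing (· < ·) (strictArcs P \ {(b, a)}) m D' ∧
        ∀ e ∈ D', e.1 < c ∧ (e ∈ D ∨ a < e.2) := by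
    intro m D c hca hD hbD hc
    rw [hQs] at hD
    obtain ⟨D', h1, h2, h3, h4, h5⟩ := hex.exists_old_of_new_left hl (by rw [hold, hy]; exact hR)
      hD.1 hD.2.2.1 (by rw [hx]; exact hbD)
      (fun e he _ => by rw [hy]; exact (hc e he).trans_le hca)
    rw [hold] at h3
    rw [hy] at h5
    have hfst : ∀ e ∈ D', e.1 < c := fun e he => by
      obtain ⟨f, hf, hle⟩ := h4 e he
      exact hle.trans_lt (hc f hf)
    refine ⟨D', ⟨h1, h2.trans hD.2.1, h3, fun e he f hf => ?_⟩, fun e he =>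
      ⟨hfst e he, (h5 e he).imp (fun h => h.1) (fun h => h.1)⟩⟩
    rcases h5 f hf with hf' | hf'
    · obtain ⟨g, hg, hle⟩ := h4 e he
      exact hle.trans_lt (hD.2.2.2 g hg f hf'.1)
    · exact (hfst e he).trans (hca.trans_lt hf'.1)
  have hcov : ∀ c ∈ coveredRed K Q, a < c := by
    intro c hc
    rw [mem_coveredRed_iff] at hc
    obtain ⟨hcr, D, hD, hu⟩ := hc
    by_contra hn
    rw [not_lt] at hn
    -- In `Q` the red block jumps from `b` over `a` to `y T`, so a red node up to `a` is at most
    -- `b`, where `P` and `Q` have the same red nodes.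
    rcases le_or_le_of_red_arc hbT hbQ hcr with hcb | hcb
    · have hcP := (hred c hcb).2 hcr
      obtain ⟨D', hD', hc'⟩ := hleft K D c hn (hD.mono (fun _ _ h => h) fun e he => he.1)
        (fun h => (hD.2.2.1 h).2 hbQ) fun e he => (hu e he).1
      have hu' : ∀ e ∈ D', e.1 < c ∧ c < e.2 := fun e he => ⟨(hc' e he).1,
        (hc' e he).2.elim (fun h' => (hu e h').2) fun h' => hn.trans_lt h'⟩
      refine (hcb.trans_lt hba).not_ge (hd.least.2 (mem_coveredRed_iff.2 ⟨hcP, D',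
        ⟨hD'.1, hD'.2.1, fun e he => ?_, hD'.2.2.2⟩, hu'⟩))
      exact mem_blackStrict_of_over (hD'.2.2.1 he).1 hcP (hu' e he).1 (hu' e he).2
    · exact hn.not_gt (hYT.trans_le hcb)
  refine ⟨⟨?_, ?_⟩, ?_, ?_, a, hd.least.1, hcov⟩
  · intro D hD
    have hD1 := hD.mono (fun _ _ h => h) fun e (he : e ∈ blackStrict Q) => he.1
    obtain ⟨e, he, hle⟩ := hright D hD1
    obtain ⟨D', hD', hc'⟩ := hleft (K + 1) D a le_rfl hD1 (fun h => (hD.2.2.1 h).2 hbQ)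
      fun f hf => (hD.2.2.2 f hf e he).trans_le hle
    refine hP.1 D' ⟨hD'.1, hD'.2.1, fun f hf => ?_, hD'.2.2.2⟩
    have hfP := hD'.2.2.1 hf
    rcases (hc' f hf).2 with hfD | hfa
    · refine ⟨hfP.1, fun hfr => ?_⟩
      have hfb : f.1 ≤ b := hd.greatest.2 ⟨hfr, (hc' f hf).1⟩
      exact (hD.2.2.1 hfD).2 ((hred _ hfb).1 hfr)
    · exact mem_blackStrict_of_over hfP.1 har (hc' f hf).1 hfa
  · intro c hc D hD
    obtain ⟨e, he, hle⟩ := hright D hD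
    exact ⟨e, he, hle.trans_lt (hcov c hc)⟩
  -- The crossing just created need not be the outermost one through `(b, y T)`. The outermost one
  -- is chosen and shown to agree with it up to `T`.
  · obtain ⟨⟨i', j'⟩, ⟨hij', p, hip, hjp⟩, hmax⟩ := Set.exists_max_image
      {q : (Fin (K + 1) → Fin (n + 1)) × (Fin (K + 1) → Fin (n + 1)) | IsCrossing Q q.1 q.2 ∧
        ∃ p, q.1 p = b ∧ q.2 p = extend (prepend a j) T} (fun q => toLex q.2) (Set.toFinite _)
      ⟨(insertAt T b i, prepend a j), isCrossing_iff.2 ⟨hd.strictMono_left, hd.strictMono_right,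
        fun s => by rw [hQs, hnew]; exact Or.inr ⟨s, rfl⟩, hd.left_lt_right⟩, T,
        insertAt_self T b i, (extend_val _ T).symm⟩
    have hlex : toLex (prepend a j) ≤ toLex j' := hmax (insertAt T b i, prepend a j)
      ⟨isCrossing_iff.2 ⟨hd.strictMono_left, hd.strictMono_right,
        fun s => by rw [hQs, hnew]; exact Or.inr ⟨s, rfl⟩, hd.left_lt_right⟩, T,
        insertAt_self T b i, (extend_val _ T).symm⟩
    dsimp only at hij' hip hjp
    have hcr := isCrossing_iff.1 hij'
    have hright' : ∀ i'' j'' : Fin (K + 1) → Fin (n + 1), IsCrossing Q i'' j'' → j'' 0 ≤ a := by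
      intro i'' j'' h
      have h' := isCrossing_iff.1 h
      obtain ⟨e, he, hle⟩ := hright _ (isXing_of_fun h'.1 h'.2.1 h'.2.2.1 h'.2.2.2)
      obtain ⟨s, -, rfl⟩ := Finset.mem_image.1 he
      exact (h'.2.1.monotone (Fin.zero_le s)).trans hle
    have hj0 : j' 0 = a := le_antisymm (hright' _ _ hij')
      (le_of_toLex_le hlex 0 fun q hq => absurd hq (Fin.not_lt_zero q))
    have hle := hex.le_of_new hl hcr.1 hcr.2.1 (fun q => hQs ▸ hcr.2.2.1 q)
      (fun q => by rw [hy, ← hj0]; exact hcr.2.2.2 q 0) (hj0.trans hy.symm)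
    -- Lexicographic maximality bounds `j'` from below at the first possible difference, `le_of_new`
    -- bounds it from above.
    have heq : ∀ m : ℕ, ∀ q : Fin (K + 1), (q : ℕ) = m → q ≤ T → j' q = prepend a j q := by
      intro m
      induction m using Nat.strong_induction_on with
      | _ m ih =>
        rintro q rfl hqT
        refine le_antisymm ?_ (le_of_toLex_le hlex q fun q' hq' =>
          (ih q' hq' q' rfl (hq'.le.trans hqT)).symm)
        have := hle q hqT
        rwa [extend_val] at this
    have heqj : ∀ q ≤ T, j' q = prepend a j q := fun q hq => heq q q rfl hq
    obtain rfl : p = T := by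
      refine hcr.2.1.injective ?_
      rw [hjp, heqj T le_rfl, extend_val]
    have heqi : ∀ q ≤ p, i' q = insertAt p b i q := by
      intro q hq
      have h1 := hcr.2.2.1 q
      rw [hQs] at h1
      have h2 := hex.new_mem (s := q) (by omega)
      rw [extend_val, extend_val] at h2
      exact congrArg Prod.fst (hex.inj_new.2 _ h1 _ h2 (heqj q hq))
    refine ⟨i', j', p, hij', by rw [hip]; exact hbQ, ?_, ?_, ?_⟩
    · intro i'' j'' p'' h hr
      have h' := isCrossing_iff.1 h
      by_contra hn
      rw [not_le, hjp] at hn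
      have hYQ := (mem_red_iff_of_arc hbT).1 hbQ
      -- A red arc ending beyond `y T` starts at `y T` or later, hence beyond `a`; but the first
      -- right end of every crossing is at most `a`.
      have h1 := le_or_le_of_red_arc (h'.2.2.1 p'') hr hYQ
      rcases h1 with h1 | h1
      · exact ((h1.trans_lt (h'.2.2.2 p'' 0)).trans_le (hright' _ _ h)).not_gt hYT
      · exact h1.not_gt hn
    · intro i'' j'' p'' h h1 h2
      exact hmax (i'', j'') ⟨h, p'', h1.trans hip, h2.trans hjp⟩
    · obtain ⟨i₀, j₀, hi₀, hj₀⟩ := exists_insertAt_prepend i' j' p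
      rw [hip] at hi₀
      rw [hj0] at hj₀
      rw [hi₀, hj₀] at hij'
      obtain ⟨O', hex', hnew', hold'⟩ := rotation_exchange hij' hd.one_le
      rw [← hi₀, ← hj₀] at hex' hnew' hold'
      have hOO := hex.oldArcs_congr hex'
        (fun s hs => by
          rw [extend_of_lt _ (by omega), extend_of_lt _ (by omega)]
          exact (heqi _ (Fin.le_def.2 hs)).symm)
        (fun s hs => by
          rw [extend_of_lt _ (by omega), extend_of_lt _ (by omega)]
          exact (heqj _ (Fin.le_def.2 hs)).symm) (hQs.symm.trans hnew'.symm)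
      refine arcs_eq_of ?_ ?_ fun c => ?_
      · rw [← hold', ← hOO, hold, Set.sdiff_union_self, Set.union_eq_self_of_subset_right
          (Set.singleton_subset_iff.2 hd.arc)]
      · rintro e ⟨s, rfl⟩
        exact hcr.2.2.2 s s
      · rw [hQs, hd.ends_eq hex hold]
  · refine numBlocks_congr fun c => ?_
    rw [hQs, snd_newArcs, hold, hy]
    constructor
    · rintro (rfl | ⟨u, hu⟩)
      · exact ⟨b, hd.arc⟩
      · exact ⟨u, hu.1⟩
    · rintro ⟨u, hu⟩
      by_cases huc : (u, c) = (b, a)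
      · exact Or.inl (congrArg Prod.snd huc)
      · exact Or.inr ⟨u, hu, huc⟩

end Rotation

/-! ### Cyclic rotations and their inverses. -/

section Rotation

variable {n K : ℕ}

/-- The data of a cyclic rotation. -/
structure RotationData (K : ℕ) (Q : SetPartition (n + 1)) (a b : Fin (n + 1))
    (i j : Fin K → Fin (n + 1)) (T : Fin (K + 1)) : Prop where
  crossing : IsCrossing Q (insertAt T b i) (prepend a j)
  red : b ∈ red Q
  rightmost : ∀ (i' j' : Fin (K + 1) → Fin (n + 1)) (p : Fin (K + 1)),
    IsCrossing Q i' j' → i' p ∈ KNoncrossing.red Q → j' p ≤ prepend a j T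
  outermost : ∀ (i' j' : Fin (K + 1) → Fin (n + 1)) (p : Fin (K + 1)),
    IsCrossing Q i' j' → i' p = b → j' p = prepend a j T → toLex j' ≤ toLex (prepend a j)

theorem cyclicRotation_iff {P Q : SetPartition (n + 1)} : CyclicRotation (K + 1) Q P ↔
    ∃ a b i j T, RotationData K Q a b i j T ∧
      arcs P = (arcs Q \ pairs (insertAt T b i) (prepend a j)) ∪
        pairs (insertAt T b i) (fun s => prepend a j (T.cycleRange s)) := by
  constructor
  · rintro ⟨i, j, T, h1, h2, h3, h4, h5⟩
    obtain ⟨i₀, j₀, hi, hj⟩ := exists_insertAt_prepend i j T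
    refine ⟨j 0, i T, i₀, j₀, T, ⟨?_, h2, ?_, ?_⟩, ?_⟩
    · rwa [← hi, ← hj]
    · rwa [← hj]
    · rwa [← hj]
    · rwa [← hi, ← hj]
  · rintro ⟨a, b, i, j, T, ⟨h1, h2, h3, h4⟩, h5⟩
    exact ⟨_, _, T, h1, by rwa [insertAt_self], h3, by rwa [insertAt_self], h5⟩

theorem exists_rotationData {Q : SetPartition (n + 1)} (h : HasRedCrossing (K + 1) Q) :
    ∃ a b i j T, RotationData K Q a b i j T := by
  obtain ⟨i₁, j₁, h₁, p₁, hp₁⟩ := h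
  obtain ⟨⟨i₂, j₂, p₂⟩, ⟨h₂, hp₂⟩, hmax⟩ := Set.exists_max_image
    {q : (Fin (K + 1) → Fin (n + 1)) × (Fin (K + 1) → Fin (n + 1)) × Fin (K + 1) |
      IsCrossing Q q.1 q.2.1 ∧ q.1 q.2.2 ∈ red Q} (fun q => q.2.1 q.2.2) (Set.toFinite _)
    ⟨(i₁, j₁, p₁), h₁, hp₁⟩
  obtain ⟨⟨i, j⟩, ⟨h, T, hi, hj⟩, hlex⟩ := Set.exists_max_image
    {q : (Fin (K + 1) → Fin (n + 1)) × (Fin (K + 1) → Fin (n + 1)) |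
      IsCrossing Q q.1 q.2 ∧ ∃ T, q.1 T = i₂ p₂ ∧ q.2 T = j₂ p₂} (fun q => toLex q.2)
    (Set.toFinite _) ⟨(i₂, j₂), h₂, p₂, rfl, rfl⟩
  dsimp only at h hi hj h₂ hp₂
  obtain ⟨i₀, j₀, hi₀, hj₀⟩ := exists_insertAt_prepend i j T
  refine ⟨j 0, i T, i₀, j₀, T, ?_, by rwa [hi], ?_, ?_⟩
  · rwa [← hi₀, ← hj₀]
  · intro i' j' p h' hr
    rw [← hj₀, hj]
    exact hmax (i', j', p) ⟨h', hr⟩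
  · intro i' j' p h' hip hjp
    rw [← hj₀] at hjp ⊢
    exact hlex (i', j') ⟨h', p, hip.trans hi, hjp.trans hj⟩

namespace RotationData

variable {Q : SetPartition (n + 1)} {a b : Fin (n + 1)} {i j : Fin K → Fin (n + 1)}
  {T : Fin (K + 1)}

theorem lt (h : RotationData K Q a b i j T) : b < a := (lt_of_crossing_insertAt h.crossing).1

theorem under (h : RotationData K Q a b i j T) : Under i j a :=
  (lt_of_crossing_insertAt h.crossing).2

theorem le_right (h : RotationData K Q a b i j T) (s : Fin (K + 1)) : a ≤ prepend a j s :=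
  (isCrossing_iff.1 h.crossing).2.1.monotone (Fin.zero_le s)

theorem arc (h : RotationData K Q a b i j T) : (b, prepend a j T) ∈ strictArcs Q := by
  have := (isCrossing_iff.1 h.crossing).2.2.1 T
  rwa [insertAt_self] at this

/-- Two red arcs never cross, so a crossing contains at most one red arc. -/
theorem notMem_red (h : RotationData K Q a b i j T) {s : Fin (K + 1)} (hs : s ≠ T) :
    insertAt T b i s ∉ KNoncrossing.red Q := by
  intro hr
  have hc := isCrossing_iff.1 h.crossing
  have hrs := (mem_red_iff_of_arc (hc.2.2.1 s)).1 hr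
  have hrT := (mem_red_iff_of_arc h.arc).1 h.red
  have h1 := hc.2.2.2 s T
  have h2 := hc.2.2.2 T s
  rw [insertAt_self] at h2
  rcases lt_or_gt_of_ne hs with hlt | hlt
  · rcases le_or_le_of_red_arc h.arc h.red hrs with h3 | h3
    · exact h3.not_gt h2
    · exact h3.not_gt (hc.2.1 hlt)
  · rcases le_or_le_of_red_arc (hc.2.2.1 s) hr hrT with h3 | h3
    · exact h3.not_gt h1
    · exact h3.not_gt (hc.2.1 hlt)

theorem isXing (h : RotationData K Q a b i j T) :
    ∃ D, IsXing (· < ·) (strictArcs Q) (K + 1) D ∧ ∀ e ∈ D, a ≤ e.2 := by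
  have hc := isCrossing_iff.1 h.crossing
  refine ⟨_, isXing_of_fun hc.1 hc.2.1 hc.2.2.1 hc.2.2.2, fun e he => ?_⟩
  obtain ⟨s, -, rfl⟩ := Finset.mem_image.1 he
  exact h.le_right s

/-- For `T = 0` the red arc ends at `a`, so `a` is a red node under the other `K` arcs, which are
black. The invariant at `a` then contradicts the crossing itself. The bound `T < K` is dual:
otherwise `b` would lie under the other `K` arcs. -/
theorem one_le (h : RotationData K Q a b i j T) (hQ : RotInv K Q) : 1 ≤ (T : ℕ) := by
  by_contra hn
  have hT0 : T = 0 := Fin.ext (by rw [Fin.val_zero]; omega)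
  have hc := isCrossing_iff.1 h.crossing
  have har : a ∈ KNoncrossing.red Q := by
    have h1 := (mem_red_iff_of_arc h.arc).1 h.red
    rw [hT0] at h1
    exact h1
  have hcov : a ∈ coveredRed K Q := by
    refine ⟨har, fun s => insertAt T b i s.succ, j, isBlackCrossing_iff.2 ⟨?_, ?_, ?_, ?_⟩,
      fun s => ⟨hc.2.2.2 s.succ 0, (h.under s).2⟩⟩
    · exact fun s s' hs => hc.1 (Fin.succ_lt_succ_iff.2 hs)
    · exact fun s s' hs => hc.2.1 (Fin.succ_lt_succ_iff.2 hs)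
    · exact fun s => ⟨hc.2.2.1 s.succ, h.notMem_red (by rw [hT0]; exact Fin.succ_ne_zero s)⟩
    · exact fun s s' => hc.2.2.2 s.succ s'.succ
  obtain ⟨D, hD, hDa⟩ := h.isXing
  obtain ⟨e, he, hlt⟩ := hQ.2 a hcov D hD
  exact hlt.not_ge (hDa e he)

theorem lt_card (h : RotationData K Q a b i j T) (hQ : RotInv K Q) : (T : ℕ) < K := by
  by_contra hn
  have hTK : T = Fin.last K := Fin.ext (by rw [Fin.val_last]; omega)
  have hc := isCrossing_iff.1 h.crossing
  have hcov : b ∈ coveredRed K Q := by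
    refine ⟨h.red, fun s => insertAt T b i s.castSucc, fun s => prepend a j s.castSucc,
      isBlackCrossing_iff.2 ⟨?_, ?_, ?_, ?_⟩, fun s => ⟨?_, h.lt.trans_le (h.le_right _)⟩⟩
    · exact fun s s' hs => hc.1 (Fin.castSucc_lt_castSucc_iff.2 hs)
    · exact fun s s' hs => hc.2.1 (Fin.castSucc_lt_castSucc_iff.2 hs)
    · exact fun s => ⟨hc.2.2.1 s.castSucc,
        h.notMem_red (by rw [hTK]; exact (Fin.castSucc_lt_last s).ne)⟩
    · exact fun s s' => hc.2.2.2 s.castSucc s'.castSucc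
    · have := hc.1 (hTK ▸ Fin.castSucc_lt_last s : s.castSucc < T)
      rwa [insertAt_self] at this
  obtain ⟨D, hD, hDa⟩ := h.isXing
  obtain ⟨e, he, hlt⟩ := hQ.2 b hcov D hD
  exact (hlt.trans h.lt).not_ge (hDa e he)

/-- A crossing avoiding the rotated red arc has a red arc to the left of it. -/
theorem exists_red_le (h : RotationData K Q a b i j T) (hQ : RotInv K Q)
    {D : Finset (Fin (n + 1) × Fin (n + 1))} (hD : IsXing (· < ·) (strictArcs Q) (K + 1) D)
    (hbD : (b, prepend a j T) ∉ D) : ∃ e ∈ D, e.1 ∈ KNoncrossing.red Q ∧ e.2 ≤ b := by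
  have hred : ∃ e ∈ D, e.1 ∈ KNoncrossing.red Q := by
    by_contra hn
    push Not at hn
    exact hQ.1 D ⟨hD.1, hD.2.1, fun e he => ⟨hD.2.2.1 he, hn e he⟩, hD.2.2.2⟩
  obtain ⟨e, he, her⟩ := hred
  obtain ⟨i', j', hi', hj', -, hs, hA, hr⟩ := hD.exists_fun
  obtain ⟨s, rfl⟩ := hs e he
  have hle := h.rightmost i' j' s (isCrossing_iff.2 ⟨hi', hj', hA, hr⟩) her
  refine ⟨_, he, her, ?_⟩
  rcases hle.eq_or_lt with heq | hlt
  · refine absurd ?_ hbD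
    have := strictArcs_inj_snd Q _ (hA s) _ h.arc heq
    rwa [this] at he
  · exact (le_or_le_of_red_arc h.arc h.red ((mem_red_iff_of_arc (hA s)).1 her)).resolve_right
      hlt.not_ge

/-- For a crossing through the rotated red arc, lexicographic maximality bounds the first right end
by `a`; any other crossing has a right end at most `b < a`. -/
theorem exists_le (h : RotationData K Q a b i j T) (hQ : RotInv K Q)
    {D : Finset (Fin (n + 1) × Fin (n + 1))} (hD : IsXing (· < ·) (strictArcs Q) (K + 1) D) :
    ∃ e ∈ D, e.2 ≤ a := by
  by_cases hbD : (b, prepend a j T) ∈ D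
  · obtain ⟨i', j', hi', hj', hm, hs, hA, hr⟩ := hD.exists_fun
    obtain ⟨s, hs⟩ := hs _ hbD
    rw [Prod.mk.injEq] at hs
    have := h.outermost i' j' s (isCrossing_iff.2 ⟨hi', hj', hA, hr⟩) hs.1.symm hs.2.symm
    exact ⟨_, hm 0, le_of_toLex_le this 0 fun q hq => absurd hq (Fin.not_lt_zero q)⟩
  · obtain ⟨e, he, -, hle⟩ := h.exists_red_le hQ hD hbD
    exact ⟨e, he, hle.trans h.lt.le⟩

theorem pairs_lt (h : RotationData K Q a b i j T) :
    ∀ e ∈ pairs (insertAt T b i) (fun s => prepend a j (T.cycleRange s)), e.1 < e.2 := by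
  rintro e ⟨s, rfl⟩
  exact (isCrossing_iff.1 h.crossing).2.2.2 s _

theorem ends_eq (_h : RotationData K Q a b i j T) {O : Set (Fin (n + 1) × Fin (n + 1))}
    (hex : IsExchange (· < ·) O (extend (insertAt T b i)) (extend (prepend a j)) T K)
    (c : Fin (n + 1)) :
    c ∈ ends (oldArcs O (extend (insertAt T b i)) (extend (prepend a j)) T ∪ {(b, a)}) ↔
      c ∈ ends (newArcs O (extend (insertAt T b i)) (extend (prepend a j)) T) := by
  rw [ends_newArcs hex, extend_insertAt_self, extend_prepend_zero]
  constructor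
  · rintro ⟨e, he | rfl, hc⟩
    · exact Or.inr (Or.inr ⟨e, he, hc⟩)
    · exact hc.imp Eq.symm fun h => Or.inl h.symm
  · rintro (rfl | rfl | ⟨e, he, hc⟩)
    · exact ⟨_, Or.inr rfl, Or.inl rfl⟩
    · exact ⟨_, Or.inr rfl, Or.inr rfl⟩
    · exact ⟨e, Or.inl he, hc⟩

end RotationData

theorem cyclicRotation_exists {Q : SetPartition (n + 1)} (hQ : RotInv K Q)
    (h : HasRedCrossing (K + 1) Q) : ∃ P, CyclicRotation (K + 1) Q P := by
  obtain ⟨a, b, i, j, T, hd⟩ := exists_rotationData h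
  obtain ⟨O, hex, hnew, hold⟩ := rotation_exchange hd.crossing (hd.one_le hQ)
  have hne := hex.ne_old
  rw [extend_insertAt_self, extend_prepend_zero] at hne
  obtain ⟨P, hP⟩ := exists_partition_of_arcs
    (oldArcs O (extend (insertAt T b i)) (extend (prepend a j)) T ∪ {(b, a)})
    (by
      rw [hold]
      rintro e (he | he)
      · exact he.1.1
      · exact hd.pairs_lt e he)
    (by
      rintro f (hf | rfl) g (hg | rfl) hfg
      · exact hex.inj_old.1 f hf g hg hfg
      · exact absurd hfg (hne f hf).1
      · exact absurd hfg.symm (hne g hg).1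
      · rfl)
    (by
      rintro f (hf | rfl) g (hg | rfl) hfg
      · exact hex.inj_old.2 f hf g hg hfg
      · exact absurd hfg (hne f hf).2
      · exact absurd hfg.symm (hne g hg).2
      · rfl)
  refine ⟨P, cyclicRotation_iff.2 ⟨a, b, i, j, T, hd, arcs_eq_of (hP.trans hold) ?_ fun c => ?_⟩⟩
  · rintro e ⟨s, rfl⟩
    exact ((isCrossing_iff.1 hd.crossing).2.2.1 s).1
  · rw [hP, hd.ends_eq hex, hnew]

/-- The choice of the rightmost red arc and of the outermost crossing supplies the labelling.
Transport runs from old to new, and each transported crossing avoids the rotated arc, so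
`exists_red_le` applies to it. -/
theorem cyclicRotation_backward {P Q : SetPartition (n + 1)} (hQ : RotInv K Q)
    (h : CyclicRotation (K + 1) Q P) : RotInv K P ∧ UndoRotation (K + 1) P Q := by
  obtain ⟨a, b, i, j, T, hd, hP⟩ := cyclicRotation_iff.1 h
  have hT := hd.one_le hQ
  have hTK := hd.lt_card hQ
  obtain ⟨O, hex, hnew, hold⟩ := rotation_exchange hd.crossing hT
  have hcr := isCrossing_iff.1 hd.crossing
  have hba := hd.lt
  have hu := hd.under
  have hx := extend_insertAt_self T b i
  have hy := extend_prepend_zero a j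
  have hyT : extend (prepend a j) T = prepend a j T := extend_val _ T
  have hYT : a < prepend a j T := by
    have h0 : (0 : Fin (K + 1)) < T := Fin.lt_def.2 (by rw [Fin.val_zero]; exact hT)
    exact hcr.2.1 h0
  have hne := hex.ne_old
  rw [hx, hy] at hne
  have hPs : strictArcs P =
      oldArcs O (extend (insertAt T b i)) (extend (prepend a j)) T ∪ {(b, a)} := by
    rw [hold]
    exact strictArcs_eq_of hP hd.pairs_lt
  -- The red arc `(b, a)` of `P` is not part of the exchange, so crossings must avoid it before they
  -- can be transported.
  have hsub : ∀ {D : Set (Fin (n + 1) × Fin (n + 1))}, D ⊆ strictArcs P → (b, a) ∉ D →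
      D ⊆ oldArcs O (extend (insertAt T b i)) (extend (prepend a j)) T := by
    intro D hD hn e he
    have := hD he
    rw [hPs] at this
    refine this.resolve_right ?_
    rintro rfl
    exact hn he
  have hbaP : (b, a) ∈ strictArcs P := by rw [hPs]; exact Or.inr rfl
  have hred : ∀ c ≤ b, c ∈ red Q ↔ c ∈ red P := mem_red_iff_of_le hd.red (by
    intro e he _ hle
    rw [hPs, hold]
    refine Or.inl ⟨he, ?_⟩
    rintro ⟨s, rfl⟩
    exact (hba.trans_le (hd.le_right s)).not_ge hle)
  have hbP := (hred b le_rfl).1 hd.red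
  have haP := (mem_red_iff_of_arc hbaP).1 hbP
  obtain ⟨lab, hl⟩ := hex.exists_labelling_of_lex_max (Y := prepend a j)
    (by rw [hnew, hy]; exact fun D hD => hd.exists_le hQ hD)
    (by
      rw [hnew, hy, hx, hyT]
      intro D hD hn
      obtain ⟨e, he, -, hle⟩ := hd.exists_red_le hQ hD hn
      exact ⟨e, he, hle.trans_lt hba⟩)
    (fun s => (extend_val _ s).symm)
    (by
      rw [hnew, hx, hyT]
      rintro i' j' hi' hj' hA hr' ⟨s, hs⟩
      rw [Prod.mk.injEq] at hs
      exact hd.outermost i' j' s (isCrossing_iff.2 ⟨hi', hj', hA, hr'⟩) hs.1.symm hs.2.symm)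
  have hright : ∀ D, IsXing (· < ·) (strictArcs P) (K + 1) D → ∃ e ∈ D, e.2 ≤ a := by
    intro D hD
    by_contra hn
    push Not at hn
    obtain ⟨D', h1, h2, h3, h4, h5⟩ := hex.exists_new_of_old hl hD.1
      (hsub hD.2.2.1 fun h => (hn _ h).false) (by rw [hy]; exact hn) hD.2.2.2
    rw [hnew] at h3
    rw [hy] at h4
    obtain ⟨e, he, hle⟩ := hd.exists_le hQ ⟨h1, h2.trans hD.2.1, h3, h5⟩
    exact absurd (h4 e he) hle.not_gt
  have hleft : ∀ m D c, c ≤ a → IsXing (· < ·) (strictArcs P) m D → (b, a) ∉ D →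
      (∀ e ∈ D, e.1 < c) → ∃ D', IsXing (· < ·) (strictArcs Q) m D' ∧
        (b, prepend a j T) ∉ D' ∧ ∀ e ∈ D', e.1 < c ∧ (e ∈ D ∨ a ≤ e.2) := by
    intro m D c hca hD hbD hc
    obtain ⟨D', h1, h2, h3, h6, h4, h5⟩ := hex.exists_new_of_old_left hl hD.1
      (hsub hD.2.2.1 hbD) (fun e he _ => by rw [hy]; exact (hc e he).trans_le hca)
    rw [hnew] at h3
    rw [hy] at h5
    rw [hx, hyT] at h6
    have hfst : ∀ e ∈ D', e.1 < c := fun e he => by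
      obtain ⟨f, hf, hle⟩ := h4 e he
      exact hle.trans_lt (hc f hf)
    refine ⟨D', ⟨h1, h2.trans hD.2.1, h3, fun e he f hf => ?_⟩, h6, fun e he =>
      ⟨hfst e he, (h5 e he).imp (fun h => h.1) (fun h => h.1)⟩⟩
    rcases h5 f hf with hf' | hf'
    · obtain ⟨g, hg, hle⟩ := h4 e he
      exact hle.trans_lt (hD.2.2.2 g hg f hf'.1)
    · exact (hfst e he).trans_le (hca.trans hf'.1)
  have hcov : ∀ c ∈ coveredRed K P, a ≤ c := by
    intro c hc
    rw [mem_coveredRed_iff] at hc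
    obtain ⟨hcr', D, hD, hcu⟩ := hc
    by_contra hn
    have hca := not_le.1 hn
    have hcb := (le_or_le_of_red_arc hbaP hbP hcr').resolve_right hn
    have hcQ := (hred c hcb).2 hcr'
    obtain ⟨D', hD', -, hc'⟩ := hleft K D c hca.le (hD.mono (fun _ _ h => h) fun e he => he.1)
      (fun h => (hD.2.2.1 h).2 hbP) fun e he => (hcu e he).1
    have hu' : ∀ e ∈ D', e.1 < c ∧ c < e.2 := fun e he => ⟨(hc' e he).1,
      (hc' e he).2.elim (fun h' => (hcu e h').2) hca.trans_le⟩
    obtain ⟨E, hE, hEa⟩ := hd.isXing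
    obtain ⟨e, he, hlt⟩ := hQ.2 c (mem_coveredRed_iff.2 ⟨hcQ, D', ⟨hD'.1, hD'.2.1, fun e he =>
      mem_blackStrict_of_over (hD'.2.2.1 he) hcQ (hu' e he).1 (hu' e he).2, hD'.2.2.2⟩, hu'⟩) E hE
    exact (hlt.trans hca).not_ge (hEa e he)
  have hijP : ∀ s, (i s, j s) ∈ oldArcs O (extend (insertAt T b i)) (extend (prepend a j)) T := by
    intro s
    have := hex.old_mem (s := s + 1) (by omega) (by omega)
    rwa [leftEnd_extend_insertAt, extend_prepend_succ] at this
  have hblack : IsBlackCrossing P i j := by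
    refine isBlackCrossing_iff.2 ⟨?_, ?_, fun s => mem_blackStrict_of_over
      (by rw [hPs]; exact Or.inl (hijP s)) haP (hu s).1 (hu s).2,
      fun s s' => (hu s).1.trans (hu s').2⟩
    · intro s s' hs
      have := hcr.1 (Fin.strictMono_succAbove T hs)
      rwa [insertAt_succAbove, insertAt_succAbove] at this
    · exact fun s s' hs => hcr.2.1 (Fin.succ_lt_succ_iff.2 hs)
  have hcut : ∀ s : Fin K, ((s : ℕ) < T → i s < b) ∧ ((T : ℕ) ≤ s → b < i s) := by
    intro s
    constructor
    · intro hs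
      have := hex.x_lt s T hs (by omega)
      rwa [hx, extend_insertAt_lt _ _ _ _ hs] at this
    · intro hs
      have := hex.x_lt T (s + 1) (by omega) (by omega)
      rwa [hx, extend_insertAt_ge _ _ _ _ hs] at this
  have hleast : IsLeast (coveredRed K P) a := ⟨⟨haP, i, j, hblack, hu⟩, hcov⟩
  refine ⟨⟨?_, ?_⟩, ?_⟩
  · intro D hD
    have hD1 := hD.mono (fun _ _ h => h) fun e (he : e ∈ blackStrict P) => he.1
    obtain ⟨e, he, hle⟩ := hright D hD1
    obtain ⟨D', hD', hbD', hc'⟩ := hleft (K + 1) D a le_rfl hD1 (fun h => (hD.2.2.1 h).2 hbP)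
      fun f hf => (hD.2.2.2 f hf e he).trans_le hle
    obtain ⟨f, hf, hfr, hfb⟩ := hd.exists_red_le hQ hD' hbD'
    have hfD := (hc' f hf).2.resolve_right (hfb.trans_lt hba).not_ge
    exact (hD.2.2.1 hfD).2 ((hred _ ((hD.2.2.1 hfD).1.1.le.trans hfb)).1 hfr)
  · intro c hc D hD
    suffices ∃ e ∈ D, e.2 < a by
      obtain ⟨e, he, hlt⟩ := this
      exact ⟨e, he, hlt.trans_le (hcov c hc)⟩
    obtain ⟨e, he, hle⟩ := hright D hD
    -- If `(b, a)` belongs to `D` and no right end lies before `a`, the other arcs start beyond `b =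
    -- x T` and are therefore fixed. Trading `(b, a)` for the new arc `(x 0, a)` gives a crossing of
    -- `Q` without the rotated arc, all of whose right ends are at least `a > b`, against
    -- `exists_red_le`.
    by_cases hbD : (b, a) ∈ D
    · by_contra hn
      push Not at hn
      have hother : ∀ f ∈ D.erase (b, a), Prec (b, a) f := fun f hf => by
        obtain ⟨hf1, hf2⟩ := Finset.mem_erase.1 hf
        refine hD.1.prec_of_snd_lt hbD hf2 (lt_of_le_of_ne (hn f hf2) fun heq => ?_)
        exact hf1 (hD.1.eq_of_snd_eq hbD hf2 heq).symm
      have hfO : ∀ f ∈ D.erase (b, a), f ∈ O := fun f hf => by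
        have := hsub (D := (D.erase (b, a) : Finset _))
          (fun f hf => hD.2.2.1 (Finset.mem_of_mem_erase hf)) (by simp) hf
        refine this.resolve_right ?_
        rintro ⟨s, h1, hs, rfl⟩
        have h2 := (hother _ hf).1
        have h3 := hex.x_lt (s - 1) T (by omega) (by omega)
        rw [hx] at h3
        exact h2.not_gt h3
      have hx0 : extend (insertAt T b i) 0 < b := by
        have := hex.x_lt 0 T (by omega) (by omega)
        rwa [hx] at this
      have h0 : ∀ f ∈ ({(extend (insertAt T b i) 0, a)} : Finset _), ∀ g ∈ D.erase (b, a),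
          Prec f g := by
        intro f hf g hg
        rw [Finset.mem_singleton.1 hf]
        exact ⟨hx0.trans (hother g hg).1, (hother g hg).2⟩
      obtain ⟨h1, h2⟩ := ArcChain.union (by
        rw [ArcChain, Finset.coe_singleton]; exact IsChain.singleton) (hD.1.subset
          (Finset.erase_subset (b, a) D)) h0
      rw [Finset.card_singleton, Finset.card_erase_of_mem hbD, hD.2.1] at h2
      have hE : IsXing (· < ·) (strictArcs Q) (K + 1)
          ({(extend (insertAt T b i) 0, a)} ∪ D.erase (b, a)) := by
        refine ⟨h1, h2.trans (by omega), ?_, ?_⟩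
        · intro f hf
          rw [← hnew]
          rcases Finset.mem_union.1 hf with hf | hf
          · rw [Finset.mem_singleton.1 hf, ← hy]
            exact hex.new_mem (Nat.zero_le _)
          · exact Or.inl (hfO f hf)
        · have hfst : ∀ f ∈ {(extend (insertAt T b i) 0, a)} ∪ D.erase (b, a), f.1 < a := by
            intro f hf
            rcases Finset.mem_union.1 hf with hf | hf
            · rw [Finset.mem_singleton.1 hf]
              exact hx0.trans hba
            · exact hD.2.2.2 f (Finset.mem_of_mem_erase hf) _ hbD
          have hsnd : ∀ f ∈ {(extend (insertAt T b i) 0, a)} ∪ D.erase (b, a), a ≤ f.2 := by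
            intro f hf
            rcases Finset.mem_union.1 hf with hf | hf
            · rw [Finset.mem_singleton.1 hf]
            · exact (hother f hf).2.le
          exact fun f hf g hg => (hfst f hf).trans_le (hsnd g hg)
      obtain ⟨f, hf, -, hfb⟩ := hd.exists_red_le hQ hE fun hmem => by
        rcases Finset.mem_union.1 hmem with hf | hf
        · exact hx0.ne' (congrArg Prod.fst (Finset.mem_singleton.1 hf))
        · exact (hother _ hf).1.false
      rcases Finset.mem_union.1 hf with hf | hf
      · rw [Finset.mem_singleton.1 hf] at hfb
        exact hfb.not_gt hba
      · exact ((hother f hf).2.trans_le hfb).not_gt hba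
    · obtain ⟨D', hD', hbD', hc'⟩ := hleft (K + 1) D a le_rfl hD hbD
        fun f hf => (hD.2.2.2 f hf e he).trans_le hle
      obtain ⟨f, hf, -, hfb⟩ := hd.exists_red_le hQ hD' hbD'
      exact ⟨f, (hc' f hf).2.resolve_right (hfb.trans_lt hba).not_ge, hfb.trans_lt hba⟩
  -- The innermost crossing over `a` may differ from `(i, j)` from position `T` on; it suffices that
  -- it agrees before `T` and is cut by `b` at the same place.
  · obtain ⟨i', j', hin⟩ := exists_isInnermost hleast.1
    have hin' := isBlackCrossing_iff.1 hin.1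
    have hlex : toLex j' ≤ toLex j := hin.2.2 i j hblack hu
    have hmem : ∀ p, (i' p, j' p) ∈ overArcs (· < ·) (extend (prepend a j) 0)
        (oldArcs O (extend (insertAt T b i)) (extend (prepend a j)) T) := by
      intro p
      rw [hy]
      refine ⟨?_, hin.2.1 p⟩
      have h1 := (hin'.2.2.1 p).1
      rw [hPs] at h1
      exact h1.resolve_right fun h => (hin.2.1 p).2.ne' (congrArg Prod.snd h)
    have hle : ∀ p : Fin K, (∀ q < p, j' q = extend (prepend a j) (q + 1)) →
        j' p ≤ extend (prepend a j) (p + 1) := by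
      intro p hp
      rw [extend_prepend_succ]
      exact le_of_toLex_le hlex p fun q hq => by rw [hp q hq, extend_prepend_succ]
    have heqj' := hex.eq_of_old_of_lex_le hl (by
      intro F hF hFc hFk hFn hFa
      rw [hnew] at hF
      rw [hx, hyT] at hFn
      rw [hy] at hFa
      obtain ⟨f, hf, -, hfb⟩ := hd.exists_red_le hQ ⟨hFc, hFk, hF,
        fun e he f hf => (hFa e he).2.trans_le (hFa f hf).1⟩ hFn
      exact (hfb.trans_lt hba).not_ge (hFa f hf).1) hin'.1 hin'.2.1 hmem hle
    have heqj : ∀ p : Fin K, (p : ℕ) < T → j' p = j p := fun p hp => by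
      rw [heqj' p hp, extend_prepend_succ]
    have heqi : ∀ p : Fin K, (p : ℕ) < T → i' p = i p := fun p hp =>
      congrArg Prod.fst (hex.inj_old.2 _ (hmem p).1 _ (hijP p) (heqj p hp))
    have hlab : ∀ p : Fin K, lab (i' p, j' p) = p + 1 :=
      IsExchange.lab_eq_of_strictMono (fun p => lab (i' p, j' p))
        (fun p q hpq => hl.old_lt _ (hmem p) _ (hmem q) ⟨hin'.1 hpq, hin'.2.1 hpq⟩) 1
        (fun p => (hl.old_range _ (hmem p)).1)
        (fun p => by have := (hl.old_range _ (hmem p)).2; omega)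
    -- If the innermost crossing started by `b` in position `T`, its arc there would precede the
    -- chain arc with index `T + 1`, although both have the label `T + 1`.
    have hbT : b < i' ⟨T, hTK⟩ := by
      by_contra hn
      have hi := (hcut ⟨T, hTK⟩).2 le_rfl
      have hj := hle ⟨T, hTK⟩ fun q hq => heqj' q (Fin.lt_def.1 hq)
      rw [extend_prepend_succ] at hj
      have hlt : j' ⟨T, hTK⟩ < j ⟨T, hTK⟩ := lt_of_le_of_ne hj fun heq => by
        have := congrArg Prod.fst (hex.inj_old.2 _ (hmem ⟨T, hTK⟩).1 _ (hijP ⟨T, hTK⟩) heq)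
        exact hn (hi.trans_eq this.symm)
      have h1 := hl.old_lt _ (hmem ⟨T, hTK⟩) _ (hex.old_over (s := T + 1) (by omega) (by omega))
      have h2 := leftEnd_extend_insertAt T b i ⟨T, hTK⟩
      have h3 := extend_prepend_succ a j ⟨T, hTK⟩
      rw [hlab, hl.lab_old _ (by omega) (by omega)] at h1
      dsimp only at h2 h3
      rw [h2, h3] at h1
      exact absurd (h1 ⟨(not_lt.1 hn).trans_lt hi, hlt⟩) (lt_irrefl _)
    have hcut' : ∀ s : Fin K, ((s : ℕ) < T → i' s < b) ∧ ((T : ℕ) ≤ s → b < i' s) := fun s =>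
      ⟨fun hs => by rw [heqi s hs]; exact (hcut s).1 hs,
        fun hs => hbT.trans_le (hin'.1.monotone (Fin.le_def.2 hs))⟩
    have hdata : UndoRotationData K P a b i' j' T := by
      refine ⟨hleast, ⟨⟨hbP, hba⟩, fun c hc => ?_⟩, hin, hT, hTK, hcut'⟩
      exact (le_or_le_of_red_arc hbaP hbP hc.1).resolve_right hc.2.not_ge
    refine undoRotation_iff.2 ⟨a, b, i', j', T, hdata, ?_⟩
    obtain ⟨O', hex', hold', hnew'⟩ := hdata.exchange
    have hNN := hex.newArcs_congr hex'
      (fun s hs => by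
        rcases hs.eq_or_lt with rfl | hs
        · rw [hx, extend_insertAt_self]
        · have h1 := extend_insertAt_lt T b i ⟨s, by omega⟩ hs
          have h2 := extend_insertAt_lt T b i' ⟨s, by omega⟩ hs
          rw [heqi _ hs] at h2
          exact h1.trans h2.symm)
      (fun s hs => by
        rcases s with _ | s
        · rw [hy, extend_prepend_zero]
        · have h1 := extend_prepend_succ a j ⟨s, by omega⟩
          have h2 := extend_prepend_succ a j' ⟨s, by omega⟩
          rw [heqj ⟨s, by omega⟩ (Nat.lt_of_succ_le hs)] at h2
          exact h1.trans h2.symm)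
      (by
        rw [hold', hPs, Set.union_sdiff_right]
        exact (Set.sdiff_singleton_eq_self fun h => (hne _ h).1 rfl).symm)
    refine arcs_eq_of ?_ ?_ fun c => ?_
    · rw [← hnew', ← hNN, hnew]
    · rintro e (⟨s, rfl⟩ | rfl)
      · exact (hin'.2.2.1 s).1.1
      · exact hba
    · rw [← hnew, ← hd.ends_eq hex, hPs]

end Rotation

/-! ### Deterministic, terminating and mutually inverse step relations. -/

section PartialInverse

variable {α : Type*} {I : α → Prop} {L U : α → α → Prop}

theorem reflTransGen_inverse (h : ∀ P Q, I P → L P Q → I Q ∧ U Q P) {P R : α} (hP : I P)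
    (hR : Relation.ReflTransGen L P R) : I R ∧ Relation.ReflTransGen U R P := by
  induction hR with
  | refl => exact ⟨hP, .refl⟩
  | tail _ hL ih =>
    obtain ⟨h1, h2⟩ := h _ _ ih.1 hL
    exact ⟨h1, .head h2 ih.2⟩

theorem reflTransGen_congr {β : Type*} {f : α → β}
    (h : ∀ P Q, I P → L P Q → I Q ∧ f Q = f P) {P R : α} (hP : I P)
    (hR : Relation.ReflTransGen L P R) : f R = f P := by
  suffices I R ∧ f R = f P from this.2
  induction hR with
  | refl => exact ⟨hP, rfl⟩
  | tail _ hL ih =>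
    obtain ⟨h1, h2⟩ := h _ _ ih.1 hL
    exact ⟨h1, h2.trans ih.2⟩

theorem exists_terminal {μ : α → ℕ} (h : ∀ P Q, I P → L P Q → I Q)
    (hμ : ∀ P Q, I P → L P Q → μ Q < μ P) {P : α} (hP : I P) :
    ∃ R, Relation.ReflTransGen L P R ∧ ∀ Q, ¬ L R Q := by
  obtain ⟨m, hm⟩ : ∃ m, μ P = m := ⟨_, rfl⟩
  induction m using Nat.strong_induction_on generalizing P with
  | _ m ih =>
    by_cases hex : ∃ Q, L P Q
    · obtain ⟨Q, hQ⟩ := hex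
      obtain ⟨R, h1, h2⟩ := ih _ (hm ▸ hμ P Q hP hQ) (h P Q hP hQ) rfl
      exact ⟨R, .head hQ h1, h2⟩
    · exact ⟨P, .refl, fun Q hQ => hex ⟨Q, hQ⟩⟩

theorem terminal_unique (hL : ∀ P Q Q', L P Q → L P Q' → Q = Q') {P R R' : α}
    (h : Relation.ReflTransGen L P R) (h' : Relation.ReflTransGen L P R') (hR : ∀ Q, ¬ L R Q)
    (hR' : ∀ Q, ¬ L R' Q) : R = R' := by
  rcases Relation.ReflTransGen.total_of_right_unique (fun a b c => hL a b c) h h' with h1 | h1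
  · rcases h1.cases_head with h2 | ⟨Q, hQ, -⟩
    · exact h2
    · exact absurd hQ (hR Q)
  · rcases h1.cases_head with h2 | ⟨Q, hQ, -⟩
    · exact h2.symm
    · exact absurd hQ (hR' Q)

theorem exists_equiv_of_rel {F B : α → α → Prop} {S T : Finset α}
    (hF : ∀ P ∈ S, ∃ Q, F P Q) (hB : ∀ Q ∈ T, ∃ P, B Q P)
    (hFu : ∀ P ∈ S, ∀ Q Q', F P Q → F P Q' → Q = Q')
    (hBu : ∀ Q ∈ T, ∀ P P', B Q P → B Q P' → P = P')
    (hFB : ∀ P ∈ S, ∀ Q, F P Q → Q ∈ T ∧ B Q P) (hBF : ∀ Q ∈ T, ∀ P, B Q P → P ∈ S ∧ F P Q) :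
    ∃ Φ : ↥S ≃ ↥T, (∀ (P : ↥S) Q, F P.1 Q ↔ Q = (Φ P).1) ∧
      ∀ (Q : ↥T) P, B Q.1 P ↔ P = (Φ.symm Q).1 := by
  choose f hf using hF
  choose g hg using hB
  let Φ : ↥S ≃ ↥T :=
    { toFun := fun P => ⟨f P.1 P.2, (hFB _ P.2 _ (hf P.1 P.2)).1⟩
      invFun := fun Q => ⟨g Q.1 Q.2, (hBF _ Q.2 _ (hg Q.1 Q.2)).1⟩
      left_inv := fun P => by
        obtain ⟨h1, h2⟩ := hFB _ P.2 _ (hf P.1 P.2)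
        exact Subtype.ext (hBu _ h1 _ _ (hg _ h1) h2)
      right_inv := fun Q => by
        obtain ⟨h1, h2⟩ := hBF _ Q.2 _ (hg Q.1 Q.2)
        exact Subtype.ext (hFu _ h1 _ _ (hf _ h1) h2) }
  refine ⟨Φ, fun P Q => ⟨fun h => hFu _ P.2 _ _ h (hf P.1 P.2), ?_⟩,
    fun Q P => ⟨fun h => hBu _ Q.2 _ _ h (hg Q.1 Q.2), ?_⟩⟩
  · rintro rfl
    exact hf P.1 P.2
  · rintro rfl
    exact hg Q.1 Q.2

end PartialInverse

/-! ### Complete runs of the two algorithms and the bijection. -/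

section Runs

variable {n K : ℕ}

theorem mem_BNW_iff {k : ℕ} {P : SetPartition (n + 1)} : P ∈ BNW n k ↔
    ∀ i j : Fin k → Fin (n + 1), ¬ IsBlackCrossing P i j ∧ ¬ IsBlackWeakCrossing P i j := by
  simp only [BNW, Finset.mem_filter, Finset.mem_univ, true_and]

theorem mem_NC_iff {k : ℕ} {P : SetPartition n} : P ∈ NC n k ↔
    ∀ i j : Fin k → Fin n, ¬ IsCrossing P i j := by
  simp only [NC, Finset.mem_filter, Finset.mem_univ, true_and]

theorem forall_not_isXing_black_iff {k : ℕ} {P : SetPartition (n + 1)} :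
    (∀ D, ¬ IsXing (· < ·) (blackStrict P) k D) ↔
      ∀ i j : Fin k → Fin (n + 1), ¬ IsBlackCrossing P i j := by
  constructor
  · intro h i j hij
    have h' := isBlackCrossing_iff.1 hij
    exact h _ (isXing_of_fun h'.1 h'.2.1 h'.2.2.1 h'.2.2.2)
  · intro h D hD
    obtain ⟨i, j, hi, hj, -, -, hA, hr⟩ := hD.exists_fun
    exact h i j (isBlackCrossing_iff.2 ⟨hi, hj, hA, hr⟩)

theorem forall_not_isXing_iff {k : ℕ} {P : SetPartition n} :
    (∀ D, ¬ IsXing (· < ·) (strictArcs P) k D) ↔ ∀ i j : Fin k → Fin n, ¬ IsCrossing P i j := by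
  constructor
  · intro h i j hij
    have h' := isCrossing_iff.1 hij
    exact h _ (isXing_of_fun h'.1 h'.2.1 h'.2.2.1 h'.2.2.2)
  · intro h D hD
    obtain ⟨i, j, hi, hj, -, -, hA, hr⟩ := hD.exists_fun
    exact h i j (isCrossing_iff.2 ⟨hi, hj, hA, hr⟩)

/-- Without black `(K + 1)`-crossings an enhanced black one is weak. If weak ones are absent too,
the second clause of `ShiftInv` is vacuous. -/
theorem mem_BNW_succ_iff (hK : 1 ≤ K) {P : SetPartition (n + 1)} : P ∈ BNW n (K + 1) ↔
    ShiftInv K P ∧ ∀ i j : Fin (K + 1) → Fin (n + 1), ¬ IsBlackWeakCrossing P i j := by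
  rw [mem_BNW_iff]
  constructor
  · intro h
    have h1 := forall_not_isXing_black_iff.2 fun i j => (h i j).1
    refine ⟨⟨h1, fun c _ D hD => ?_⟩, fun i j => (h i j).2⟩
    obtain ⟨i, j, hi, hj, -, -, hA, hr⟩ := hD.exists_fun
    obtain ⟨i', j', h', -, -⟩ := exists_weakCrossingAt hK h1 hi hj hA hr
    exact absurd h' (h _ _).2
  · exact fun h i j => ⟨forall_not_isXing_black_iff.1 h.1.1 i j, h.2 i j⟩

theorem mem_NC_succ_iff {Q : SetPartition (n + 1)} : Q ∈ NC (n + 1) (K + 1) ↔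
    RotInv K Q ∧ ¬ HasRedCrossing (K + 1) Q := by
  rw [mem_NC_iff]
  constructor
  · intro h
    refine ⟨⟨forall_not_isXing_black_iff.2 fun i j hij => h i j hij.1, fun c _ D hD => ?_⟩,
      fun ⟨i, j, hij, _⟩ => h i j hij⟩
    exact absurd hD (forall_not_isXing_iff.2 h D)
  · rintro ⟨h1, h2⟩ i j hij
    by_cases hr : ∃ p, i p ∈ red Q
    · exact h2 ⟨i, j, hij, hr⟩
    · exact forall_not_isXing_black_iff.1 h1.1 i j ⟨hij, fun s hs => hr ⟨s, hs⟩⟩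

/-- The meeting point of the two phases: without covered red nodes only the common first clause
remains. -/
theorem shiftInv_iff_rotInv {P : SetPartition (n + 1)} (h : coveredRed K P = ∅) :
    ShiftInv K P ↔ RotInv K P := by
  constructor
  · exact fun h' => ⟨h'.1, fun c hc => by rw [h] at hc; exact hc.elim⟩
  · exact fun h' => ⟨h'.1, fun c hc => by rw [h] at hc; exact hc.elim⟩

theorem coveredRed_eq_empty_of_mem_BNW {P : SetPartition (n + 1)} (h : P ∈ BNW n K) :
    coveredRed K P = ∅ := by
  rw [Set.eq_empty_iff_forall_notMem]
  rintro c ⟨-, i, j, hij, -⟩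
  exact (mem_BNW_iff.1 h i j).1 hij

/-- Dropping the only red arc of a red `(K + 1)`-crossing leaves a black `K`-crossing. -/
theorem not_hasRedCrossing_of_mem_BNW {P : SetPartition (n + 1)} (h : P ∈ BNW n K) :
    ¬ HasRedCrossing (K + 1) P := by
  intro hr
  obtain ⟨a, b, i, j, T, hd⟩ := exists_rotationData hr
  have hc := isCrossing_iff.1 hd.crossing
  refine (mem_BNW_iff.1 h (fun s => insertAt T b i (T.succAbove s))
    (fun s => prepend a j (T.succAbove s))).1 (isBlackCrossing_iff.2 ⟨?_, ?_, ?_, ?_⟩)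
  · exact fun s s' hs => hc.1 (Fin.strictMono_succAbove T hs)
  · exact fun s s' hs => hc.2.1 (Fin.strictMono_succAbove T hs)
  · exact fun s => ⟨hc.2.2.1 _, hd.notMem_red (Fin.succAbove_ne T s)⟩
  · exact fun s s' => hc.2.2.2 _ _

/-- Dropping the arc that ends at the centre of a weak `(K + 1)`-crossing leaves a `K`-crossing. -/
theorem not_isBlackWeakCrossing_of_mem_BNW (hK : 1 ≤ K) {P : SetPartition (n + 1)}
    (h : P ∈ BNW n K) (i j : Fin (K + 1) → Fin (n + 1)) : ¬ IsBlackWeakCrossing P i j := by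
  intro hij
  have hc := (isBlackWeakCrossing_iff hK).1 hij
  refine (mem_BNW_iff.1 h (fun s => i s.succ) (fun s => j s.succ)).1
    (isBlackCrossing_iff.2 ⟨?_, ?_, fun s => hc.2.2.1 s.succ, fun s s' => ?_⟩)
  · exact fun s s' hs => hc.1 (Fin.succ_lt_succ_iff.2 hs)
  · exact fun s s' hs => hc.2.1 (Fin.succ_lt_succ_iff.2 hs)
  · exact ((hc.1.monotone (Fin.le_last s.succ)).trans_eq hc.2.2.2).trans_lt
      (hc.2.1 (Fin.succ_pos s'))

theorem not_leftShift_iff (hK : 1 ≤ K) {P : SetPartition (n + 1)} :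
    (∀ Q, ¬ LeftShift (K + 1) P Q) ↔ coveredRed K P = ∅ := by
  constructor
  · intro h
    rw [← Set.not_nonempty_iff_eq_empty]
    intro hne
    obtain ⟨Q, hQ⟩ := leftShift_exists hK hne
    exact h Q hQ
  · rintro h Q ⟨a, i, j, ha, -⟩
    exact Set.notMem_empty a (h ▸ ha.1)

theorem not_undoRotation_iff (hK : 1 ≤ K) {P : SetPartition (n + 1)} (hP : RotInv K P) :
    (∀ Q, ¬ UndoRotation (K + 1) P Q) ↔ coveredRed K P = ∅ := by
  constructor
  · intro h
    rw [← Set.not_nonempty_iff_eq_empty]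
    intro hne
    obtain ⟨Q, hQ⟩ := undoRotation_exists hK hP hne
    exact h Q hQ
  · rintro h Q hQ
    obtain ⟨a, b, i, j, T, hd, -⟩ := undoRotation_iff.1 hQ
    exact Set.notMem_empty a (h ▸ hd.least.1)

theorem not_undoShift_iff (hK : 1 ≤ K) {Q : SetPartition (n + 1)} :
    (∀ P, ¬ UndoShift (K + 1) Q P) ↔
      ∀ i j : Fin (K + 1) → Fin (n + 1), ¬ IsBlackWeakCrossing Q i j := by
  constructor
  · intro h i j hij
    obtain ⟨P, hP⟩ := undoShift_exists hK ⟨i, j, hij⟩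
    exact h P hP
  · rintro h P ⟨a, i, j, -, hij, -⟩
    exact h _ _ hij

theorem not_cyclicRotation_iff {Q : SetPartition (n + 1)} (hQ : RotInv K Q) :
    (∀ P, ¬ CyclicRotation (K + 1) Q P) ↔ ¬ HasRedCrossing (K + 1) Q := by
  constructor
  · intro h hr
    obtain ⟨P, hP⟩ := cyclicRotation_exists hQ hr
    exact h P hP
  · rintro h P ⟨i, j, p, hij, hp, -⟩
    exact h ⟨i, j, hij, p, hp⟩

theorem LeftShift.card_red_lt {k : ℕ} {P Q : SetPartition (n + 1)} (h : LeftShift k P Q) :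
    (red Q).card < (red P).card := by
  obtain ⟨a, i, j, ha, -, hr, -⟩ := h
  rw [hr]
  refine Finset.card_lt_card (Finset.sdiff_ssubset (Finset.singleton_subset_iff.2 ha.1.1)
    (Finset.singleton_nonempty a))

/-- The number of nodes weakly to the right of some covered red node. -/
noncomputable def coverage (K : ℕ) (P : SetPartition (n + 1)) : ℕ :=
  {c : Fin (n + 1) | ∃ a ∈ coveredRed K P, a ≤ c}.ncard

theorem coverage_lt {P Q : SetPartition (n + 1)}
    (h : ∃ a ∈ coveredRed K P, ∀ c ∈ coveredRed K Q, a < c) : coverage K Q < coverage K P := by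
  obtain ⟨a, ha, h⟩ := h
  refine Set.ncard_lt_ncard ((Set.ssubset_iff_of_subset ?_).2 ⟨a, ⟨a, ha, le_rfl⟩, ?_⟩)
    (Set.toFinite _)
  · rintro c ⟨d, hd, hdc⟩
    exact ⟨a, ha, (h d hd).le.trans hdc⟩
  · rintro ⟨d, hd, hda⟩
    exact (h d hd).not_ge hda

theorem coverage_le (K : ℕ) (P : SetPartition (n + 1)) : coverage K P ≤ n + 1 := by
  have := Set.ncard_le_card {c : Fin (n + 1) | ∃ a ∈ coveredRed K P, a ≤ c}
  rwa [Nat.card_fin] at this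

/-- A complete sequence of enhanced left shifts followed by cyclic rotations. -/
def Forward (K : ℕ) (P Q : SetPartition (n + 1)) : Prop :=
  ∃ R, Relation.ReflTransGen (LeftShift (K + 1)) P R ∧ coveredRed K R = ∅ ∧
    Relation.ReflTransGen (CyclicRotation (K + 1)) R Q ∧ ¬ HasRedCrossing (K + 1) Q

/-- A complete sequence undoing cyclic rotations and then enhanced left shifts. -/
def Backward (K : ℕ) (Q P : SetPartition (n + 1)) : Prop :=
  ∃ R, Relation.ReflTransGen (UndoRotation (K + 1)) Q R ∧ coveredRed K R = ∅ ∧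
    Relation.ReflTransGen (UndoShift (K + 1)) R P ∧
    ∀ i j : Fin (K + 1) → Fin (n + 1), ¬ IsBlackWeakCrossing P i j

theorem eq_of_reflTransGen {α : Type*} {L : α → α → Prop} {P Q : α}
    (h : Relation.ReflTransGen L P Q) (hP : ∀ R, ¬ L P R) : Q = P := by
  rcases h.cases_head with h2 | ⟨R, hR, -⟩
  · exact h2.symm
  · exact absurd hR (hP R)

/-- The early return is not a separate case: for such `P` neither a left shift nor a rotation is
possible, so the complete sequence of operations is empty as well. -/
theorem forwardRun_iff (hK : 1 ≤ K) {P Q : SetPartition (n + 1)} (hP : P ∈ BNW n (K + 1)) :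
    ForwardRun (K + 1) P Q ↔ Forward K P Q := by
  constructor
  · rintro (⟨h, rfl⟩ | ⟨-, h⟩)
    · exact ⟨Q, .refl, coveredRed_eq_empty_of_mem_BNW h, .refl, not_hasRedCrossing_of_mem_BNW h⟩
    · exact h
  · intro h
    by_cases hb : P ∈ BNW n K
    · refine Or.inl ⟨hb, ?_⟩
      obtain ⟨R, h1, h2, h3, h4⟩ := h
      have hc := coveredRed_eq_empty_of_mem_BNW hb
      obtain rfl := eq_of_reflTransGen h1 ((not_leftShift_iff hK).2 hc)
      exact eq_of_reflTransGen h3 ((not_cyclicRotation_iff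
        ((shiftInv_iff_rotInv hc).1 ((mem_BNW_succ_iff hK).1 hP).1)).2
        (not_hasRedCrossing_of_mem_BNW hb))
    · exact Or.inr ⟨hb, h⟩

theorem backwardRun_iff (hK : 1 ≤ K) {P Q : SetPartition (n + 1)} (hQ : Q ∈ NC (n + 1) (K + 1)) :
    BackwardRun (K + 1) Q P ↔ Backward K Q P := by
  constructor
  · rintro (⟨h, rfl⟩ | ⟨-, h⟩)
    · exact ⟨P, .refl, coveredRed_eq_empty_of_mem_BNW h, .refl,
        not_isBlackWeakCrossing_of_mem_BNW hK h⟩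
    · exact h
  · intro h
    by_cases hb : Q ∈ BNW n K
    · refine Or.inl ⟨hb, ?_⟩
      obtain ⟨R, h1, h2, h3, h4⟩ := h
      obtain rfl := eq_of_reflTransGen h1 ((not_undoRotation_iff hK (mem_NC_succ_iff.1 hQ).1).2
        (coveredRed_eq_empty_of_mem_BNW hb))
      exact eq_of_reflTransGen h3 ((not_undoShift_iff hK).2
        (not_isBlackWeakCrossing_of_mem_BNW hK hb))
    · exact Or.inr ⟨hb, h⟩

theorem shift_step (hK : 1 ≤ K) (P Q : SetPartition (n + 1)) (hP : ShiftInv K P)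
    (h : LeftShift (K + 1) P Q) : ShiftInv K Q ∧ UndoShift (K + 1) Q P :=
  ⟨(leftShift_forward hK hP h).1, (leftShift_forward hK hP h).2.1⟩

theorem undoRotation_step (P Q : SetPartition (n + 1)) (hP : RotInv K P)
    (h : UndoRotation (K + 1) P Q) : RotInv K Q ∧ CyclicRotation (K + 1) Q P :=
  ⟨(undoRotation_forward hP h).1, (undoRotation_forward hP h).2.1⟩

theorem rotation_step (Q P : SetPartition (n + 1)) (hQ : RotInv K Q)
    (h : CyclicRotation (K + 1) Q P) : RotInv K P ∧ UndoRotation (K + 1) P Q :=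
  cyclicRotation_backward hQ h

theorem undoShift_step (hK : 1 ≤ K) (Q P : SetPartition (n + 1)) (hQ : ShiftInv K Q)
    (h : UndoShift (K + 1) Q P) : ShiftInv K P ∧ LeftShift (K + 1) P Q :=
  undoShift_backward hK hQ h

theorem rotation_numBlocks {Q P : SetPartition (n + 1)} (hQ : RotInv K Q)
    (h : CyclicRotation (K + 1) Q P) : numBlocks P = numBlocks Q :=
  have h' := cyclicRotation_backward hQ h
  (undoRotation_forward h'.1 h'.2).2.2.1.symm

theorem forward_spec (hK : 1 ≤ K) {P Q : SetPartition (n + 1)} (hP : P ∈ BNW n (K + 1))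
    (h : Forward K P Q) :
    Q ∈ NC (n + 1) (K + 1) ∧ Backward K Q P ∧ numBlocks Q = numBlocks P := by
  obtain ⟨R, h1, h2, h3, h4⟩ := h
  obtain ⟨hP1, hP2⟩ := (mem_BNW_succ_iff hK).1 hP
  obtain ⟨hR, h1'⟩ := reflTransGen_inverse (shift_step hK) hP1 h1
  have hR' := (shiftInv_iff_rotInv h2).1 hR
  obtain ⟨hQ, h3'⟩ := reflTransGen_inverse rotation_step hR' h3
  refine ⟨mem_NC_succ_iff.2 ⟨hQ, h4⟩, ⟨R, h3', h2, h1', hP2⟩, ?_⟩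
  have hn1 : numBlocks R = numBlocks P := reflTransGen_congr (L := LeftShift (K + 1))
    (fun P Q hP h => ⟨(leftShift_forward hK hP h).1, (leftShift_forward hK hP h).2.2⟩) hP1 h1
  have hn2 : numBlocks Q = numBlocks R := reflTransGen_congr (L := CyclicRotation (K + 1))
    (fun P Q hP h => ⟨(cyclicRotation_backward hP h).1, rotation_numBlocks hP h⟩) hR' h3
  exact hn2.trans hn1

theorem backward_spec (hK : 1 ≤ K) {P Q : SetPartition (n + 1)} (hQ : Q ∈ NC (n + 1) (K + 1))
    (h : Backward K Q P) : P ∈ BNW n (K + 1) ∧ Forward K P Q := by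
  obtain ⟨R, h1, h2, h3, h4⟩ := h
  obtain ⟨hQ1, hQ2⟩ := mem_NC_succ_iff.1 hQ
  obtain ⟨hR, h1'⟩ := reflTransGen_inverse undoRotation_step hQ1 h1
  obtain ⟨hP, h3'⟩ := reflTransGen_inverse (undoShift_step hK)
    ((shiftInv_iff_rotInv h2).2 hR) h3
  exact ⟨(mem_BNW_succ_iff hK).2 ⟨hP, h4⟩, R, h3', h2, h1', hQ2⟩

theorem forward_exists (hK : 1 ≤ K) {P : SetPartition (n + 1)} (hP : P ∈ BNW n (K + 1)) :
    ∃ Q, Forward K P Q := by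
  have hP1 := ((mem_BNW_succ_iff hK).1 hP).1
  obtain ⟨R, h1, h2⟩ := exists_terminal (L := LeftShift (K + 1)) (μ := fun P => (red P).card)
    (fun P Q hP h => (shift_step hK P Q hP h).1) (fun _ _ _ h => h.card_red_lt) hP1
  rw [not_leftShift_iff hK] at h2
  have hR := (shiftInv_iff_rotInv h2).1 (reflTransGen_inverse (shift_step hK) hP1 h1).1
  obtain ⟨Q, h3, h4⟩ := exists_terminal (L := CyclicRotation (K + 1))
    (μ := fun P => n + 1 - coverage K P)
    -- Undoing a rotation lowers `coverage`, so a rotation raises it, and it is bounded by `n + 1`.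
    (fun P Q hP h => (cyclicRotation_backward hP h).1) (fun P Q hP h => by
      obtain ⟨h5, h6⟩ := cyclicRotation_backward hP h
      have h7 := coverage_lt (undoRotation_forward h5 h6).2.2.2
      have h8 := coverage_le K Q
      omega) hR
  have hQ := (reflTransGen_inverse rotation_step hR h3).1
  exact ⟨Q, R, h1, h2, h3, (not_cyclicRotation_iff hQ).1 h4⟩

theorem backward_exists (hK : 1 ≤ K) {Q : SetPartition (n + 1)} (hQ : Q ∈ NC (n + 1) (K + 1)) :
    ∃ P, Backward K Q P := by
  have hQ1 := (mem_NC_succ_iff.1 hQ).1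
  obtain ⟨R, h1, h2⟩ := exists_terminal (L := UndoRotation (K + 1)) (μ := coverage K)
    (fun P Q hP h => (undoRotation_step P Q hP h).1)
    (fun P Q hP h => coverage_lt (undoRotation_forward hP h).2.2.2) hQ1
  have hR := (reflTransGen_inverse undoRotation_step hQ1 h1).1
  rw [not_undoRotation_iff hK hR] at h2
  obtain ⟨P, h3, h4⟩ := exists_terminal (L := UndoShift (K + 1))
    (μ := fun P => n + 1 - (red P).card)
    (fun P Q hP h => (undoShift_backward hK hP h).1) (fun P Q hP h => by
      have h7 := (undoShift_backward hK hP h).2.card_red_lt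
      have h8 := Finset.card_le_univ (red Q)
      rw [Fintype.card_fin] at h8
      omega) ((shiftInv_iff_rotInv h2).2 hR)
  exact ⟨P, R, h1, h2, h3, (not_undoShift_iff hK).1 h4⟩

theorem forward_unique (hK : 1 ≤ K) {P Q Q' : SetPartition (n + 1)} (hP : P ∈ BNW n (K + 1))
    (h : Forward K P Q) (h' : Forward K P Q') : Q = Q' := by
  have hP1 := ((mem_BNW_succ_iff hK).1 hP).1
  obtain ⟨R, h1, h2, h3, h4⟩ := h
  obtain ⟨R', h1', h2', h3', h4'⟩ := h'
  obtain rfl := terminal_unique (L := LeftShift (K + 1)) (fun _ _ _ => LeftShift.unique) h1 h1'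
    ((not_leftShift_iff hK).2 h2) ((not_leftShift_iff hK).2 h2')
  have hR := (shiftInv_iff_rotInv h2).1 (reflTransGen_inverse (shift_step hK) hP1 h1).1
  have hQ := (reflTransGen_inverse rotation_step hR h3).1
  have hQ' := (reflTransGen_inverse rotation_step hR h3').1
  exact terminal_unique (L := CyclicRotation (K + 1)) (fun _ _ _ => CyclicRotation.unique) h3 h3'
    ((not_cyclicRotation_iff hQ).2 h4) ((not_cyclicRotation_iff hQ').2 h4')

theorem backward_unique (hK : 1 ≤ K) {Q P P' : SetPartition (n + 1)}
    (hQ : Q ∈ NC (n + 1) (K + 1)) (h : Backward K Q P) (h' : Backward K Q P') : P = P' := by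
  have hQ1 := (mem_NC_succ_iff.1 hQ).1
  obtain ⟨R, h1, h2, h3, h4⟩ := h
  obtain ⟨R', h1', h2', h3', h4'⟩ := h'
  have hR := (reflTransGen_inverse undoRotation_step hQ1 h1).1
  have hR' := (reflTransGen_inverse undoRotation_step hQ1 h1').1
  obtain rfl := terminal_unique (L := UndoRotation (K + 1)) (fun _ _ _ => UndoRotation.unique) h1
    h1'
    ((not_undoRotation_iff hK hR).2 h2) ((not_undoRotation_iff hK hR').2 h2')
  exact terminal_unique (L := UndoShift (K + 1)) (fun _ _ _ => UndoShift.unique hK) h3 h3'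
    ((not_undoShift_iff hK).2 h4) ((not_undoShift_iff hK).2 h4')

/-- The bijection computed by the two algorithms. -/
theorem exists_bijection (n : ℕ) (hK : 1 ≤ K) :
    ∃ Φ : ↥(BNW n (K + 1)) ≃ ↥(NC (n + 1) (K + 1)),
      (∀ (P : ↥(BNW n (K + 1))) (Q : SetPartition (n + 1)),
        ForwardRun (K + 1) P.1 Q ↔ Q = (Φ P).1) ∧
      (∀ (Q : ↥(NC (n + 1) (K + 1))) (P : SetPartition (n + 1)),
        BackwardRun (K + 1) Q.1 P ↔ P = (Φ.symm Q).1) ∧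
      ∀ P : ↥(BNW n (K + 1)), numBlocks (Φ P).1 = numBlocks P.1 := by
  obtain ⟨Φ, h1, h2⟩ := exists_equiv_of_rel (F := Forward K) (B := Backward K)
    (fun P => forward_exists hK) (fun Q => backward_exists hK)
    (fun P hP Q Q' => forward_unique hK hP) (fun Q hQ P P' => backward_unique hK hQ)
    (fun P hP Q h => ⟨(forward_spec hK hP h).1, (forward_spec hK hP h).2.1⟩)
    (fun Q hQ P => backward_spec hK hQ)
  exact ⟨Φ, fun P Q => (forwardRun_iff hK P.2).trans (h1 P Q),
    fun Q P => (backwardRun_iff hK Q.2).trans (h2 Q P),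
    fun P => (forward_spec hK P.2 ((h1 P _).2 rfl)).2.2⟩

end Runs

/-! ### Deleting the red block and comparing generating functions. -/

section Enumeration

variable {n m : ℕ}

theorem mem_NW_iff {k : ℕ} {P : SetPartition n} : P ∈ NW n k ↔
    ∀ i j : Fin k → Fin n, ¬ IsEnhancedCrossing P i j := by
  simp only [NW, Finset.mem_filter, Finset.mem_univ, true_and]

/-- The nodes of `P` outside the range of `f` are red, and the black arcs of `P` are the arcs of
`P'`, relabelled by `f`. -/
structure IsRelabelling (f : Fin m ↪o Fin (n + 1)) (P' : SetPartition m)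
    (P : SetPartition (n + 1)) : Prop where
  mem_red : ∀ c, c ∈ red P ↔ c ∉ Set.range f
  arcs : blackStrict P = Prod.map f f '' strictArcs P'

theorem exists_relabelling (f : Fin m ↪o Fin (n + 1)) (h0 : 0 ∉ Set.range f)
    (P' : SetPartition m) : ∃ P, IsRelabelling f P' P := by
  classical
  obtain ⟨P, h1, h2⟩ := exists_partition_of_black
    (Finset.univ.filter fun c => c ∉ Set.range f) (Prod.map f f '' strictArcs P')
    (by simpa using h0)
    (by
      rintro _ ⟨e, he, rfl⟩
      exact f.strictMono he.1)
    (by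
      rintro _ ⟨e, he, rfl⟩ _ ⟨e', he', rfl⟩ h
      rw [strictArcs_inj_fst P' e he e' he' (f.injective h)])
    (by
      rintro _ ⟨e, he, rfl⟩ _ ⟨e', he', rfl⟩ h
      rw [strictArcs_inj_snd P' e he e' he' (f.injective h)])
    (by
      rintro _ ⟨e, he, rfl⟩
      simp)
  refine ⟨P, fun c => ?_, h2⟩
  rw [h1, Finset.mem_filter]
  simp only [Finset.mem_univ, true_and]

theorem exists_of_relabelling (f : Fin m ↪o Fin (n + 1)) {P : SetPartition (n + 1)}
    (hP : ∀ c, c ∈ red P ↔ c ∉ Set.range f) : ∃ P', IsRelabelling f P' P := by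
  obtain ⟨P', h⟩ := exists_partition_of_arcs (Prod.map f f ⁻¹' blackStrict P)
    (fun e he => f.lt_iff_lt.1 he.1.1)
    (fun e he e' he' h => (f.injective.prodMap f.injective)
      (strictArcs_inj_fst P _ he.1 _ he'.1 (congrArg f h)))
    (fun e he e' he' h => (f.injective.prodMap f.injective)
      (strictArcs_inj_snd P _ he.1 _ he'.1 (congrArg f h)))
  refine ⟨P', hP, ?_⟩
  rw [h, Set.image_preimage_eq_of_subset]
  intro e he
  obtain ⟨u, hu⟩ := not_not.1 (mt (hP e.1).2 he.2)
  obtain ⟨v, hv⟩ := not_not.1 (mt (hP e.2).2 (blackStrict_snd_notMem_red he))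
  exact ⟨(u, v), Prod.ext hu hv⟩

namespace IsRelabelling

variable {f : Fin m ↪o Fin (n + 1)} {P' : SetPartition m} {P : SetPartition (n + 1)}

theorem mem_arcs (h : IsRelabelling f P' P) {u v : Fin m} :
    (f u, f v) ∈ blackStrict P ↔ (u, v) ∈ strictArcs P' := by
  rw [h.arcs]
  exact (f.injective.prodMap f.injective).mem_set_image (a := (u, v))

theorem exists_words (h : IsRelabelling f P' P) {k : ℕ} {i j : Fin k → Fin (n + 1)}
    (hij : ∀ s, (i s, j s) ∈ blackStrict P) : ∃ i' j' : Fin k → Fin m,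
      (∀ s, i s = f (i' s)) ∧ (∀ s, j s = f (j' s)) ∧ ∀ s, (i' s, j' s) ∈ strictArcs P' := by
  have : ∀ s, ∃ e ∈ strictArcs P', Prod.map f f e = (i s, j s) := fun s => by
    have := hij s
    rwa [h.arcs] at this
  choose e he he' using this
  exact ⟨fun s => (e s).1, fun s => (e s).2, fun s => (congrArg Prod.fst (he' s)).symm,
    fun s => (congrArg Prod.snd (he' s)).symm, he⟩

theorem mem_BNW_iff (h : IsRelabelling f P' P) {K : ℕ} (hK : 1 ≤ K) :
    P ∈ BNW n (K + 1) ↔ P' ∈ NW m (K + 1) := by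
  rw [KNoncrossing.mem_BNW_iff, mem_NW_iff]
  constructor
  · rintro hP i j (hij | hij)
    · have hc := isCrossing_iff.1 hij
      exact (hP (f ∘ i) (f ∘ j)).1 (isBlackCrossing_iff.2 ⟨f.strictMono.comp hc.1,
        f.strictMono.comp hc.2.1, fun s => h.mem_arcs.2 (hc.2.2.1 s),
        fun s s' => f.strictMono (hc.2.2.2 s s')⟩)
    · have hc := (isWeakCrossing_iff hK).1 hij
      exact (hP (f ∘ i) (f ∘ j)).2 ((isBlackWeakCrossing_iff hK).2 ⟨f.strictMono.comp hc.1,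
        f.strictMono.comp hc.2.1, fun s => h.mem_arcs.2 (hc.2.2.1 s),
        congrArg f hc.2.2.2⟩)
  · intro hP i j
    constructor
    · intro hij
      have hc := isBlackCrossing_iff.1 hij
      obtain ⟨i', j', hi, hj, hA⟩ := h.exists_words hc.2.2.1
      refine hP i' j' (Or.inl (isCrossing_iff.2 ⟨fun s s' hs => ?_, fun s s' hs => ?_, hA,
        fun s s' => ?_⟩))
      · rw [← f.lt_iff_lt, ← hi, ← hi]
        exact hc.1 hs
      · rw [← f.lt_iff_lt, ← hj, ← hj]
        exact hc.2.1 hs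
      · rw [← f.lt_iff_lt, ← hi, ← hj]
        exact hc.2.2.2 s s'
    · intro hij
      have hc := (isBlackWeakCrossing_iff hK).1 hij
      obtain ⟨i', j', hi, hj, hA⟩ := h.exists_words hc.2.2.1
      refine hP i' j' (Or.inr ((isWeakCrossing_iff hK).2 ⟨fun s s' hs => ?_, fun s s' hs => ?_,
        hA, ?_⟩))
      · rw [← f.lt_iff_lt, ← hi, ← hi]
        exact hc.1 hs
      · rw [← f.lt_iff_lt, ← hj, ← hj]
        exact hc.2.1 hs
      · exact f.injective (by rw [← hi, ← hj]; exact hc.2.2.2)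

/-- The additional block is the red one, counted by the node `0`; every other red node has an
incoming arc. -/
theorem numBlocks_eq (h : IsRelabelling f P' P) : numBlocks P = numBlocks P' + 1 := by
  classical
  rw [numBlocks_eq_card, numBlocks_eq_card]
  have h0 : (0 : Fin (n + 1)) ∉ Set.range f := (h.mem_red 0).1 (zero_mem_red P)
  rw [← Finset.card_map f.toEmbedding, ← Finset.card_insert_of_notMem (a := (0 : Fin (n + 1)))]
  · congr 1
    ext c
    simp only [Finset.mem_filter, Finset.mem_univ, true_and, Finset.mem_insert, Finset.mem_map,
      RelEmbedding.coe_toEmbedding]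
    rw [← not_exists, exists_snd_iff, h.mem_red]
    constructor
    · intro hc
      push Not at hc
      by_cases hr : c ∈ Set.range f
      · obtain ⟨d, rfl⟩ := hr
        exact Or.inr ⟨d, fun u hu => hc.2 (f u) (h.mem_arcs.2 hu), rfl⟩
      · exact Or.inl (hc.1 hr)
    · rintro (rfl | ⟨d, hd, rfl⟩)
      · rintro (⟨-, hc⟩ | ⟨u, hu⟩)
        · exact hc rfl
        · exact (Fin.not_lt_zero u) hu.1.1
      · rintro (⟨hc, -⟩ | ⟨u, hu⟩)
        · exact hc ⟨d, rfl⟩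
        · obtain ⟨w, hw⟩ := not_not.1 (mt (h.mem_red u).2 hu.2)
          rw [← hw] at hu
          exact hd w (h.mem_arcs.1 hu)
  · intro hmem
    obtain ⟨d, -, hd⟩ := Finset.mem_map.1 hmem
    exact h0 ⟨d, hd⟩

theorem unique_left (h : IsRelabelling f P' P) {P'' : SetPartition m}
    (h' : IsRelabelling f P'' P) : P' = P'' :=
  eq_of_strictArcs_eq ((f.injective.prodMap f.injective).image_injective
    (h.arcs.symm.trans h'.arcs))

theorem unique_right (h : IsRelabelling f P' P) {Q : SetPartition (n + 1)}
    (h' : IsRelabelling f P' Q) : P = Q :=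
  eq_of_red_black (Finset.ext fun c => (h.mem_red c).trans (h'.mem_red c).symm)
    (h.arcs.trans h'.arcs.symm)

end IsRelabelling

theorem sum_weight_red {K : ℕ} (hK : 1 ≤ K) (A : Finset (Fin (n + 1))) (hA : 0 ∉ A) :
    ∑ P ∈ BNW n (K + 1) with red P = Finset.univ \ A, weight P =
      X * ∑ P ∈ NW A.card (K + 1), weight P := by
  have hrange : Set.range (A.orderEmbOfFin rfl) = A := A.range_orderEmbOfFin rfl
  have hred : ∀ P : SetPartition (n + 1), red P = Finset.univ \ A ↔
      ∀ c, c ∈ red P ↔ c ∉ Set.range (A.orderEmbOfFin rfl) := by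
    intro P
    rw [Finset.ext_iff, hrange]
    simp only [Finset.mem_sdiff, Finset.mem_univ, true_and, Finset.mem_coe]
  choose g hg using exists_relabelling (A.orderEmbOfFin rfl) (by rw [hrange]; exact hA)
  rw [Finset.mul_sum]
  symm
  refine Finset.sum_bij (fun P' _ => g P') ?_ ?_ ?_ ?_
  · intro P' hP'
    rw [Finset.mem_filter]
    exact ⟨((hg P').mem_BNW_iff hK).2 hP', (hred _).2 (hg P').mem_red⟩
  · intro P' _ P'' _ h
    exact (hg P').unique_left (h ▸ hg P'')
  · intro P hP
    rw [Finset.mem_filter] at hP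
    obtain ⟨P', h⟩ := exists_of_relabelling _ ((hred P).1 hP.2)
    exact ⟨P', (h.mem_BNW_iff hK).1 hP.1, (hg P').unique_right h⟩
  · intro P' _
    rw [weight, weight, (hg P').numBlocks_eq, pow_succ']

/-- Partitions are grouped by their set of black nodes, an arbitrary set of nodes other than `0`; of
size `i` there are `n.choose i`. -/
theorem sum_weight_BNW {K : ℕ} (hK : 1 ≤ K) :
    ∑ P ∈ BNW n (K + 1), weight P = X * ∑ i ∈ Finset.range (n + 1),
      (n.choose i : ℕ[X]) * ∑ P ∈ NW i (K + 1), weight P := by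
  have hmaps : ∀ P ∈ BNW n (K + 1), Finset.univ \ red P ∈
      ((Finset.univ : Finset (Fin (n + 1))).erase 0).powerset := by
    intro P _
    rw [Finset.mem_powerset]
    intro c hc
    rw [Finset.mem_sdiff] at hc
    refine Finset.mem_erase.2 ⟨?_, Finset.mem_univ c⟩
    rintro rfl
    exact hc.2 (zero_mem_red P)
  rw [← Finset.sum_fiberwise_of_maps_to hmaps]
  have hstep : ∀ A ∈ ((Finset.univ : Finset (Fin (n + 1))).erase 0).powerset,
      ∑ P ∈ BNW n (K + 1) with Finset.univ \ red P = A, weight P =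
        X * ∑ P ∈ NW A.card (K + 1), weight P := by
    intro A hA
    rw [← sum_weight_red hK A fun h0 => Finset.notMem_erase 0 _ (Finset.mem_powerset.1 hA h0)]
    refine Finset.sum_congr (Finset.filter_congr fun P _ => ?_) fun _ _ => rfl
    constructor
    · rintro rfl
      rw [Finset.sdiff_sdiff_eq_self (Finset.subset_univ _)]
    · intro h
      rw [h, Finset.sdiff_sdiff_eq_self (Finset.subset_univ _)]
  rw [Finset.sum_congr rfl hstep, Finset.sum_powerset_apply_card
    (fun i => X * ∑ P ∈ NW i (K + 1), weight P),
    Finset.card_erase_of_mem (Finset.mem_univ _), Finset.card_univ, Fintype.card_fin,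
    Nat.add_sub_cancel, Finset.mul_sum]
  refine Finset.sum_congr rfl fun i _ => ?_
  rw [nsmul_eq_mul, mul_left_comm]

end Enumeration

end KNoncrossing

theorem mainTheorem2 (n k : ℕ) (hk : 2 ≤ k) :
    (∃ Φ : ↥(KNoncrossing.BNW n k) ≃ ↥(KNoncrossing.NC (n + 1) k),
      (∀ (P : ↥(KNoncrossing.BNW n k)) (Q : KNoncrossing.SetPartition (n + 1)),
        KNoncrossing.ForwardRun k P.1 Q ↔ Q = (Φ P).1) ∧
      (∀ (Q : ↥(KNoncrossing.NC (n + 1) k)) (P : KNoncrossing.SetPartition (n + 1)),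
        KNoncrossing.BackwardRun k Q.1 P ↔ P = (Φ.symm Q).1) ∧
      (∀ P : ↥(KNoncrossing.BNW n k),
        KNoncrossing.numBlocks (Φ P).1 = KNoncrossing.numBlocks P.1)) ∧
    (∑ P ∈ KNoncrossing.BNW n k, KNoncrossing.weight P =
      ∑ P ∈ KNoncrossing.NC (n + 1) k, KNoncrossing.weight P) ∧
    (∀ A : Finset (Fin (n + 1)), 0 ∉ A →
      ∑ P ∈ KNoncrossing.BNW n k with KNoncrossing.red P = Finset.univ \ A,
          KNoncrossing.weight P =
        X * ∑ P ∈ KNoncrossing.NW A.card k, KNoncrossing.weight P) ∧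
    (∑ P ∈ KNoncrossing.BNW n k, KNoncrossing.weight P =
      X * ∑ i ∈ Finset.range (n + 1),
        (n.choose i : ℕ[X]) * ∑ P ∈ KNoncrossing.NW i k, KNoncrossing.weight P) := by
  obtain ⟨K, rfl⟩ : ∃ K, k = K + 1 := ⟨k - 1, by omega⟩
  have hK : 1 ≤ K := by omega
  obtain ⟨Φ, hF, hB, hn⟩ := KNoncrossing.exists_bijection n hK
  refine ⟨⟨Φ, hF, hB, hn⟩, ?_, KNoncrossing.sum_weight_red hK, KNoncrossing.sum_weight_BNW hK⟩
  rw [← Finset.sum_coe_sort, ← Finset.sum_coe_sort (KNoncrossing.NC (n + 1) (K + 1))]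
  refine Fintype.sum_equiv Φ _ _ fun P => ?_
  rw [KNoncrossing.weight, KNoncrossing.weight, hn P]
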